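/- Let $\alpha_1>0$, $\alpha_2\in\mathbb R$, $\alpha_3\neq 0$ be real, let $(u_n)_{n\ge1}$ be defined by $u_1=1$ and $u_n=(\alpha_1n+\alpha_2)u_{n-1}+\alpha_3\sum_{j=1}^{n-1}u_ju_{n-j}$ for $n\ge2$, and put $k=1/\alpha_1$, $a=\alpha_3/\alpha_1$, $b=-1-\alpha_2/\alpha_1$. Let $M(a,b,z)=\sum_{r\ge0}\frac{(a)_r}{(b)_r}\frac{z^r}{r!}$, and on the plane cut along $(-\infty,0]$ (principal powers) let $$U(a,b,z)=\frac{\Gamma(1-b)}{\Gamma(a-b+1)}M(a,b,z)+\frac{\Gamma(b-1)}{\Gamma(a)}z^{1-b}M(a-b+1,2-b,z).$$ For $x>0$ let $$U_R(x)=e^{-x}\Big[\tfrac{\Gamma(1-b)}{\Gamma(a-b+1)}M(b-a,b,x)-\cos(\pi b)\tfrac{\Gamma(b-1)}{\Gamma(a)}x^{1-b}M(1-a,2-b,x)\Big],$$ $$U_I(x)=\sin(\pi b)\tfrac{\Gamma(b-1)}{\Gamma(a)}e^{-x}x^{1-b}M(1-a,2-b,x).$$ Here $1/\Gamma$ is $0$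 at the poles of $\Gamma$, and for $b\in\mathbb Z$ the functions $U,U_R,U_I$ are the limits of these formulas as $b'\to b$, $b'\ne b$, with $a$ fixed. Let $$F(z)=\frac ka\,\frac{U'(a,b,kz)}{U(a,b,kz)}-\frac kb$$ (the constant $k/b$ being omitted if $b=0$), and $$\mu(x)=\frac{k\,(kx)^{-b}e^{-kx}}{\Gamma(a+1)\,\Gamma(a-b+1)\,\big(U_R(kx)^2+U_I(kx)^2\big)},\qquad x>0.$$ 1. For every $x>0$, $\lim_{\varepsilon\to0+}U(a,b,-x\pm i\varepsilon)=U_R(x)\pm i\,U_I(x)$. 2. For every $x>0$ with $U_R(kx)^2+U_I(kx)^2\neq0$, $\displaystyle\lim_{\varepsilon\to0+}\frac{1}{2\pi i}\big[F(-x+i\varepsilon)-F(-x-i\varepsilon)\big]=\mu(x)$. 3. Suppose that neither $a$ nor $a-b$ is a negative integer. Then $U_R(kx)^2+U_I(kx)^2>0$ and $\Gamma(a+1)\Gamma(a-b+1)\,\mu(x)>0$ for every $x>0$. If moreover the sequence is regular, that is, $F$ has no singularities in $\mathbb C\setminus(-\infty,0]$ and $zF(z)\to0$ as $z\to0$ in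 this cut plane, then for every $n\ge1$ the function $x^{n-1}\mu(x)$ is integrable on $(0,\infty)$ and $$u_n=\int_0^\infty x^{n-1}\mu(x)\,dx .$$ -/

import Mathlib

open Filter Topology MeasureTheory Set

noncomputable section

/-- The sequence `S(α₁, α₂, α₃)`: `u₁ = 1` and, for `n ≥ 2`,
`uₙ = (α₁ n + α₂) uₙ₋₁ + α₃ ∑_{j=1}^{n-1} uⱼ uₙ₋ⱼ`. (The value `u 0` is irrelevant.) -/
def IsSelfConvolutive (α₁ α₂ α₃ : ℝ) (u : ℕ → ℝ) : Prop :=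
  u 1 = 1 ∧ ∀ n : ℕ, 2 ≤ n →
    u n = (α₁ * (n : ℝ) + α₂) * u (n - 1) + α₃ * ∑ j ∈ Finset.Icc 1 (n - 1), u j * u (n - j)

/-- Kummer's function `M(a, b, z) = ∑ (a)_r / (b)_r * z ^ r / r!`
(meaningful when `b` is not a nonpositive integer). -/
def kummerM {𝕜 : Type*} [RCLike 𝕜] (a b z : 𝕜) : 𝕜 :=
  ∑' r : ℕ, (ascPochhammer 𝕜 r).eval a / (ascPochhammer 𝕜 r).eval b * z ^ r / (r.factorial : 𝕜)

/-- The formula for the confluent hypergeometric function `U(a, b, z)` for `b` not an integer.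
At its poles Mathlib's `Gamma` is `0`, so a quotient `_ / Gamma c` there is `0`, which is the
correct value of the reciprocal Gamma function. The power is the principal one. -/
def tricomiUAux (a b : ℝ) (z : ℂ) : ℂ :=
  (Real.Gamma (1 - b) / Real.Gamma (a - b + 1) : ℝ) * kummerM (a : ℂ) (b : ℂ) z
    + (Real.Gamma (b - 1) / Real.Gamma a : ℝ) * z ^ (1 - (b : ℂ))
      * kummerM ((a : ℂ) - b + 1) (2 - (b : ℂ)) z

open Classical in
/-- The confluent hypergeometric function `U(a, b, z)` on the plane cut along `(-∞, 0]`;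
for an integer `b` it is the limit of `U(a, b', z)` as `b' → b`. -/
def tricomiU (a b : ℝ) (z : ℂ) : ℂ :=
  if ∃ m : ℤ, b = m then limUnder (𝓝[≠] b) (fun b' : ℝ => tricomiUAux a b' z)
  else tricomiUAux a b z

/-- The formula for `U_R` for `b` not an integer. -/
def tricomiReAux (a b x : ℝ) : ℝ :=
  Real.exp (-x) * (Real.Gamma (1 - b) / Real.Gamma (a - b + 1) * kummerM (b - a) b x
    - Real.cos (Real.pi * b) * (Real.Gamma (b - 1) / Real.Gamma a) * x ^ (1 - b)
      * kummerM (1 - a) (2 - b) x)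

/-- The formula for `U_I` for `b` not an integer. -/
def tricomiImAux (a b x : ℝ) : ℝ :=
  Real.sin (Real.pi * b) * (Real.Gamma (b - 1) / Real.Gamma a) * Real.exp (-x) * x ^ (1 - b)
    * kummerM (1 - a) (2 - b) x

open Classical in
/-- `U_R(x)`; for an integer `b` the removable singularity in `b` is removed. -/
def tricomiRe (a b x : ℝ) : ℝ :=
  if ∃ m : ℤ, b = m then limUnder (𝓝[≠] b) (fun b' : ℝ => tricomiReAux a b' x)
  else tricomiReAux a b x

open Classical in
/-- `U_I(x)`; for an integer `b` the removable singularity in `b` is removed. -/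
def tricomiIm (a b x : ℝ) : ℝ :=
  if ∃ m : ℤ, b = m then limUnder (𝓝[≠] b) (fun b' : ℝ => tricomiImAux a b' x)
  else tricomiImAux a b x

/-- The generating function `F(z) = (k/a) U'(a, b, kz) / U(a, b, kz) - k/b`, where `U'` is the
derivative in the last argument. For `b = 0` the additive constant is dropped (`k / 0 = 0`). -/
def genF (k a b : ℝ) (z : ℂ) : ℂ :=
  ((k / a : ℝ) : ℂ) * (deriv (tricomiU a b) (k * z) / tricomiU a b (k * z)) - ((k / b : ℝ) : ℂ)

/-- The regular case: `F` has no singularity in the plane cut along `(-∞, 0]`, and `z F(z) → 0`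
as `z → 0` in the cut plane. (At a zero of `U` the function `F` has a pole, so `genF` is not
differentiable there whatever value is assigned to it.) -/
def IsRegularCase (k a b : ℝ) : Prop :=
  DifferentiableOn ℂ (genF k a b) Complex.slitPlane ∧
    Tendsto (fun z : ℂ => z * genF k a b z) (𝓝[Complex.slitPlane] 0) (𝓝 0)

/-- `μ(x) = k (kx)^{-b} e^{-kx} / (Γ(a+1) Γ(a-b+1) (U_R(kx)² + U_I(kx)²))`. -/
def muDensity (k a b x : ℝ) : ℝ :=
  k * (k * x) ^ (-b) * Real.exp (-(k * x))
    / (Real.Gamma (a + 1) * Real.Gamma (a - b + 1)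
      * (tricomiRe a b (k * x) ^ 2 + tricomiIm a b (k * x) ^ 2))

end

/-! Put `z = exp L`. On the Riemann surface of the logarithm `U` becomes `tricomiSurf a b`, entire
in `L`; the cut plane is the strip `|Im L| < π`, and the two sides of the cut are the lines `Im L =
±π`. Integer `b` is reached by a limit in `b`: `sin (π b) U / π` is entire in `b` and vanishes at
the integers (`tricomiNum_intCast`), so the singularity is removable. Part 1 is then continuity in
`L`, combined with Kummer's transformation and the reflection formula for `Γ`.

Part 2 and positivity rest on one Wronskian. Both `U(L)` and `U(L + 2πi)` solve Kummer's equation,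
so their Wronskian is an explicit exponential times a constant, and the constant is read off as `z →
0` (`tricomiSurf_wronskian`). At `L = log x - πi` it is the numerator of the jump of `U'/U`, whose
denominator is `U₊ U₋ = U_R² + U_I²`; this gives `μ`. If neither `a` nor `a - b` is a negative
integer the Wronskian is nonzero, so `U_R` and `U_I` have no common zero.

For the moments, let `y = U'/U`. It satisfies a Riccati equation in `L`, whose formal solution in
powers of `e^{-L}` has the coefficients `(-1)^n a k^(n-1) u_n`; the recurrence for `u` says exactly
this (`isRiccatiSeries_of_isSelfConvolutive`). Cauchy's theorem is applied to `e^{nL} y` on long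
rectangles in `|Im L| ≤ π`. The right side produces `2π` times the `n`-th coefficient, the left side
vanishes because `z F(z) → 0`, and the horizontal sides give the integral of the jump, which is the
moment of `μ`. As `μ` has constant sign, convergence of these integrals already implies
integrability.

The right side needs the expansion of `y` to be uniform up to the cut. Once `y = O(e^{-L})` on a
wider strip, the Riccati equation and Cauchy's estimate produce all further terms
(`IsRiccatiSeries.exists_norm_sub_le`). That first bound says that `U` is recessive for `|arg z| <
13π/12`. Laplace integrals along the rays of angle `0` and `±2π/3` give solutions of exact order
`|z|^(-a)` on three overlapping sectors, and Wronskians that tend to `0` show that `U` is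
proportional to each of them. No integral representation of `U` itself is needed. -/

noncomputable section

/-! ### The regularised Kummer function -/

/-- The entire function `1 / Γ`. -/
def rGamma (s : ℂ) : ℂ := (Complex.Gamma s)⁻¹

lemma differentiable_rGamma : Differentiable ℂ rGamma := Complex.differentiable_one_div_Gamma

lemma rGamma_eq (s : ℂ) : rGamma s = s * rGamma (s + 1) :=
  Complex.one_div_Gamma_eq_self_mul_one_div_Gamma_add_one s

/-- Finitely many `r` are handled by compactness of the disc. Beyond `2A + 1` one has `‖b + r‖ ≥ (r
+ 1) / 2`, so each step of the functional equation gains a factor `2 / (r + 1)`. -/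
lemma exists_norm_rGamma_add_nat_le (A : ℝ) :
    ∃ C : ℝ, 0 ≤ C ∧ ∀ (r : ℕ) (b : ℂ), ‖b‖ ≤ A → ‖rGamma (b + r)‖ ≤ C * 2 ^ r / r.factorial := by
  have key : ∀ n : ℕ, ∃ C : ℝ, 0 ≤ C ∧ ∀ r ≤ n, ∀ b : ℂ, ‖b‖ ≤ A →
      ‖rGamma (b + r)‖ ≤ C * 2 ^ r / r.factorial := by
    have one : ∀ r : ℕ, ∃ C : ℝ, 0 ≤ C ∧ ∀ b : ℂ, ‖b‖ ≤ A →
        ‖rGamma (b + r)‖ ≤ C * 2 ^ r / r.factorial := by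
      intro r
      have hc : Continuous fun b : ℂ => rGamma (b + r) :=
        differentiable_rGamma.continuous.comp (by fun_prop)
      obtain ⟨C, hC⟩ := (isCompact_closedBall (0 : ℂ) A).exists_bound_of_continuousOn
        hc.continuousOn
      refine ⟨|C| * r.factorial, by positivity, fun b hb => ?_⟩
      have h1 := hC b (by simpa using hb)
      have h2 : (1 : ℝ) ≤ 2 ^ r := one_le_pow₀ (by norm_num)
      have h3 : (r.factorial : ℝ) ≠ 0 := by positivity
      rw [mul_right_comm, mul_div_assoc, div_self h3, mul_one]
      nlinarith [le_abs_self C, abs_nonneg C]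
    intro n
    choose C hC0 hC using one
    refine ⟨∑ r ∈ Finset.range (n + 1), C r, Finset.sum_nonneg fun r _ => hC0 r,
      fun r hr b hb => (hC r b hb).trans ?_⟩
    have : C r ≤ ∑ r ∈ Finset.range (n + 1), C r :=
      Finset.single_le_sum (fun i _ => hC0 i) (Finset.mem_range.2 (by omega))
    gcongr
  obtain ⟨N, hN⟩ := exists_nat_ge (2 * A + 1)
  obtain ⟨C, hC0, hC⟩ := key N
  refine ⟨C, hC0, fun r b hb => ?_⟩
  rcases le_total r N with h | h
  · exact hC r h b hb
  · induction r, h using Nat.le_induction with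
    | base => exact hC N le_rfl b hb
    | succ r hr ih =>
      have hr' : (N : ℝ) ≤ r := by exact_mod_cast hr
      have h1 : ((r : ℝ) + 1) / 2 ≤ ‖b + r‖ := by
        have := norm_sub_norm_le (r : ℂ) (-b)
        rw [Complex.norm_natCast, norm_neg, sub_neg_eq_add, add_comm] at this
        linarith
      have h2 := rGamma_eq (b + r)
      have h3 : ‖rGamma (b + r)‖ = ‖b + r‖ * ‖rGamma (b + r + 1)‖ := by rw [h2, norm_mul]
      have h5 : (b + ((r + 1 : ℕ) : ℂ)) = b + r + 1 := by push_cast; ring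
      rw [h5, Nat.factorial_succ, Nat.cast_mul, pow_succ]
      have h4 : ((r : ℝ) + 1) / 2 * ‖rGamma (b + r + 1)‖ ≤ C * 2 ^ r / r.factorial :=
        (mul_le_mul_of_nonneg_right h1 (norm_nonneg _)).trans (h3 ▸ ih)
      have hf : (0 : ℝ) < r.factorial := by positivity
      rw [le_div_iff₀ (by positivity)] at h4 ⊢
      push_cast
      nlinarith

lemma norm_ascPochhammer_eval_le {a : ℂ} {A : ℝ} (ha : ‖a‖ ≤ A) (r : ℕ) :
    ‖(ascPochhammer ℂ r).eval a‖ ≤ (1 + A) ^ r * r.factorial := by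
  have hA : 0 ≤ A := (norm_nonneg a).trans ha
  induction r with
  | zero => simp
  | succ r ih =>
    rw [ascPochhammer_succ_eval, norm_mul, Nat.factorial_succ, pow_succ]
    have h : ‖a + r‖ ≤ (1 + A) * (r + 1) := by
      refine (norm_add_le _ _).trans ?_
      rw [Complex.norm_natCast]
      nlinarith [(Nat.cast_nonneg r : (0 : ℝ) ≤ r)]
    calc _ ≤ ((1 + A) ^ r * r.factorial) * ((1 + A) * (r + 1)) := by gcongr
      _ = _ := by push_cast; ring

/-- The terms of the series of `regKummer`. -/
def regKummerTerm (r : ℕ) (a b z : ℂ) : ℂ :=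
  (ascPochhammer ℂ r).eval a * rGamma (b + r) * z ^ r / (r.factorial : ℂ)

/-- The regularised Kummer function `M(a, b, z) / Γ(b)`, entire in all three arguments. -/
def regKummer (a b z : ℂ) : ℂ := ∑' r : ℕ, regKummerTerm r a b z

/-- One majorant on a polydisc in all three arguments serves joint continuity, holomorphy in any
argument and termwise differentiation. -/
lemma exists_norm_regKummerTerm_le (A : ℝ) :
    ∃ v : ℕ → ℝ, Summable v ∧ ∀ (r : ℕ) (a b z : ℂ), ‖a‖ ≤ A → ‖b‖ ≤ A → ‖z‖ ≤ A →
      ‖regKummerTerm r a b z‖ ≤ v r := by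
  obtain ⟨C, hC0, hC⟩ := exists_norm_rGamma_add_nat_le A
  refine ⟨fun r => C * ((2 * (1 + A) * A) ^ r / r.factorial),
    (Real.summable_pow_div_factorial _).mul_left C, fun r a b z ha hb hz => ?_⟩
  have hA : 0 ≤ A := (norm_nonneg a).trans ha
  have hf : (0 : ℝ) < r.factorial := by positivity
  rw [regKummerTerm, norm_div, norm_mul, norm_mul, norm_pow, Complex.norm_natCast]
  calc _ ≤ ((1 + A) ^ r * r.factorial) * (C * 2 ^ r / r.factorial) * A ^ r / r.factorial := by
        gcongr
        · exact norm_ascPochhammer_eval_le ha r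
        · exact hC r b hb
    _ = _ := by
      simp only [mul_pow]
      field_simp

lemma summable_regKummerTerm (a b z : ℂ) : Summable fun r => regKummerTerm r a b z := by
  obtain ⟨v, hv, h⟩ := exists_norm_regKummerTerm_le (max ‖a‖ (max ‖b‖ ‖z‖))
  exact Summable.of_norm_bounded hv fun r => h r a b z (by simp) (by simp) (by simp)

lemma hasSum_regKummer (a b z : ℂ) : HasSum (fun r => regKummerTerm r a b z) (regKummer a b z) :=
  (summable_regKummerTerm a b z).hasSum

@[fun_prop]
lemma Continuous.regKummer {X : Type*} [TopologicalSpace X] {f g h : X → ℂ} (hf : Continuous f)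
    (hg : Continuous g) (hh : Continuous h) :
    Continuous fun x => regKummer (f x) (g x) (h x) := by
  have key : Continuous fun p : ℂ × ℂ × ℂ => _root_.regKummer p.1 p.2.1 p.2.2 := by
    rw [continuous_iff_continuousAt]
    intro p
    obtain ⟨v, hv, h⟩ := exists_norm_regKummerTerm_le (‖p‖ + 1)
    have hs : Metric.ball (0 : ℂ × ℂ × ℂ) (‖p‖ + 1) ∈ 𝓝 p :=
      Metric.isOpen_ball.mem_nhds (by simp)
    have hcont : ContinuousOn (fun x : ℂ × ℂ × ℂ => ∑' r, regKummerTerm r x.1 x.2.1 x.2.2)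
        (Metric.ball 0 (‖p‖ + 1)) := by
      have hF : ∀ r, ContinuousOn (fun x : ℂ × ℂ × ℂ => regKummerTerm r x.1 x.2.1 x.2.2)
          (Metric.ball 0 (‖p‖ + 1)) := by
        intro r
        refine Continuous.continuousOn ?_
        have h1 : Continuous fun x : ℂ × ℂ × ℂ => (ascPochhammer ℂ r).eval x.1 :=
          (ascPochhammer ℂ r).continuous.comp continuous_fst
        have h2 : Continuous fun x : ℂ × ℂ × ℂ => rGamma (x.2.1 + r) :=
          differentiable_rGamma.continuous.comp (by fun_prop)
        unfold regKummerTerm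
        fun_prop
      have hB : ∀ r, ∀ x ∈ Metric.ball (0 : ℂ × ℂ × ℂ) (‖p‖ + 1),
          ‖regKummerTerm r x.1 x.2.1 x.2.2‖ ≤ v r := by
        intro r x hx
        have hx' : ‖x‖ ≤ ‖p‖ + 1 := by simpa using (mem_ball_zero_iff.1 hx).le
        have h1 := norm_fst_le x
        have h2 := norm_snd_le x
        have h3 := norm_fst_le x.2
        have h4 := norm_snd_le x.2
        exact h r _ _ _ (by linarith) (by linarith) (by linarith)
      exact continuousOn_tsum hF hv hB
    simpa only [_root_.regKummer] using hcont.continuousAt hs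
  have hp : Continuous fun x => (f x, g x, h x) := hf.prodMk (hg.prodMk hh)

  have := key.comp hp

  simpa only [Function.comp_def] using this

lemma Differentiable.regKummer {f g h : ℂ → ℂ} (hf : Differentiable ℂ f)
    (hg : Differentiable ℂ g) (hh : Differentiable ℂ h) :
    Differentiable ℂ fun x => regKummer (f x) (g x) (h x) := by
  intro x
  obtain ⟨v, hv, hb⟩ := exists_norm_regKummerTerm_le (‖f x‖ + ‖g x‖ + ‖h x‖ + 1)
  set U : Set ℂ := {y | ‖f y‖ < ‖f x‖ + 1} ∩ {y | ‖g y‖ < ‖g x‖ + 1} ∩ {y | ‖h y‖ < ‖h x‖ + 1}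
  have hU : IsOpen U :=
    ((isOpen_lt hf.continuous.norm continuous_const).inter
      (isOpen_lt hg.continuous.norm continuous_const)).inter
      (isOpen_lt hh.continuous.norm continuous_const)
  have hx : x ∈ U := by simp [U]
  refine (Complex.differentiableOn_tsum_of_summable_norm hv (fun r => ?_) hU
    (fun r y hy => ?_)).differentiableAt (hU.mem_nhds hx)
  · refine Differentiable.differentiableOn ?_
    have := differentiable_rGamma
    unfold regKummerTerm
    have h1 : Differentiable ℂ fun x => (ascPochhammer ℂ r).eval (f x) :=
      (ascPochhammer ℂ r).differentiable.comp hf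
    have h2 : Differentiable ℂ fun x => rGamma (g x + r) := this.comp (by fun_prop)
    fun_prop
  · obtain ⟨⟨h1, h2⟩, h3⟩ := hy
    simp only [mem_ofPred_eq] at h1 h2 h3
    have := norm_nonneg (f x)
    have := norm_nonneg (g x)
    have := norm_nonneg (h x)
    exact hb r _ _ _ (by linarith) (by linarith) (by linarith)

lemma regKummerTerm_zero (a b z : ℂ) : regKummerTerm 0 a b z = rGamma b := by
  simp [regKummerTerm]

lemma regKummer_zero_right (a b : ℂ) : regKummer a b 0 = rGamma b := by
  rw [regKummer, tsum_eq_single 0, regKummerTerm_zero]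
  intro r hr
  simp [regKummerTerm, hr]

/-! ### Contiguous relations for the regularised Kummer function -/

lemma ascPochhammer_succ_eval_left (r : ℕ) (a : ℂ) :
    (ascPochhammer ℂ (r + 1)).eval a = a * (ascPochhammer ℂ r).eval (a + 1) := by
  simp [ascPochhammer_succ_left]

lemma mul_ascPochhammer_eval_add_one (r : ℕ) (a : ℂ) :
    a * (ascPochhammer ℂ r).eval (a + 1) = (ascPochhammer ℂ r).eval a * (a + r) := by
  rw [← ascPochhammer_succ_eval_left, ascPochhammer_succ_eval]

/-- The series is shifted by one so that multiplication by `z` can be compared coefficientwise with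
unshifted series. The leading factor `r` kills the term `r = 0`, where the truncated `r - 1` would
be wrong. -/
lemma hasSum_mul_regKummer (a b z : ℂ) :
    HasSum (fun r : ℕ => (r : ℂ) * ((ascPochhammer ℂ (r - 1)).eval a
      * rGamma (b + ((r : ℂ) - 1)) * z ^ r / (r.factorial : ℂ))) (z * regKummer a b z) := by
  rw [← hasSum_nat_add_iff' 1]
  simp only [Finset.sum_range_one, Nat.cast_zero, zero_mul, sub_zero]
  refine ((hasSum_regKummer a b z).mul_left z).congr_fun fun r => ?_
  have : ((r : ℂ) + 1) ≠ 0 := by exact_mod_cast r.succ_ne_zero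
  have hf : (r.factorial : ℂ) ≠ 0 := by exact_mod_cast r.factorial_ne_zero
  simp only [regKummerTerm, Nat.factorial_succ, add_tsub_cancel_right]
  push_cast
  rw [add_sub_cancel_right]
  field_simp
  ring

lemma HasSum.eq_of_terms_eq {f g : ℕ → ℂ} {x y : ℂ} (hf : HasSum f x) (hg : HasSum g y)
    (h : ∀ n, f n = g n) : x = y :=
  hf.unique (by rwa [funext h])

lemma hasDerivAt_regKummer (a b z : ℂ) :
    HasDerivAt (regKummer a b) (a * regKummer (a + 1) (b + 1) z) z := by
  have hd : DifferentiableAt ℂ (regKummer a b) z :=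
    (Differentiable.regKummer (f := fun _ => a) (g := fun _ => b) (h := id)
      (by fun_prop) (by fun_prop) (by fun_prop)) z
  obtain ⟨v, hv, hb⟩ := exists_norm_regKummerTerm_le (max ‖a‖ (max ‖b‖ (‖z‖ + 1)))
  have hder : ∀ r, HasDerivAt (regKummerTerm r a b)
      ((ascPochhammer ℂ r).eval a * rGamma (b + r) * (r * z ^ (r - 1)) / (r.factorial : ℂ)) z :=
    fun r => ((hasDerivAt_pow r z).const_mul _).div_const _
  have h1 := Complex.hasSum_deriv_of_summable_norm (F := fun r => regKummerTerm r a b)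
    (U := Metric.ball 0 (‖z‖ + 1)) (z := z) hv
    (fun r => by unfold regKummerTerm; fun_prop) Metric.isOpen_ball
    (fun r w hw => hb r _ _ _ (by simp) (by simp)
      (by simp only [le_max_iff]; right; right; simpa using (mem_ball_zero_iff.1 hw).le))
    (by simp)
  simp only [(hder _).deriv] at h1
  have h2 := (hasSum_regKummer (a + 1) (b + 1) z).mul_left a
  rw [← hasSum_nat_add_iff' 1] at h1
  simp only [Finset.sum_range_one, Nat.cast_zero, zero_mul, mul_zero, zero_div, sub_zero] at h1
  have : deriv (regKummer a b) z = a * regKummer (a + 1) (b + 1) z := by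
    refine h1.eq_of_terms_eq h2 fun r => ?_
    have : ((r : ℂ) + 1) ≠ 0 := by exact_mod_cast r.succ_ne_zero
    have hf : (r.factorial : ℂ) ≠ 0 := by exact_mod_cast r.factorial_ne_zero
    simp only [regKummerTerm, Nat.factorial_succ, add_tsub_cancel_right,
      ascPochhammer_succ_eval_left]
    push_cast
    rw [show b + ((r : ℂ) + 1) = b + 1 + r by ring]
    field_simp
  rw [← this]
  exact hd.hasDerivAt

lemma regKummer_sub_one (a b z : ℂ) :
    regKummer a (b - 1) z
      = (b - 1) * regKummer a b z + z * (a * regKummer (a + 1) (b + 1) z) := by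
  have h := ((hasSum_mul_regKummer (a + 1) (b + 1) z).mul_left a).add
    ((hasSum_regKummer a b z).mul_left (b - 1))
  refine ((hasSum_regKummer a (b - 1) z).eq_of_terms_eq h fun r => ?_).trans (by ring)
  simp only [regKummerTerm]
  have h1 := rGamma_eq (b - 1 + r)
  rw [show b - 1 + (r : ℂ) + 1 = b + r by ring] at h1
  rw [h1]
  rcases r with _ | r
  · simp
  · rw [ascPochhammer_succ_eval_left, add_tsub_cancel_right]
    push_cast
    rw [show b + 1 + ((r : ℂ) + 1 - 1) = b + (r + 1) by ring]
    ring

lemma regKummer_add_one_left (a b z : ℂ) :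
    regKummer (a + 1) b z = regKummer a b z + z * regKummer (a + 1) (b + 1) z := by
  have h := (hasSum_regKummer a b z).add (hasSum_mul_regKummer (a + 1) (b + 1) z)
  refine (hasSum_regKummer (a + 1) b z).eq_of_terms_eq h fun r => ?_
  simp only [regKummerTerm]
  rcases r with _ | r
  · simp
  · rw [ascPochhammer_succ_eval_left r a, add_tsub_cancel_right,
      ascPochhammer_succ_eval r (a + 1)]
    push_cast
    rw [show b + 1 + ((r : ℂ) + 1 - 1) = b + (r + 1) by ring]
    ring

lemma regKummer_eq_mul_add_mul (a b z : ℂ) :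
    regKummer a b z
      = a * regKummer (a + 1) (b + 1) z + (b - a) * regKummer a (b + 1) z := by
  have h := ((hasSum_regKummer (a + 1) (b + 1) z).mul_left a).add
    ((hasSum_regKummer a (b + 1) z).mul_left (b - a))
  refine (hasSum_regKummer a b z).eq_of_terms_eq h fun r => ?_
  simp only [regKummerTerm]
  have h1 := rGamma_eq (b + r)
  have h2 := mul_ascPochhammer_eval_add_one r a
  rw [show b + (r : ℂ) + 1 = b + 1 + r by ring] at h1
  rw [h1]
  linear_combination -(rGamma (b + 1 + r) * z ^ r / (r.factorial : ℂ)) * h2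

lemma regKummer_three_term (a b z : ℂ) :
    regKummer a (b - 2) z
      = (b - 2) * regKummer a (b - 1) z + z * regKummer a (b - 1) z
        + (a + 1 - b) * (z * regKummer a b z) := by
  have h := (((hasSum_regKummer a (b - 1) z).mul_left (b - 2)).add
    (hasSum_mul_regKummer a (b - 1) z)).add ((hasSum_mul_regKummer a b z).mul_left (a + 1 - b))
  refine (hasSum_regKummer a (b - 2) z).eq_of_terms_eq h fun r => ?_
  simp only [regKummerTerm]
  have h1 := rGamma_eq (b - 2 + r)
  rw [show b - 2 + (r : ℂ) + 1 = b - 1 + r by ring] at h1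
  rw [h1]
  rcases r with _ | r
  · simp
  · rw [add_tsub_cancel_right, ascPochhammer_succ_eval]
    push_cast
    rw [show b - 1 + ((r : ℂ) + 1 - 1) = b - 1 + r by ring,
      show b + ((r : ℂ) + 1 - 1) = b + r by ring,
      show b - 1 + ((r : ℂ) + 1) = b + r by ring, rGamma_eq (b - 1 + r),
      show b - 1 + (r : ℂ) + 1 = b + r by ring]
    ring

/-- At the second parameter `1 - p` the first `p` coefficients vanish, because `1 / Γ` is zero at
nonpositive integers; the rest is a shift of the index by `p`. This makes the two summands of
`tricomiNum` coincide at positive integer `b`. -/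
lemma regKummer_one_sub_nat (a : ℂ) (p : ℕ) (z : ℂ) :
    regKummer (a - p) (1 - p) z
      = z ^ p * ((ascPochhammer ℂ p).eval (a - p) * regKummer a (1 + p) z) := by
  have h1 := hasSum_regKummer (a - p) (1 - p) z
  rw [← hasSum_nat_add_iff' p, Finset.sum_eq_zero, sub_zero] at h1
  · refine h1.eq_of_terms_eq (((hasSum_regKummer a (1 + p) z).mul_left _).mul_left _) fun r => ?_
    have e1 : (ascPochhammer ℂ (r + p)).eval (a - p)
        = (ascPochhammer ℂ p).eval (a - p) * (ascPochhammer ℂ r).eval a := by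
      rw [add_comm, ← ascPochhammer_mul]
      simp
    have e2 : ∀ n : ℕ, rGamma (1 + n) = ((n.factorial : ℂ))⁻¹ := fun n => by
      rw [rGamma, add_comm, Complex.Gamma_nat_eq_factorial]
    simp only [regKummerTerm]
    rw [e1, show (1 : ℂ) - p + ((r + p : ℕ) : ℂ) = 1 + r by push_cast; ring, e2,
      show (1 : ℂ) + p + (r : ℂ) = 1 + ((r + p : ℕ) : ℂ) by push_cast; ring, e2, pow_add]
    ring
  · intro r hr
    have : rGamma (1 - p + r) = 0 := by
      rw [rGamma, inv_eq_zero, Complex.Gamma_eq_zero_iff]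
      refine ⟨p - 1 - r, ?_⟩
      have := Finset.mem_range.1 hr
      rw [Nat.cast_sub (by omega), Nat.cast_sub (by omega)]
      push_cast
      ring
    simp [regKummerTerm, this]

/-- Kummer's transformation. -/
lemma regKummer_neg (a b z : ℂ) :
    regKummer a b (-z) = Complex.exp (-z) * regKummer (b - a) b z := by
  -- The defect `D` of the identity vanishes at `z = 0`, and its derivative is `a` times the defect
  -- with both parameters raised by one. Hence all Taylor coefficients at `0` vanish.
  set D : ℂ → ℂ → ℂ → ℂ := fun a b z =>
    regKummer a b z - Complex.exp z * regKummer (b - a) b (-z) with hD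
  have hderiv : ∀ a b z, HasDerivAt (D a b) (a * D (a + 1) (b + 1) z) z := by
    intro a b z
    have h2 : HasDerivAt (fun z => regKummer (b - a) b (-z))
        ((b - a) * regKummer (b - a + 1) (b + 1) (-z) * (-1)) z :=
      (hasDerivAt_regKummer (b - a) b (-z)).comp z (hasDerivAt_neg z)
    refine ((hasDerivAt_regKummer a b z).sub ((Complex.hasDerivAt_exp z).mul h2)).congr_deriv ?_
    simp only [hD]
    have h3 := regKummer_eq_mul_add_mul (b - a) b (-z)
    rw [show b + 1 - (a + 1) = b - a by ring]
    linear_combination (-Complex.exp z) * h3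
  have hiter : ∀ n : ℕ, ∀ a b, iteratedDeriv n (D a b) 0 = 0 := by
    intro n
    induction n with
    | zero => intro a b; simp [hD, regKummer_zero_right]
    | succ n ih =>
      intro a b
      rw [iteratedDeriv_succ', show deriv (D a b) = fun z => a * D (a + 1) (b + 1) z from
        funext fun z => (hderiv a b z).deriv, iteratedDeriv_const_mul_field, ih, mul_zero]
  have hzero : D a b (-z) = 0 := by
    have hdiff : Differentiable ℂ (D a b) := fun z => (hderiv a b z).differentiableAt
    rw [← Complex.taylorSeries_eq_of_entire' 0 (-z) hdiff]
    simp [hiter]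
  simp only [hD, neg_neg] at hzero
  exact sub_eq_zero.1 hzero

/-! ### The Tricomi function on the Riemann surface of the logarithm -/

/-- `sin (π b) / π` times the Tricomi function at `z = exp L`. -/
def tricomiNum (a b L : ℂ) : ℂ :=
  rGamma (a - b + 1) * regKummer a b (Complex.exp L)
    - rGamma a * (Complex.exp ((1 - b) * L) * regKummer (a - b + 1) (2 - b) (Complex.exp L))

/-- The Tricomi function at `z = exp L` for a noninteger second parameter. -/
def tricomiGen (a b L : ℂ) : ℂ := Real.pi / Complex.sin (Real.pi * b) * tricomiNum a b L

/-- The Tricomi function `U(a, b, exp L)`, entire in `L`, for every second parameter. -/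
def tricomiSurf (a b L : ℂ) : ℂ := limUnder (𝓝[≠] b) fun β => tricomiGen a β L

/-- The derivative of `tricomiSurf a b`. -/
def tricomiSurfDeriv (a b L : ℂ) : ℂ := -(a * Complex.exp L * tricomiSurf (a + 1) (b + 1) L)

@[fun_prop]
lemma Continuous.rGamma {X : Type*} [TopologicalSpace X] {f : X → ℂ} (hf : Continuous f) :
    Continuous fun x => rGamma (f x) := differentiable_rGamma.continuous.comp hf

@[fun_prop]
lemma Continuous.tricomiNum {X : Type*} [TopologicalSpace X] {f g : X → ℂ} (a : ℂ)
    (hf : Continuous f) (hg : Continuous g) : Continuous fun x => tricomiNum a (f x) (g x) := by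
  unfold _root_.tricomiNum
  fun_prop

lemma differentiable_tricomiNum_snd (a L : ℂ) : Differentiable ℂ fun b => tricomiNum a b L := by
  unfold tricomiNum
  have h1 : Differentiable ℂ fun b => rGamma (a - b + 1) :=
    differentiable_rGamma.comp (by fun_prop)
  have h2 : Differentiable ℂ fun b => regKummer a b (Complex.exp L) :=
    Differentiable.regKummer (by fun_prop) (by fun_prop) (by fun_prop)
  have h3 : Differentiable ℂ fun b => regKummer (a - b + 1) (2 - b) (Complex.exp L) :=
    Differentiable.regKummer (by fun_prop) (by fun_prop) (by fun_prop)
  fun_prop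

lemma hasDerivAt_tricomiNum (a b L : ℂ) :
    HasDerivAt (tricomiNum a b) (a * Complex.exp L * tricomiNum (a + 1) (b + 1) L) L := by
  have h1 := (hasDerivAt_regKummer a b (Complex.exp L)).comp L (Complex.hasDerivAt_exp L)
  have h2 := (hasDerivAt_regKummer (a - b + 1) (2 - b) (Complex.exp L)).comp L
    (Complex.hasDerivAt_exp L)
  have h3 : HasDerivAt (fun L => Complex.exp ((1 - b) * L))
      (Complex.exp ((1 - b) * L) * ((1 - b) * 1)) L :=
    ((hasDerivAt_id L).const_mul (1 - b)).cexp
  refine ((h1.const_mul (rGamma (a - b + 1))).sub ((h3.mul h2).const_mul (rGamma a))).congr_deriv ?_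
  have e1 := regKummer_sub_one (a - b + 1) (2 - b) (Complex.exp L)
  have e2 := rGamma_eq a
  have e3 : Complex.exp ((1 - b) * L) = Complex.exp L * Complex.exp ((1 - (b + 1)) * L) := by
    rw [← Complex.exp_add]; ring_nf
  simp only [tricomiNum, Function.comp]
  rw [show a + 1 - (b + 1) + 1 = a - b + 1 by ring, show 2 - (b + 1) = 2 - b - 1 by ring, e1, e2,
    e3]
  ring

/-- This is Kummer's equation with derivatives replaced by raised parameters. The middle sign is
opposite to that in `tricomiGen_ode`, since dividing by `sin (π b)` changes sign under `b ↦ b + 1`.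
-/
lemma tricomiNum_ode (a b L : ℂ) :
    a * (a + 1) * Complex.exp L * tricomiNum (a + 1 + 1) (b + 1 + 1) L
      + (b - Complex.exp L) * (a * tricomiNum (a + 1) (b + 1) L) - a * tricomiNum a b L = 0 := by
  have e1 := regKummer_sub_one (a + 1) (b + 1) (Complex.exp L)
  have e2 := regKummer_add_one_left a b (Complex.exp L)
  have e3 := regKummer_three_term (a - b + 1) (2 - b) (Complex.exp L)
  have e4 := rGamma_eq a
  have e5 := rGamma_eq (a + 1)
  have e6 : Complex.exp ((1 - b) * L)
      = Complex.exp L * (Complex.exp L * Complex.exp ((-1 - b) * L)) := by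
    rw [← Complex.exp_add, ← Complex.exp_add]; ring_nf
  have e7 : Complex.exp ((1 - (b + 1)) * L) = Complex.exp L * Complex.exp ((-1 - b) * L) := by
    rw [← Complex.exp_add]; ring_nf
  have e8 : Complex.exp ((1 - (b + 1 + 1)) * L) = Complex.exp ((-1 - b) * L) := by ring_nf
  simp only [tricomiNum, e6, e7, e8]
  rw [add_sub_cancel_right] at e1
  rw [show a + 1 + 1 - (b + 1 + 1) + 1 = a - b + 1 by ring,
    show a + 1 - (b + 1) + 1 = a - b + 1 by ring, show 2 - (b + 1 + 1) = 2 - b - 2 by ring,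
    show 2 - (b + 1) = 2 - b - 1 by ring, e4, e5]
  linear_combination (-rGamma (a - b + 1) * a) * e1 + (rGamma (a - b + 1) * a) * e2
    - (a * (a + 1) * rGamma (a + 1 + 1) * Complex.exp L * Complex.exp ((-1 - b) * L)) * e3

lemma rGamma_eq_ascPochhammer_mul (s : ℂ) (n : ℕ) :
    rGamma s = (ascPochhammer ℂ n).eval s * rGamma (s + n) := by
  induction n with
  | zero => simp
  | succ n ih =>
    rw [ih, rGamma_eq (s + n), ascPochhammer_succ_eval]
    push_cast
    rw [add_assoc, mul_assoc]

lemma tricomiNum_one_add_nat (a L : ℂ) (p : ℕ) : tricomiNum a (1 + p) L = 0 := by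
  have e1 := regKummer_one_sub_nat a p (Complex.exp L)
  have e2 := rGamma_eq_ascPochhammer_mul (a - p) p
  have e3 : Complex.exp ((1 - (1 + p)) * L) * Complex.exp L ^ p = 1 := by
    rw [← Complex.exp_nat_mul, ← Complex.exp_add]
    ring_nf
    simp
  rw [tricomiNum, show a - (1 + p) + 1 = a - p by ring, show (2 : ℂ) - (1 + p) = 1 - p by ring, e1,
    e2, sub_add_cancel]
  linear_combination (-rGamma a * (ascPochhammer ℂ p).eval (a - p)
    * regKummer a (1 + p) (Complex.exp L)) * e3

/-- This is `U(a, b, z) = z^(1-b) U(a-b+1, 2-b, z)`; the minus sign is that of `sin (π (2 - b))`. It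
carries the vanishing at `b ≥ 1` over to the remaining integers. -/
lemma tricomiNum_reflect (a b L : ℂ) :
    tricomiNum a b L = -(Complex.exp ((1 - b) * L) * tricomiNum (a - b + 1) (2 - b) L) := by
  have e : Complex.exp ((1 - b) * L) * Complex.exp ((1 - (2 - b)) * L) = 1 := by
    rw [← Complex.exp_add]
    ring_nf
    simp
  rw [tricomiNum, tricomiNum, show a - b + 1 - (2 - b) + 1 = a by ring, sub_sub_cancel]
  linear_combination (-rGamma (a - b + 1) * regKummer a b (Complex.exp L)) * e

lemma tricomiNum_intCast (a L : ℂ) (m : ℤ) : tricomiNum a m L = 0 := by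
  have key : ∀ m : ℤ, 1 ≤ m → ∀ a : ℂ, tricomiNum a m L = 0 := by
    intro m hm a
    obtain ⟨p, hp⟩ := Int.eq_ofNat_of_zero_le (sub_nonneg.2 hm)
    obtain rfl : m = 1 + p := by omega
    simpa using tricomiNum_one_add_nat a L p
  rcases le_or_gt 1 m with h | h
  · exact key m h a
  · rw [tricomiNum_reflect]
    have := key (2 - m) (by omega) (a - m + 1)
    push_cast at this
    rw [this]
    simp

lemma sin_pi_mul_ne_zero_of_forall_ne {b : ℂ} (hb : ∀ m : ℤ, b ≠ m) :
    Complex.sin (Real.pi * b) ≠ 0 := by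
  intro h
  obtain ⟨m, hm⟩ := Complex.sin_eq_zero_iff.1 h
  rw [mul_comm] at hm
  exact hb m (mul_right_cancel₀ (by exact_mod_cast Real.pi_ne_zero) hm)

lemma eventually_forall_ne_intCast (b : ℂ) : ∀ᶠ β : ℂ in 𝓝[≠] b, ∀ m : ℤ, β ≠ m := by
  by_cases hb : ∃ m : ℤ, b = m
  · obtain ⟨m, rfl⟩ := hb
    filter_upwards [nhdsWithin_le_nhds (Metric.ball_mem_nhds (m : ℂ) one_pos),
      self_mem_nhdsWithin] with β h1 h2 n hn
    subst hn
    rw [Metric.mem_ball, Complex.dist_eq, ← Int.cast_sub, Complex.norm_intCast] at h1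
    have : |n - m| < 1 := by exact_mod_cast h1
    rw [Int.abs_lt_one_iff, sub_eq_zero] at this
    exact h2 (by simp [this])
  · push Not at hb
    have : ContinuousAt (fun β : ℂ => Complex.sin (Real.pi * β)) b := by fun_prop
    filter_upwards [nhdsWithin_le_nhds (this.eventually_ne (sin_pi_mul_ne_zero_of_forall_ne hb))]
      with β h m hm
    apply h
    rw [hm, mul_comm, Complex.sin_int_mul_pi]

lemma continuousAt_tricomiGen_snd (a L : ℂ) {b : ℂ} (hb : ∀ m : ℤ, b ≠ m) :
    ContinuousAt (fun β => tricomiGen a β L) b := by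
  unfold tricomiGen
  have h := sin_pi_mul_ne_zero_of_forall_ne hb
  have h2 : ContinuousAt (fun β => tricomiNum a β L) b := by
    have : Continuous fun β => tricomiNum a β L := by fun_prop
    exact this.continuousAt
  have h3 : ContinuousAt (fun β : ℂ => Complex.sin (Real.pi * β)) b := by fun_prop
  exact (continuousAt_const.div h3 h).mul h2

lemma tricomiSurf_eq_tricomiGen (a L : ℂ) {b : ℂ} (hb : ∀ m : ℤ, b ≠ m) :
    tricomiSurf a b L = tricomiGen a b L :=
  ((continuousAt_tricomiGen_snd a L hb).tendsto.mono_left nhdsWithin_le_nhds).limUnder_eq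

/-- Numerator and `sin (π β)` both vanish at `m` and the sine has a simple zero, so the quotient of
the two slopes converges. -/
lemma tendsto_tricomiGen_intCast (a L : ℂ) (m : ℤ) :
    ∃ l, Tendsto (fun β => tricomiGen a β L) (𝓝[≠] (m : ℂ)) (𝓝 l) := by
  have h1 := hasDerivAt_iff_tendsto_slope.1
    (differentiable_tricomiNum_snd a L (m : ℂ)).hasDerivAt
  have h2 : HasDerivAt (fun β : ℂ => Complex.sin (Real.pi * β))
      (Complex.cos (Real.pi * m) * (Real.pi * 1)) (m : ℂ) :=
    ((hasDerivAt_id _).const_mul _).csin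
  have h3 := hasDerivAt_iff_tendsto_slope.1 h2
  have hne : Complex.cos (Real.pi * m) * (Real.pi * 1) ≠ 0 := by
    have : Complex.cos (Real.pi * m) ≠ 0 := by
      intro h
      have := Complex.sin_sq_add_cos_sq (Real.pi * m)
      rw [h, mul_comm, Complex.sin_int_mul_pi] at this
      simp at this
    have hpi : (Real.pi : ℂ) ≠ 0 := by exact_mod_cast Real.pi_ne_zero
    simp [this, hpi]
  refine ⟨_, ((h1.div h3 hne).const_mul (Real.pi : ℂ)).congr' ?_⟩
  filter_upwards [self_mem_nhdsWithin] with β hβ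
  have hβ' : β - m ≠ 0 := sub_ne_zero.2 hβ
  simp only [slope_def_field, Pi.div_apply, tricomiNum_intCast, sub_zero, tricomiGen,
    mul_comm (Real.pi : ℂ) (m : ℂ), Complex.sin_int_mul_pi]
  field_simp

lemma tendsto_tricomiGen (a b L : ℂ) :
    Tendsto (fun β => tricomiGen a β L) (𝓝[≠] b) (𝓝 (tricomiSurf a b L)) := by
  by_cases hb : ∃ m : ℤ, b = m
  · obtain ⟨m, rfl⟩ := hb
    exact tendsto_nhds_limUnder (tendsto_tricomiGen_intCast a L m)
  · push Not at hb
    rw [tricomiSurf_eq_tricomiGen a L hb]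
    exact (continuousAt_tricomiGen_snd a L hb).tendsto.mono_left nhdsWithin_le_nhds

lemma tricomiGen_ode (a b L : ℂ) :
    a * (a + 1) * Complex.exp L * tricomiGen (a + 1 + 1) (b + 1 + 1) L
      - (b - Complex.exp L) * (a * tricomiGen (a + 1) (b + 1) L) - a * tricomiGen a b L = 0 := by
  have h1 : ∀ b : ℂ, Complex.sin (Real.pi * (b + 1)) = -Complex.sin (Real.pi * b) := fun b => by
    rw [mul_add, mul_one, Complex.sin_add_pi]
  simp only [tricomiGen, h1, neg_neg, div_neg]
  linear_combination (Real.pi / Complex.sin (Real.pi * b)) * tricomiNum_ode a b L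

lemma hasDerivAt_tricomiGen (a b L : ℂ) :
    HasDerivAt (tricomiGen a b) (-(a * Complex.exp L * tricomiGen (a + 1) (b + 1) L)) L := by
  refine ((hasDerivAt_tricomiNum a b L).const_mul
    (Real.pi / Complex.sin (Real.pi * b))).congr_deriv ?_
  rw [tricomiGen, mul_add, mul_one, Complex.sin_add_pi, div_neg]
  ring

lemma tendsto_add_one_nhdsNE (b : ℂ) : Tendsto (fun β : ℂ => β + 1) (𝓝[≠] b) (𝓝[≠] (b + 1)) := by
  refine tendsto_nhdsWithin_of_tendsto_nhds_of_eventually_within _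
    ((continuous_id.add continuous_const).tendsto' b _ rfl |>.mono_left nhdsWithin_le_nhds) ?_
  filter_upwards [self_mem_nhdsWithin] with β hβ
  simpa using hβ

lemma tricomiSurf_ode (a b L : ℂ) :
    a * (a + 1) * Complex.exp L * tricomiSurf (a + 1 + 1) (b + 1 + 1) L
      - (b - Complex.exp L) * (a * tricomiSurf (a + 1) (b + 1) L) - a * tricomiSurf a b L = 0 := by
  have h0 := tendsto_tricomiGen a b L
  have h1 := (tendsto_tricomiGen (a + 1) (b + 1) L).comp (tendsto_add_one_nhdsNE b)
  have h2 := ((tendsto_tricomiGen (a + 1 + 1) (b + 1 + 1) L).comp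
    (tendsto_add_one_nhdsNE (b + 1))).comp (tendsto_add_one_nhdsNE b)
  have hb : Tendsto (fun β : ℂ => β - Complex.exp L) (𝓝[≠] b) (𝓝 (b - Complex.exp L)) :=
    ((continuous_id.sub continuous_const).tendsto' b _ rfl).mono_left nhdsWithin_le_nhds
  have h3 := ((h2.const_mul (a * (a + 1) * Complex.exp L)).sub (hb.mul (h1.const_mul a))).sub
    (h0.const_mul a)
  refine tendsto_nhds_unique h3 (tendsto_const_nhds.congr fun β => ?_)
  exact (tricomiGen_ode a β L).symm

lemma forall_circleMap_half_ne_intCast (m : ℤ) (θ : ℝ) (n : ℤ) :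
    circleMap (m : ℂ) (1 / 2) θ ≠ n := by
  intro h
  have h1 : ‖(n : ℂ) - m‖ = 1 / 2 := by
    rw [← h]
    simp
  rw [← Int.cast_sub, Complex.norm_intCast, ← Int.cast_abs] at h1
  have h2 : (2 * |n - m| : ℝ) = 1 := by push_cast at h1 ⊢; linarith
  have h3 : 2 * |n - m| = 1 := by exact_mod_cast h2
  omega

/-- The mean value property after filling the removable singularity in `β`. The circle of radius
`1/2` avoids all integers, so the limit in `β` becomes an integral that can be differentiated in
`L`. -/
lemma tricomiSurf_intCast_eq_circleAverage (a L : ℂ) (m : ℤ) :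
    tricomiSurf a m L = Real.circleAverage (fun β => tricomiGen a β L) m (1 / 2) := by
  classical
  set f : ℂ → ℂ := Function.update (fun β => tricomiGen a β L) m (tricomiSurf a m L) with hf
  have hne : ∀ z ∈ Metric.closedBall (m : ℂ) |1 / 2|, z ≠ m → ∀ n : ℤ, z ≠ n := by
    rintro z hz hzm n rfl
    rw [Metric.mem_closedBall, Complex.dist_eq, ← Int.cast_sub, Complex.norm_intCast,
      abs_of_pos (by norm_num : (0 : ℝ) < 1 / 2)] at hz
    have : |((n - m : ℤ) : ℝ)| < 1 := by linarith
    have : |n - m| < 1 := by exact_mod_cast this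
    rw [Int.abs_lt_one_iff, sub_eq_zero] at this
    exact hzm (by rw [this])
  have hd : ∀ z ∈ Metric.closedBall (m : ℂ) |1 / 2|, z ≠ m → DifferentiableAt ℂ f z := by
    intro z hz hzm
    have h1 : DifferentiableAt ℂ (fun β => tricomiGen a β L) z := by
      have h2 := sin_pi_mul_ne_zero_of_forall_ne (hne z hz hzm)
      have h3 := differentiable_tricomiNum_snd a L z
      have h4 : DifferentiableAt ℂ (fun β : ℂ => Complex.sin (Real.pi * β)) z := by fun_prop
      exact ((differentiableAt_const _).div h4 h2).mul h3
    refine h1.congr_of_eventuallyEq ?_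
    filter_upwards [isOpen_ne.mem_nhds hzm] with w hw
    exact Function.update_of_ne hw _ _
  have h1 := circleAverage_of_differentiable_on_off_countable (f := f) (c := (m : ℂ)) (R := 1 / 2)
    (countable_singleton (m : ℂ)) (fun z hz => ?_)
    (fun z hz => hd z (Metric.ball_subset_closedBall hz.1) hz.2)
  · have h2 : f m = tricomiSurf a m L := Function.update_self _ _ _
    rw [← h2, ← h1]
    refine Real.circleAverage_congr_sphere fun z hz => ?_
    refine Function.update_of_ne ?_ _ _
    rintro rfl
    simp at hz
  · by_cases hzm : z = m
    · subst hzm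
      exact (continuousAt_update_same.2 (tendsto_tricomiGen a m L)).continuousWithinAt
    · exact (hd z hz hzm).continuousAt.continuousWithinAt

/-- For integer `b` the circle average is differentiated under the integral sign. The circle
translated by one again avoids the integers, so the integrand's derivative is jointly continuous and
hence bounded near `L`. -/
lemma hasDerivAt_tricomiSurf (a b L : ℂ) :
    HasDerivAt (tricomiSurf a b) (tricomiSurfDeriv a b L) L := by
  rw [tricomiSurfDeriv]
  by_cases hb : ∃ m : ℤ, b = m
  · obtain ⟨m, rfl⟩ := hb
    set F : ℂ → ℝ → ℂ := fun L θ => tricomiGen a (circleMap m (1 / 2) θ) L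
    set F' : ℂ → ℝ → ℂ := fun L θ =>
      -(a * Complex.exp L * tricomiGen (a + 1) (circleMap m (1 / 2) θ + 1) L)
    have hcm : Continuous fun θ => circleMap (m : ℂ) (1 / 2) θ := continuous_circleMap _ _
    have hsin : ∀ θ, Complex.sin (Real.pi * circleMap (m : ℂ) (1 / 2) θ) ≠ 0 := fun θ =>
      sin_pi_mul_ne_zero_of_forall_ne (forall_circleMap_half_ne_intCast m θ)
    have hsin' : ∀ θ, Complex.sin (Real.pi * (circleMap (m : ℂ) (1 / 2) θ + 1)) ≠ 0 := fun θ => by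
      rw [mul_add, mul_one, Complex.sin_add_pi]
      exact neg_ne_zero.2 (hsin θ)
    have hF : ∀ L, Continuous (F L) := fun L => by
      have : Continuous fun θ => Complex.sin (Real.pi * circleMap (m : ℂ) (1 / 2) θ) := by fun_prop
      have h2 : Continuous fun θ => tricomiNum a (circleMap (m : ℂ) (1 / 2) θ) L := by fun_prop
      exact (continuous_const.div this hsin).mul h2
    have hF' : Continuous fun p : ℂ × ℝ => F' p.1 p.2 := by
      have : Continuous fun p : ℂ × ℝ =>
          Complex.sin (Real.pi * (circleMap (m : ℂ) (1 / 2) p.2 + 1)) := by fun_prop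
      have h2 : Continuous fun p : ℂ × ℝ =>
          tricomiNum (a + 1) (circleMap (m : ℂ) (1 / 2) p.2 + 1) p.1 := by fun_prop
      have h3 := (continuous_const (y := (Real.pi : ℂ))).div this fun p => hsin' p.2
      have h4 : Continuous fun p : ℂ × ℝ => a * Complex.exp p.1 := by fun_prop
      exact (h4.mul (h3.mul h2)).neg
    obtain ⟨C, hC⟩ := ((isCompact_closedBall L 1).prod
      (isCompact_Icc (a := (0 : ℝ)) (b := 2 * Real.pi))).exists_bound_of_continuousOn
      hF'.continuousOn
    have key := intervalIntegral.hasDerivAt_integral_of_dominated_loc_of_deriv_le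
      (μ := volume) (a := 0) (b := 2 * Real.pi) (F := F) (F' := F') (x₀ := L)
      (s := Metric.closedBall L 1) (bound := fun _ => C)
      (Metric.closedBall_mem_nhds L one_pos)
      (Eventually.of_forall fun L => (hF L).aestronglyMeasurable)
      ((hF L).intervalIntegrable _ _)
      (hF'.comp (by fun_prop : Continuous fun θ : ℝ => (L, θ))).aestronglyMeasurable
      (Eventually.of_forall fun θ hθ x hx => hC (x, θ) ⟨hx, by
        rw [uIoc_of_le Real.two_pi_pos.le] at hθ
        exact Ioc_subset_Icc_self hθ⟩)
      intervalIntegrable_const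
      (Eventually.of_forall fun θ _ x _ => hasDerivAt_tricomiGen a (circleMap m (1 / 2) θ) x)
    have e1 : tricomiSurf a m = fun L => (2 * Real.pi)⁻¹ • ∫ θ in 0..2 * Real.pi, F L θ :=
      funext fun L => tricomiSurf_intCast_eq_circleAverage a L m
    have e2 : tricomiSurf (a + 1) (m + 1) L = (2 * Real.pi)⁻¹ •
        ∫ θ in 0..2 * Real.pi, tricomiGen (a + 1) (circleMap m (1 / 2) θ + 1) L := by
      have := tricomiSurf_intCast_eq_circleAverage (a + 1) L (m + 1)
      push_cast at this
      rw [this, Real.circleAverage_def]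
      congr 2
      ext θ
      congr 1
      simp only [circleMap]
      ring
    rw [e1, e2]
    refine (key.2.const_smul ((2 * Real.pi)⁻¹)).congr_deriv ?_
    simp only [F', ← neg_mul, intervalIntegral.integral_const_mul]
    rw [mul_smul_comm]
  · push Not at hb
    have h1 : tricomiSurf a b = tricomiGen a b := funext fun L => tricomiSurf_eq_tricomiGen a L hb
    have hb' : ∀ m : ℤ, b + 1 ≠ m := fun m h => hb (m - 1) (by push_cast; rw [← h]; ring)
    rw [h1, tricomiSurf_eq_tricomiGen _ _ hb']
    exact hasDerivAt_tricomiGen a b L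

/-- Kummer's equation `z w'' + (b - z) w' = a w` in the variable `L`, where `d/dL = z d/dz`. -/
lemma hasDerivAt_tricomiSurfDeriv (a b L : ℂ) :
    HasDerivAt (tricomiSurfDeriv a b)
      ((1 - b + Complex.exp L) * tricomiSurfDeriv a b L
        + a * Complex.exp L * tricomiSurf a b L) L := by
  refine ((((Complex.hasDerivAt_exp L).const_mul a).mul
    (hasDerivAt_tricomiSurf (a + 1) (b + 1) L)).neg).congr_deriv ?_
  simp only [tricomiSurfDeriv]
  linear_combination Complex.exp L * tricomiSurf_ode a b L

lemma tendsto_tricomiGen_deriv (a b L : ℂ) :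
    Tendsto (fun β => -(a * Complex.exp L * tricomiGen (a + 1) (β + 1) L)) (𝓝[≠] b)
      (𝓝 (tricomiSurfDeriv a b L)) :=
  (((tendsto_tricomiGen (a + 1) (b + 1) L).comp (tendsto_add_one_nhdsNE b)).const_mul _).neg

lemma differentiable_tricomiSurf (a b : ℂ) : Differentiable ℂ (tricomiSurf a b) :=
  fun L => (hasDerivAt_tricomiSurf a b L).differentiableAt

lemma differentiable_tricomiSurfDeriv (a b : ℂ) : Differentiable ℂ (tricomiSurfDeriv a b) :=
  fun L => (hasDerivAt_tricomiSurfDeriv a b L).differentiableAt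

/-! ### Wronskians -/

/-- The pair `(f, f')` solves Kummer's equation in the logarithmic variable on `D`. -/
def SolvesLogKummer (a b : ℂ) (D : Set ℂ) (f f' : ℂ → ℂ) : Prop :=
  ∀ L ∈ D, HasDerivAt f (f' L) L ∧
    HasDerivAt f' ((1 - b + Complex.exp L) * f' L + a * Complex.exp L * f L) L

lemma solvesLogKummer_tricomiSurf (a b : ℂ) (D : Set ℂ) :
    SolvesLogKummer a b D (tricomiSurf a b) (tricomiSurfDeriv a b) :=
  fun L _ => ⟨hasDerivAt_tricomiSurf a b L, hasDerivAt_tricomiSurfDeriv a b L⟩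

lemma exp_add_two_pi_I (L : ℂ) : Complex.exp (L + 2 * Real.pi * Complex.I) = Complex.exp L :=
  Complex.exp_periodic L

/-- The equation depends on `L` only through `exp L`, so continuation around the origin yields a
second solution. -/
lemma solvesLogKummer_tricomiSurf_add_two_pi_I (a b : ℂ) (D : Set ℂ) :
    SolvesLogKummer a b D (fun L => tricomiSurf a b (L + 2 * Real.pi * Complex.I))
      (fun L => tricomiSurfDeriv a b (L + 2 * Real.pi * Complex.I)) := by
  intro L _
  refine ⟨(hasDerivAt_tricomiSurf a b _).comp_add_const L _, ?_⟩
  have := (hasDerivAt_tricomiSurfDeriv a b (L + 2 * Real.pi * Complex.I)).comp_add_const L _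
  rwa [exp_add_two_pi_I] at this

/-- Abel's identity: `(1 - b) L + exp L` is a primitive of the coefficient `1 - b + exp L` of the
first derivative. -/
lemma SolvesLogKummer.wronskian_eq {a b : ℂ} {D : Set ℂ} {f f' h h' : ℂ → ℂ}
    (hf : SolvesLogKummer a b D f f') (hh : SolvesLogKummer a b D h h') (hD : IsOpen D)
    (hDc : IsPreconnected D) {x y : ℂ} (hx : x ∈ D) (hy : y ∈ D) :
    (f x * h' x - f' x * h x) * Complex.exp (-((1 - b) * x + Complex.exp x))
      = (f y * h' y - f' y * h y) * Complex.exp (-((1 - b) * y + Complex.exp y)) := by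
  have hd : ∀ L ∈ D, HasDerivAt (fun L => (f L * h' L - f' L * h L)
      * Complex.exp (-((1 - b) * L + Complex.exp L))) 0 L := by
    intro L hL
    obtain ⟨h1, h2⟩ := hf L hL
    obtain ⟨h3, h4⟩ := hh L hL
    have h5 : HasDerivAt (fun L => Complex.exp (-((1 - b) * L + Complex.exp L)))
        (Complex.exp (-((1 - b) * L + Complex.exp L)) * -((1 - b) * 1 + Complex.exp L)) L :=
      ((((hasDerivAt_id L).const_mul (1 - b)).add (Complex.hasDerivAt_exp L)).neg).cexp
    refine (((h1.mul h4).sub (h2.mul h3)).mul h5).congr_deriv ?_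
    simp only [Pi.sub_apply, Pi.mul_apply]
    ring
  exact hD.is_const_of_deriv_eq_zero hDc
    (fun L hL => (hd L hL).differentiableAt.differentiableWithinAt)
    (fun L hL => (hd L hL).deriv) hx hy

lemma rGamma_mul_rGamma_one_sub (b : ℂ) :
    rGamma b * rGamma (1 - b) = Complex.sin (Real.pi * b) / Real.pi := by
  rw [rGamma, rGamma, ← mul_inv, Complex.Gamma_mul_Gamma_one_sub, inv_div]

lemma exp_one_sub_mul_add_two_pi_I (b L : ℂ) :
    Complex.exp ((1 - b) * (L + 2 * Real.pi * Complex.I))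
      = Complex.exp (-(2 * Real.pi * Complex.I * b)) * Complex.exp ((1 - b) * L) := by
  rw [← Complex.exp_add, ← exp_add_two_pi_I (_ + _)]
  ring_nf

/-- The Wronskian of the Tricomi function and its analytic continuation around the origin,
for a noninteger parameter. -/
lemma tricomiGen_wronskian (a L : ℂ) {b : ℂ} (hb : ∀ m : ℤ, b ≠ m) :
    tricomiSurf a b L * tricomiSurfDeriv a b (L + 2 * Real.pi * Complex.I)
      - tricomiSurfDeriv a b L * tricomiSurf a b (L + 2 * Real.pi * Complex.I)
    = 2 * Real.pi * Complex.I * Complex.exp (-(Real.pi * Complex.I * b)) * rGamma a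
      * rGamma (a - b + 1) * Complex.exp ((1 - b) * L + Complex.exp L) := by
  have hb' : ∀ m : ℤ, b + 1 ≠ m := fun m h => hb (m - 1) (by push_cast; rw [← h]; ring)
  have hsin := sin_pi_mul_ne_zero_of_forall_ne hb
  have hpi : (Real.pi : ℂ) ≠ 0 := by exact_mod_cast Real.pi_ne_zero
  -- Continuation by `2πi` multiplies the second summand of `U` by `w` and fixes the first, so only
  -- the cross terms survive, with the factor `1 - w`. What remains is `Q`, and by Abel's identity
  -- `Q(z) exp(-z)` is constant.
  set Q : ℂ → ℂ := fun z => regKummer a b z * regKummer (a - b + 1) (2 - b - 1) z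
    - a * z * regKummer (a + 1) (b + 1) z * regKummer (a - b + 1) (2 - b) z with hQ
  set w : ℂ := Complex.exp (-(2 * Real.pi * Complex.I * b)) with hw
  have hexpand : ∀ L : ℂ, tricomiSurf a b L * tricomiSurfDeriv a b (L + 2 * Real.pi * Complex.I)
      - tricomiSurfDeriv a b L * tricomiSurf a b (L + 2 * Real.pi * Complex.I)
      = (Real.pi / Complex.sin (Real.pi * b)) ^ 2 * (1 - w) * (rGamma a * rGamma (a - b + 1))
        * Complex.exp ((1 - b) * L) * Q (Complex.exp L) := by
    intro L
    have e3 : Complex.exp ((1 - b) * L) = Complex.exp L * Complex.exp ((1 - (b + 1)) * L) := by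
      rw [← Complex.exp_add]; ring_nf
    have e4 : Complex.exp (-(2 * Real.pi * Complex.I * (b + 1))) = w := by
      rw [hw, ← exp_add_two_pi_I]; ring_nf
    have e5 := rGamma_eq a
    simp only [tricomiSurfDeriv, tricomiSurf_eq_tricomiGen _ _ hb,
      tricomiSurf_eq_tricomiGen _ _ hb', tricomiGen, tricomiNum, exp_add_two_pi_I,
      exp_one_sub_mul_add_two_pi_I, hQ, e4, ← hw]
    rw [show Complex.sin (Real.pi * (b + 1)) = -Complex.sin (Real.pi * b) by
      rw [mul_add, mul_one, Complex.sin_add_pi], show a + 1 - (b + 1) + 1 = a - b + 1 by ring,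
      show 2 - (b + 1) = 2 - b - 1 by ring, e5, e3, div_neg]
    ring
  have hw1 : 1 - w = 2 * Complex.I * Complex.exp (-(Real.pi * Complex.I * b))
      * Complex.sin (Real.pi * b) := by
    have e1 : w = Complex.exp (-(Real.pi * Complex.I * b))
        * Complex.exp (-(Real.pi * Complex.I * b)) := by
      rw [← Complex.exp_add, hw]; ring_nf
    have e2 : Complex.exp (-(Real.pi * Complex.I * b))
        * Complex.exp (Real.pi * Complex.I * b) = 1 := by
      rw [← Complex.exp_add, neg_add_cancel, Complex.exp_zero]
    rw [Complex.sin, e1, show -(Real.pi * b) * Complex.I = -(Real.pi * Complex.I * b) by ring,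
      show Real.pi * b * Complex.I = Real.pi * Complex.I * b by ring]
    linear_combination (-1 : ℂ) * e2 - Complex.exp (-(Real.pi * Complex.I * b))
      * (Complex.exp (-(Real.pi * Complex.I * b)) - Complex.exp (Real.pi * Complex.I * b))
      * Complex.I_sq
  rw [hexpand]
  -- Constancy of `Q(z) exp(-z)` comes from dividing by this factor; when it is zero both sides of
  -- the claim vanish.
  by_cases hg : rGamma a * rGamma (a - b + 1) = 0
  · rw [hg, mul_assoc (2 * Real.pi * Complex.I * _) (rGamma a), hg]
    simp
  have hw0 : 1 - w ≠ 0 := by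
    rw [hw1]
    exact mul_ne_zero (mul_ne_zero (mul_ne_zero two_ne_zero Complex.I_ne_zero)
      (Complex.exp_ne_zero _)) hsin
  have hconst : ∀ L₀ : ℂ, Q (Complex.exp L₀) * Complex.exp (-Complex.exp L₀)
      = Q (Complex.exp L) * Complex.exp (-Complex.exp L) := by
    intro L₀
    have h1 := (solvesLogKummer_tricomiSurf a b univ).wronskian_eq
      (solvesLogKummer_tricomiSurf_add_two_pi_I a b univ) isOpen_univ isPreconnected_univ
      (mem_univ L₀) (mem_univ L)
    rw [hexpand, hexpand] at h1
    have h2 : ∀ L : ℂ, Complex.exp ((1 - b) * L) * Complex.exp (-((1 - b) * L + Complex.exp L))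
        = Complex.exp (-Complex.exp L) := fun L => by rw [← Complex.exp_add]; ring_nf
    have hK : (Real.pi / Complex.sin (Real.pi * b)) ^ 2 * (1 - w)
        * (rGamma a * rGamma (a - b + 1)) ≠ 0 :=
      mul_ne_zero (mul_ne_zero (pow_ne_zero _ (div_ne_zero hpi hsin)) hw0) hg
    refine mul_left_cancel₀ hK ?_
    rw [← h2 L₀, ← h2 L]
    linear_combination h1
  -- The constant is `Q(0) = 1 / (Γ(b) Γ(1 - b))`, reached as `z = exp t → 0`.
  have hlim : Tendsto (fun t : ℝ => Q (Complex.exp t) * Complex.exp (-Complex.exp t)) atBot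
      (𝓝 (Q 0 * Complex.exp (-0))) := by
    have hc : Continuous fun z => Q z * Complex.exp (-z) := by simp only [hQ]; fun_prop
    have h0 : Tendsto (fun t : ℝ => Complex.exp t) atBot (𝓝 0) := by
      have := (Complex.continuous_ofReal.tendsto 0).comp Real.tendsto_exp_atBot
      simpa [Function.comp_def] using this
    exact (hc.tendsto 0).comp h0
  have hQ0 : Q (Complex.exp L) = rGamma b * rGamma (1 - b) * Complex.exp (Complex.exp L) := by
    have h1 := tendsto_nhds_unique hlim (tendsto_const_nhds.congr fun t : ℝ => (hconst t).symm)
    simp only [hQ, regKummer_zero_right] at h1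
    rw [show 2 - b - 1 = 1 - b by ring] at h1
    have h2 : Complex.exp (-Complex.exp L) * Complex.exp (Complex.exp L) = 1 := by
      rw [← Complex.exp_add, neg_add_cancel, Complex.exp_zero]
    simp only [neg_zero, Complex.exp_zero, mul_one, mul_zero, zero_mul, sub_zero] at h1
    rw [h1]
    simp only [hQ]
    rw [show 2 - b - 1 = 1 - b by ring]
    linear_combination (-(regKummer a b (Complex.exp L) * regKummer (a - b + 1) (1 - b)
      (Complex.exp L) - a * Complex.exp L * regKummer (a + 1) (b + 1) (Complex.exp L)
      * regKummer (a - b + 1) (2 - b) (Complex.exp L))) * h2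
  rw [hQ0, rGamma_mul_rGamma_one_sub, hw1, Complex.exp_add]
  field_simp

/-- Both sides are limits of their values at noninteger `β`, the right side being continuous in the
second parameter. -/
lemma tricomiSurf_wronskian (a b L : ℂ) :
    tricomiSurf a b L * tricomiSurfDeriv a b (L + 2 * Real.pi * Complex.I)
      - tricomiSurfDeriv a b L * tricomiSurf a b (L + 2 * Real.pi * Complex.I)
    = 2 * Real.pi * Complex.I * Complex.exp (-(Real.pi * Complex.I * b)) * rGamma a
      * rGamma (a - b + 1) * Complex.exp ((1 - b) * L + Complex.exp L) := by
  have h1 := ((tendsto_tricomiGen a b L).mul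
    (tendsto_tricomiGen_deriv a b (L + 2 * Real.pi * Complex.I))).sub
    ((tendsto_tricomiGen_deriv a b L).mul
      (tendsto_tricomiGen a b (L + 2 * Real.pi * Complex.I)))
  have h2 : Continuous fun b => 2 * Real.pi * Complex.I * Complex.exp (-(Real.pi * Complex.I * b))
      * rGamma a * rGamma (a - b + 1) * Complex.exp ((1 - b) * L + Complex.exp L) := by
    fun_prop
  refine tendsto_nhds_unique h1 (((h2.tendsto b).mono_left nhdsWithin_le_nhds).congr' ?_)
  filter_upwards [eventually_forall_ne_intCast b] with β hβ
  have hb' : ∀ m : ℤ, β + 1 ≠ m := fun m h => hβ (m - 1) (by push_cast; rw [← h]; ring)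
  simp only [← tricomiGen_wronskian a L hβ, tricomiSurfDeriv, tricomiSurf_eq_tricomiGen _ _ hβ,
    tricomiSurf_eq_tricomiGen _ _ hb']

/-! ### Comparison with the classical formulas -/

lemma ofReal_ascPochhammer_eval (r : ℕ) (x : ℝ) :
    (((ascPochhammer ℝ r).eval x : ℝ) : ℂ) = (ascPochhammer ℂ r).eval (x : ℂ) := by
  induction r with
  | zero => simp
  | succ r ih => rw [ascPochhammer_succ_eval, ascPochhammer_succ_eval, ← ih]; push_cast; rfl

lemma ofReal_kummerM (a b x : ℝ) : ((kummerM a b x : ℝ) : ℂ) = kummerM (a : ℂ) b x := by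
  simp only [kummerM, Complex.ofReal_tsum]
  refine tsum_congr fun r => ?_
  push_cast [ofReal_ascPochhammer_eval]
  rfl

lemma Gamma_ne_zero_of_forall_ne {b : ℂ} (hb : ∀ m : ℤ, b ≠ m) : Complex.Gamma b ≠ 0 :=
  Complex.Gamma_ne_zero fun n h => hb (-n) (by push_cast; exact h)

lemma kummerM_eq (a z : ℂ) {b : ℂ} (hb : ∀ m : ℤ, b ≠ m) :
    kummerM a b z = Complex.Gamma b * regKummer a b z := by
  rw [kummerM, regKummer, ← tsum_mul_left]
  refine tsum_congr fun r => ?_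
  have h1 := rGamma_eq_ascPochhammer_mul b r
  have h2 := Gamma_ne_zero_of_forall_ne hb
  have h3 : (ascPochhammer ℂ r).eval b ≠ 0 := by
    intro h
    rw [h, zero_mul, rGamma, inv_eq_zero] at h1
    exact h2 h1
  have h4 : Complex.Gamma b * rGamma (b + r) = ((ascPochhammer ℂ r).eval b)⁻¹ := by
    refine eq_inv_of_mul_eq_one_left ?_
    rw [mul_assoc, mul_comm (rGamma _), ← h1, rGamma, mul_inv_cancel₀ h2]
  rw [regKummerTerm, div_eq_mul_inv ((ascPochhammer ℂ r).eval a), ← h4]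
  ring

lemma Gamma_sub_one_mul_Gamma_two_sub (b : ℂ) :
    Complex.Gamma (b - 1) * Complex.Gamma (2 - b) = -(Real.pi / Complex.sin (Real.pi * b)) := by
  have := Complex.Gamma_mul_Gamma_one_sub (b - 1)
  rw [show 1 - (b - 1) = 2 - b by ring, mul_sub, mul_one, Complex.sin_sub_pi, div_neg] at this
  exact this

lemma forall_two_sub_ne_intCast {b : ℂ} (hb : ∀ m : ℤ, b ≠ m) : ∀ m : ℤ, 2 - b ≠ m :=
  fun m h => hb (2 - m) (by push_cast; rw [← h]; ring)

lemma ofReal_ne_intCast {b : ℝ} (hb : ¬∃ m : ℤ, b = m) : ∀ m : ℤ, (b : ℂ) ≠ m :=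
  fun m h => hb ⟨m, by exact_mod_cast h⟩

lemma ofReal_Gamma_div_Gamma (s t : ℝ) :
    ((Real.Gamma s / Real.Gamma t : ℝ) : ℂ) = Complex.Gamma s * rGamma t := by
  rw [rGamma, Complex.Gamma_ofReal, Complex.Gamma_ofReal, Complex.ofReal_div, div_eq_mul_inv]

/-- The reflection formula turns `Γ(b) Γ(1-b)` and `-Γ(b-1) Γ(2-b)` into the common factor `π / sin
(π b)`. -/
lemma tricomiUAux_eq (a : ℝ) {b : ℝ} (hb : ¬∃ m : ℤ, b = m) {z : ℂ} (hz : z ≠ 0) :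
    tricomiUAux a b z = tricomiGen a b (Complex.log z) := by
  have hb' := ofReal_ne_intCast hb
  rw [tricomiUAux, tricomiGen, tricomiNum, Complex.exp_log hz, kummerM_eq _ _ hb',
    kummerM_eq _ _ (forall_two_sub_ne_intCast hb'), ofReal_Gamma_div_Gamma, ofReal_Gamma_div_Gamma,
    Complex.cpow_def_of_ne_zero hz]
  have h1 := Complex.Gamma_mul_Gamma_one_sub b
  have h2 := Gamma_sub_one_mul_Gamma_two_sub b
  push_cast
  rw [mul_comm (Complex.log z)]
  linear_combination (rGamma (a - b + 1) * regKummer a b z) * h1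
    + (rGamma a * Complex.exp ((1 - b) * Complex.log z) * regKummer (a - b + 1) (2 - b) z) * h2

/-- The sign `s` selects the side of the cut. The power contributes the phase `exp(± πi (1 - b)) =
-cos (π b) ± i sin (π b)`, and Kummer's transformation turns the argument `-x` into `x` at the cost
of `exp(-x)`. -/
lemma tricomiReAux_add_tricomiImAux (a : ℝ) {b x s : ℝ} (hb : ¬∃ m : ℤ, b = m) (hx : 0 < x)
    (hs : s = 1 ∨ s = -1) :
    (tricomiReAux a b x : ℂ) + s * tricomiImAux a b x * Complex.I
      = tricomiGen a b (Real.log x + s * Real.pi * Complex.I) := by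
  have hb' := ofReal_ne_intCast hb
  have h1 := Complex.Gamma_mul_Gamma_one_sub b
  have h2 := Gamma_sub_one_mul_Gamma_two_sub b
  have hexp : Complex.exp (Real.log x + s * Real.pi * Complex.I) = -x := by
    rw [Complex.exp_add, ← Complex.ofReal_exp, Real.exp_log hx]
    rcases hs with rfl | rfl
    · simp
    · simp [Complex.exp_neg]
  have hpow : Complex.exp ((1 - b) * (Real.log x + s * Real.pi * Complex.I))
      = ((x ^ (1 - b) : ℝ) : ℂ) * (-Complex.cos (Real.pi * b)
        + s * Complex.sin (Real.pi * b) * Complex.I) := by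
    have e1 : Complex.exp (s * Real.pi * Complex.I) = -1 := by
      rcases hs with rfl | rfl
      · simp
      · simp [Complex.exp_neg]
    have e2 : Complex.exp ((-(s * Real.pi * b) : ℂ) * Complex.I)
        = Complex.cos (Real.pi * b) - s * Complex.sin (Real.pi * b) * Complex.I := by
      rw [Complex.exp_mul_I, Complex.cos_neg, Complex.sin_neg]
      rcases hs with rfl | rfl
      · push_cast
        rw [one_mul]
        ring
      · push_cast
        rw [show (-1 : ℂ) * Real.pi * b = -(Real.pi * b) by ring, Complex.cos_neg, Complex.sin_neg]
        ring
    rw [Real.rpow_def_of_pos hx, mul_add, Complex.exp_add,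
      show (1 - b : ℂ) * (s * Real.pi * Complex.I) = s * Real.pi * Complex.I
        + (-(s * Real.pi * b) : ℂ) * Complex.I by ring, Complex.exp_add (s * Real.pi * Complex.I),
      e1, e2]
    push_cast
    rw [mul_comm (1 - b : ℂ)]
    ring
  have hK1 : ((kummerM (b - a) b x : ℝ) : ℂ) = Complex.Gamma b * regKummer (b - a) b x := by
    rw [ofReal_kummerM, kummerM_eq _ _ hb']
    push_cast
    rfl
  have hK2 : ((kummerM (1 - a) (2 - b) x : ℝ) : ℂ)
      = Complex.Gamma (2 - b) * regKummer (1 - a) (2 - b) x := by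
    rw [ofReal_kummerM]
    push_cast
    rw [kummerM_eq _ _ (forall_two_sub_ne_intCast hb')]
  rw [tricomiGen, tricomiNum, hexp, hpow, regKummer_neg, regKummer_neg, tricomiReAux, tricomiImAux]
  simp only [Complex.ofReal_mul, Complex.ofReal_sub, ofReal_Gamma_div_Gamma, hK1, hK2]
  push_cast
  rw [show (2 : ℂ) - b - (a - b + 1) = 1 - a by ring]
  linear_combination (Complex.exp (-x) * rGamma (a - b + 1) * regKummer (b - a) b x) * h1
    + (Complex.exp (-x) * rGamma a * ((x ^ (1 - b) : ℝ) : ℂ) * regKummer (1 - a) (2 - b) x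
      * (-Complex.cos (Real.pi * b) + s * Complex.sin (Real.pi * b) * Complex.I)) * h2

lemma tendsto_ofReal_nhdsNE (b : ℝ) :
    Tendsto (fun β : ℝ => (β : ℂ)) (𝓝[≠] b) (𝓝[≠] (b : ℂ)) := by
  refine tendsto_nhdsWithin_of_tendsto_nhds_of_eventually_within _
    ((Complex.continuous_ofReal.tendsto b).mono_left nhdsWithin_le_nhds) ?_
  filter_upwards [self_mem_nhdsWithin] with β hβ
  simpa using hβ

lemma eventually_not_exists_eq_intCast (b : ℝ) : ∀ᶠ β : ℝ in 𝓝[≠] b, ¬∃ m : ℤ, β = m := by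
  filter_upwards [(tendsto_ofReal_nhdsNE b).eventually (eventually_forall_ne_intCast b)]
    with β hβ ⟨m, hm⟩
  exact hβ m (by rw [hm]; simp)

lemma tricomiU_eq (a b : ℝ) {z : ℂ} (hz : z ≠ 0) :
    tricomiU a b z = tricomiSurf a b (Complex.log z) := by
  rw [tricomiU]
  split_ifs with hb
  · refine Tendsto.limUnder_eq (((tendsto_tricomiGen a b _).comp
      (tendsto_ofReal_nhdsNE b)).congr' ?_)
    filter_upwards [eventually_not_exists_eq_intCast b] with β hβ
    exact (tricomiUAux_eq a hβ hz).symm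
  · rw [tricomiUAux_eq a hb hz, tricomiSurf_eq_tricomiGen _ _ (ofReal_ne_intCast hb)]

lemma tricomiRe_and_tricomiIm_eq (a b : ℝ) {x : ℝ} (hx : 0 < x) :
    (tricomiRe a b x = (tricomiSurf a b (Real.log x + Real.pi * Complex.I)).re ∧
      tricomiIm a b x = (tricomiSurf a b (Real.log x + Real.pi * Complex.I)).im) := by
  have key : ∀ β : ℝ, (¬∃ m : ℤ, β = m) →
      tricomiReAux a β x = (tricomiGen a β (Real.log x + Real.pi * Complex.I)).re ∧
      tricomiImAux a β x = (tricomiGen a β (Real.log x + Real.pi * Complex.I)).im := by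
    intro β hβ
    have := tricomiReAux_add_tricomiImAux a hβ hx (Or.inl rfl)
    simp only [Complex.ofReal_one, one_mul] at this
    rw [← this]
    simp
  by_cases hb : ∃ m : ℤ, b = m
  · have ht := (tendsto_tricomiGen a b (Real.log x + Real.pi * Complex.I)).comp
      (tendsto_ofReal_nhdsNE b)
    rw [tricomiRe, tricomiIm, if_pos hb, if_pos hb]
    constructor
    · refine Tendsto.limUnder_eq (((Complex.continuous_re.tendsto _).comp ht).congr' ?_)
      filter_upwards [eventually_not_exists_eq_intCast b] with β hβ
      exact (key β hβ).1.symm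
    · refine Tendsto.limUnder_eq (((Complex.continuous_im.tendsto _).comp ht).congr' ?_)
      filter_upwards [eventually_not_exists_eq_intCast b] with β hβ
      exact (key β hβ).2.symm
  · rw [tricomiRe, tricomiIm, if_neg hb, if_neg hb,
      tricomiSurf_eq_tricomiGen _ _ (ofReal_ne_intCast hb)]
    exact key b hb

lemma tricomiSurf_upper (a b : ℝ) {x : ℝ} (hx : 0 < x) :
    tricomiSurf a b (Real.log x + Real.pi * Complex.I)
      = tricomiRe a b x + tricomiIm a b x * Complex.I := by
  obtain ⟨h1, h2⟩ := tricomiRe_and_tricomiIm_eq a b hx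
  rw [h1, h2, Complex.re_add_im]

/-- For real parameters the values on the two sides are complex conjugates; this is visible at
noninteger `β` and survives the limit. -/
lemma tricomiSurf_lower (a b : ℝ) {x : ℝ} (hx : 0 < x) :
    tricomiSurf a b (Real.log x - Real.pi * Complex.I)
      = tricomiRe a b x - tricomiIm a b x * Complex.I := by
  obtain ⟨h1, h2⟩ := tricomiRe_and_tricomiIm_eq a b hx
  have hconj : tricomiSurf a b (Real.log x - Real.pi * Complex.I)
      = (starRingEnd ℂ) (tricomiSurf a b (Real.log x + Real.pi * Complex.I)) := by
    have t1 := (tendsto_tricomiGen a b (Real.log x - Real.pi * Complex.I)).comp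
      (tendsto_ofReal_nhdsNE b)
    have t2 := ((Complex.continuous_conj.tendsto _).comp
      (tendsto_tricomiGen a b (Real.log x + Real.pi * Complex.I))).comp (tendsto_ofReal_nhdsNE b)
    refine tendsto_nhds_unique t1 (t2.congr' ?_)
    filter_upwards [eventually_not_exists_eq_intCast b] with β hβ
    have e1 := tricomiReAux_add_tricomiImAux a hβ hx (Or.inl rfl)
    have e2 := tricomiReAux_add_tricomiImAux a hβ hx (Or.inr rfl)
    simp only [Complex.ofReal_one, one_mul, Complex.ofReal_neg, neg_mul,
      ← sub_eq_add_neg] at e1 e2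
    simp only [Function.comp, ← e1, ← e2]
    simp [sub_eq_add_neg]
  rw [hconj, ← Complex.re_add_im (tricomiSurf a b (Real.log x + Real.pi * Complex.I)), ← h1, ← h2]
  simp [sub_eq_add_neg]

/-! ### Boundary values -/

lemma tendsto_log_upper {x : ℝ} (hx : 0 < x) :
    Tendsto (fun ε : ℝ => Complex.log (-(x : ℂ) + ε * Complex.I)) (𝓝[>] 0)
      (𝓝 (Real.log x + Real.pi * Complex.I)) := by
  have h := Complex.tendsto_log_nhdsWithin_im_nonneg_of_re_neg_of_im_zero
    (z := -(x : ℂ)) (by simpa using hx) (by simp)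
  rw [norm_neg, Complex.norm_real, Real.norm_of_nonneg hx.le] at h
  refine h.comp (tendsto_nhdsWithin_of_tendsto_nhds_of_eventually_within _ ?_ ?_)
  · have : Continuous fun ε : ℝ => -(x : ℂ) + ε * Complex.I := by fun_prop
    exact (this.tendsto' 0 _ (by simp)).mono_left nhdsWithin_le_nhds
  · filter_upwards [self_mem_nhdsWithin] with ε hε
    simpa using le_of_lt hε

lemma tendsto_log_lower {x : ℝ} (hx : 0 < x) :
    Tendsto (fun ε : ℝ => Complex.log (-(x : ℂ) - ε * Complex.I)) (𝓝[>] 0)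
      (𝓝 (Real.log x - Real.pi * Complex.I)) := by
  have h := Complex.tendsto_log_nhdsWithin_im_neg_of_re_neg_of_im_zero
    (z := -(x : ℂ)) (by simpa using hx) (by simp)
  rw [norm_neg, Complex.norm_real, Real.norm_of_nonneg hx.le] at h
  refine h.comp (tendsto_nhdsWithin_of_tendsto_nhds_of_eventually_within _ ?_ ?_)
  · have : Continuous fun ε : ℝ => -(x : ℂ) - ε * Complex.I := by fun_prop
    exact (this.tendsto' 0 _ (by simp)).mono_left nhdsWithin_le_nhds
  · filter_upwards [self_mem_nhdsWithin] with ε hε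
    simpa using hε

lemma mem_slitPlane_of_im_ne_zero {z : ℂ} (hz : z.im ≠ 0) : z ∈ Complex.slitPlane :=
  Complex.mem_slitPlane_iff.2 (Or.inr hz)

lemma tendsto_tricomiU_upper (a b : ℝ) {x : ℝ} (hx : 0 < x) :
    Tendsto (fun ε : ℝ => tricomiU a b (-(x : ℂ) + ε * Complex.I)) (𝓝[>] 0)
      (𝓝 ((tricomiRe a b x : ℂ) + tricomiIm a b x * Complex.I)) := by
  rw [← tricomiSurf_upper a b hx]
  refine (((differentiable_tricomiSurf a b).continuous.tendsto _).comp
    (tendsto_log_upper hx)).congr' ?_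
  filter_upwards [self_mem_nhdsWithin] with ε hε
  exact (tricomiU_eq a b (Complex.slitPlane_ne_zero (mem_slitPlane_of_im_ne_zero (by
    simpa using (ne_of_gt hε))))).symm

lemma tendsto_tricomiU_lower (a b : ℝ) {x : ℝ} (hx : 0 < x) :
    Tendsto (fun ε : ℝ => tricomiU a b (-(x : ℂ) - ε * Complex.I)) (𝓝[>] 0)
      (𝓝 ((tricomiRe a b x : ℂ) - tricomiIm a b x * Complex.I)) := by
  rw [← tricomiSurf_lower a b hx]
  refine (((differentiable_tricomiSurf a b).continuous.tendsto _).comp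
    (tendsto_log_lower hx)).congr' ?_
  filter_upwards [self_mem_nhdsWithin] with ε hε
  exact (tricomiU_eq a b (Complex.slitPlane_ne_zero (mem_slitPlane_of_im_ne_zero (by
    simpa using (ne_of_gt hε))))).symm

/-- The logarithmic derivative `U' / U` at `z = exp L`. -/
def tricomiLogDeriv (a b L : ℂ) : ℂ := tricomiSurfDeriv a b L / (tricomiSurf a b L * Complex.exp L)

lemma genF_eq {k : ℝ} (a b : ℝ) (hk : 0 < k) {z : ℂ} (hz : z ∈ Complex.slitPlane) :
    genF k a b z
      = ((k / a : ℝ) : ℂ) * tricomiLogDeriv a b (Complex.log (k * z)) - ((k / b : ℝ) : ℂ) := by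
  have hkz : (k : ℂ) * z ∈ Complex.slitPlane := by
    rw [Complex.mem_slitPlane_iff] at hz ⊢
    simpa [hk, hk.ne'] using hz
  have h0 := Complex.slitPlane_ne_zero hkz
  have hd : HasDerivAt (tricomiU a b) (tricomiSurfDeriv a b (Complex.log (k * z)) * (k * z)⁻¹)
      (k * z) := by
    refine ((hasDerivAt_tricomiSurf a b _).comp (k * z : ℂ)
      (Complex.hasDerivAt_log hkz)).congr_of_eventuallyEq ?_
    filter_upwards [Complex.isOpen_slitPlane.mem_nhds hkz] with w hw
    exact tricomiU_eq a b (Complex.slitPlane_ne_zero hw)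
  rw [genF, hd.deriv, tricomiU_eq a b h0, tricomiLogDeriv, Complex.exp_log h0]
  congr 2
  rw [← div_eq_mul_inv, div_div, mul_comm (k * z : ℂ)]

lemma continuousAt_tricomiLogDeriv (a b : ℂ) {L : ℂ} (h : tricomiSurf a b L ≠ 0) :
    ContinuousAt (tricomiLogDeriv a b) L :=
  (differentiable_tricomiSurfDeriv a b).continuous.continuousAt.div
    ((differentiable_tricomiSurf a b).continuous.continuousAt.mul
      Complex.continuous_exp.continuousAt) (mul_ne_zero h (Complex.exp_ne_zero _))

lemma tricomiSurf_upper_mul_lower (a b : ℝ) {x : ℝ} (hx : 0 < x) :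
    tricomiSurf a b (Real.log x + Real.pi * Complex.I)
      * tricomiSurf a b (Real.log x - Real.pi * Complex.I)
      = ((tricomiRe a b x ^ 2 + tricomiIm a b x ^ 2 : ℝ) : ℂ) := by
  rw [tricomiSurf_upper a b hx, tricomiSurf_lower a b hx]
  push_cast
  linear_combination (-(tricomiIm a b x : ℂ) ^ 2) * Complex.I_sq

lemma ofReal_Gamma_inv (s : ℝ) : (((Real.Gamma s)⁻¹ : ℝ) : ℂ) = rGamma s := by
  rw [rGamma, Complex.Gamma_ofReal, Complex.ofReal_inv]

/-- Translation by `2πi` carries the lower side to the upper one. The phase `exp(-πi b)` of the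
Wronskian cancels that of `exp((1 - b) L)` up to sign, which leaves a real factor. -/
lemma tricomiSurf_wronskian_cut (a b : ℝ) {x : ℝ} (hx : 0 < x) :
    tricomiSurf a b (Real.log x - Real.pi * Complex.I)
        * tricomiSurfDeriv a b (Real.log x + Real.pi * Complex.I)
      - tricomiSurfDeriv a b (Real.log x - Real.pi * Complex.I)
        * tricomiSurf a b (Real.log x + Real.pi * Complex.I)
    = -(2 * Real.pi * Complex.I)
      * ((x ^ (1 - b) * Real.exp (-x) * (Real.Gamma a)⁻¹
        * (Real.Gamma (a - b + 1))⁻¹ : ℝ) : ℂ) := by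
  have h := tricomiSurf_wronskian a b (Real.log x - Real.pi * Complex.I)
  rw [show (Real.log x : ℂ) - Real.pi * Complex.I + 2 * Real.pi * Complex.I
    = Real.log x + Real.pi * Complex.I by ring] at h
  rw [h]
  have h1 : Complex.exp (Real.log x - Real.pi * Complex.I) = -x := by
    rw [Complex.exp_sub, ← Complex.ofReal_exp, Real.exp_log hx, Complex.exp_pi_mul_I]
    ring
  have h2 : Complex.exp (-(Real.pi * Complex.I * b))
      * Complex.exp ((1 - b) * (Real.log x - Real.pi * Complex.I) + -x)
      = -((x ^ (1 - b) * Real.exp (-x) : ℝ) : ℂ) := by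
    rw [Real.rpow_def_of_pos hx, ← Real.exp_add, ← Complex.exp_add, Complex.ofReal_exp,
      show -(Real.pi * Complex.I * b) + ((1 - b) * (Real.log x - Real.pi * Complex.I) + -x)
        = ((Real.log x * (1 - b) + -x : ℝ) : ℂ) - Real.pi * Complex.I by push_cast; ring,
      Complex.exp_sub, Complex.exp_pi_mul_I]
    ring
  rw [h1]
  simp only [Complex.ofReal_mul, ofReal_Gamma_inv] at h2 ⊢
  push_cast at h2 ⊢
  linear_combination (2 * Real.pi * Complex.I * rGamma a * rGamma (a - b + 1)) * h2

/-- With the value `0` of `Γ` at its poles this holds for every `a`. It trades the `1/Γ(a)` of the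
Wronskian for the `1/Γ(a+1)` of `μ`; the factor `a` cancels against the `k/a` in `F`. -/
lemma Real.inv_Gamma_eq (a : ℝ) : (Real.Gamma a)⁻¹ = a * (Real.Gamma (a + 1))⁻¹ := by
  have h := rGamma_eq a
  have h1 := ofReal_Gamma_inv (a + 1)
  push_cast at h1
  rw [← h1, ← ofReal_Gamma_inv] at h
  exact_mod_cast h

/-- Over the common denominator `U₊ U₋ = U_R² + U_I²` the difference of the logarithmic derivatives
has the Wronskian as numerator. Both sides have the same `exp L = -kx`. -/
lemma tricomiLogDeriv_jump {a b k x : ℝ} (ha : a ≠ 0) (hk : 0 < k) (hx : 0 < x)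
    (h : tricomiRe a b (k * x) ^ 2 + tricomiIm a b (k * x) ^ 2 ≠ 0) :
    tricomiLogDeriv a b (Real.log (k * x) + Real.pi * Complex.I)
      - tricomiLogDeriv a b (Real.log (k * x) - Real.pi * Complex.I)
      = 2 * Real.pi * Complex.I * ((a / k * muDensity k a b x : ℝ) : ℂ) := by
  have hkx : 0 < k * x := mul_pos hk hx
  have h1 := tricomiSurf_upper_mul_lower a b hkx
  have h2 := tricomiSurf_wronskian_cut a b hkx
  have h3 : tricomiSurf a b (Real.log (k * x) + Real.pi * Complex.I)
      * tricomiSurf a b (Real.log (k * x) - Real.pi * Complex.I) ≠ 0 := by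
    rw [h1]; exact_mod_cast h
  obtain ⟨hu, hl⟩ := mul_ne_zero_iff.1 h3
  have e1 : Complex.exp (Real.log (k * x) + Real.pi * Complex.I) = -((k * x : ℝ) : ℂ) := by
    rw [Complex.exp_add, ← Complex.ofReal_exp, Real.exp_log hkx, Complex.exp_pi_mul_I]
    ring
  have e2 : Complex.exp (Real.log (k * x) - Real.pi * Complex.I) = -((k * x : ℝ) : ℂ) := by
    rw [Complex.exp_sub, ← Complex.ofReal_exp, Real.exp_log hkx, Complex.exp_pi_mul_I]
    ring
  have hkxc : ((k * x : ℝ) : ℂ) ≠ 0 := by exact_mod_cast hkx.ne'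
  have h4 : tricomiLogDeriv a b (Real.log (k * x) + Real.pi * Complex.I)
      - tricomiLogDeriv a b (Real.log (k * x) - Real.pi * Complex.I)
      = -(tricomiSurf a b (Real.log (k * x) - Real.pi * Complex.I)
        * tricomiSurfDeriv a b (Real.log (k * x) + Real.pi * Complex.I)
      - tricomiSurfDeriv a b (Real.log (k * x) - Real.pi * Complex.I)
        * tricomiSurf a b (Real.log (k * x) + Real.pi * Complex.I))
        / (tricomiSurf a b (Real.log (k * x) + Real.pi * Complex.I)
          * tricomiSurf a b (Real.log (k * x) - Real.pi * Complex.I)) / ((k * x : ℝ) : ℂ) := by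
    rw [tricomiLogDeriv, tricomiLogDeriv, e1, e2]
    field_simp
    ring
  rw [h4, h2, h1]
  have h5 : (k * x) ^ (1 - b) = (k * x) ^ (-b) * (k * x) := by
    rw [sub_eq_neg_add, Real.rpow_add_one hkx.ne']
  have h6 : a / k * muDensity k a b x = (k * x) ^ (1 - b) * Real.exp (-(k * x)) * (Real.Gamma a)⁻¹
      * (Real.Gamma (a - b + 1))⁻¹ / (tricomiRe a b (k * x) ^ 2 + tricomiIm a b (k * x) ^ 2)
      / (k * x) := by
    rw [muDensity, h5, Real.inv_Gamma_eq a]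
    have hx' := hx.ne'
    have hk' := hk.ne'
    rw [div_eq_mul_inv _ (_ * _), mul_inv, mul_inv]
    field_simp
  rw [h6]
  push_cast
  ring

lemma tendsto_genF_jump {a b k x : ℝ} (ha : a ≠ 0) (hk : 0 < k) (hx : 0 < x)
    (h : tricomiRe a b (k * x) ^ 2 + tricomiIm a b (k * x) ^ 2 ≠ 0) :
    Tendsto (fun ε : ℝ => (1 / (2 * (Real.pi : ℂ) * Complex.I)) *
      (genF k a b (-(x : ℂ) + ε * Complex.I) - genF k a b (-(x : ℂ) - ε * Complex.I)))
      (𝓝[>] 0) (𝓝 (muDensity k a b x : ℂ)) := by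
  have hkx : 0 < k * x := mul_pos hk hx
  have h3 : tricomiSurf a b (Real.log (k * x) + Real.pi * Complex.I)
      * tricomiSurf a b (Real.log (k * x) - Real.pi * Complex.I) ≠ 0 := by
    rw [tricomiSurf_upper_mul_lower a b hkx]; exact_mod_cast h
  obtain ⟨hu, hl⟩ := mul_ne_zero_iff.1 h3
  have hscale : Tendsto (fun ε : ℝ => k * ε) (𝓝[>] 0) (𝓝[>] 0) := by
    refine tendsto_nhdsWithin_of_tendsto_nhds_of_eventually_within _
      (((continuous_const_mul k).tendsto' 0 _ (by simp)).mono_left nhdsWithin_le_nhds) ?_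
    filter_upwards [self_mem_nhdsWithin] with ε hε
    exact mul_pos hk hε
  have t1 := (continuousAt_tricomiLogDeriv a b hu).tendsto.comp
    ((tendsto_log_upper hkx).comp hscale)
  have t2 := (continuousAt_tricomiLogDeriv a b hl).tendsto.comp
    ((tendsto_log_lower hkx).comp hscale)
  have t3 := ((t1.sub t2).const_mul ((k / a : ℝ) : ℂ)).const_mul
    (1 / (2 * (Real.pi : ℂ) * Complex.I))
  rw [tricomiLogDeriv_jump ha hk hx h] at t3
  have hval : (1 / (2 * (Real.pi : ℂ) * Complex.I)) * (((k / a : ℝ) : ℂ)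
      * (2 * Real.pi * Complex.I * ((a / k * muDensity k a b x : ℝ) : ℂ))) = muDensity k a b x := by
    have hpi : (Real.pi : ℂ) ≠ 0 := by exact_mod_cast Real.pi_ne_zero
    have ha' : (a : ℂ) ≠ 0 := by exact_mod_cast ha
    have hk' : (k : ℂ) ≠ 0 := by exact_mod_cast hk.ne'
    push_cast
    field_simp
  rw [hval] at t3
  refine t3.congr' ?_
  filter_upwards [self_mem_nhdsWithin] with ε hε
  have hε' : (ε : ℝ) ≠ 0 := ne_of_gt hε
  rw [genF_eq a b hk (mem_slitPlane_of_im_ne_zero (by simpa using hε')),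
    genF_eq a b hk (mem_slitPlane_of_im_ne_zero (by simpa using hε'))]
  simp only [Function.comp]
  push_cast
  ring_nf

/-! ### Growth on the positive real axis -/

/-- For `s > 0` this is Euler's limit formula for `Γ`. The functional equation lowers `s` by one at
the cost of a factor `n / (n + s + 1)`, which tends to `1`. -/
lemma Real.tendsto_Gamma_add_nat_div (s : ℝ) :
    Tendsto (fun n : ℕ => Real.Gamma (s + n + 1) / ((n : ℝ) ^ s * n.factorial)) atTop (𝓝 1) := by
  have pos : ∀ s : ℝ, 0 < s →
      Tendsto (fun n : ℕ => Real.Gamma (s + n + 1) / ((n : ℝ) ^ s * n.factorial)) atTop (𝓝 1) := by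
    intro s hs
    have hG := (Real.Gamma_pos_of_pos hs).ne'
    have hprod : ∀ n : ℕ, (∏ j ∈ Finset.range n, (s + j)) * Real.Gamma s = Real.Gamma (s + n) := by
      intro n
      induction n with
      | zero => simp
      | succ n ih =>
        rw [Finset.prod_range_succ, mul_right_comm, ih, Nat.cast_succ, ← add_assoc,
          Real.Gamma_add_one (by positivity), mul_comm]
    have h1 := (Real.GammaSeq_tendsto_Gamma s).inv₀ hG |>.const_mul (Real.Gamma s)
    rw [mul_inv_cancel₀ hG] at h1
    refine h1.congr fun n => ?_
    have h2 := hprod (n + 1)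
    push_cast at h2
    rw [← add_assoc] at h2
    rw [Real.GammaSeq, inv_div, ← h2]
    ring
  have step : ∀ n : ℕ, ∀ s : ℝ, 0 < s + n →
      Tendsto (fun n : ℕ => Real.Gamma (s + n + 1) / ((n : ℝ) ^ s * n.factorial)) atTop (𝓝 1) := by
    intro n
    induction n with
    | zero => intro s hs; exact pos s (by simpa using hs)
    | succ m ih =>
      intro s hs
      have h1 := ih (s + 1) (by push_cast at hs; linarith)
      have h2 : Tendsto (fun n : ℕ => (n : ℝ) / (n + (s + 1))) atTop (𝓝 1) :=
        tendsto_natCast_div_add_atTop (s + 1)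
      have h3 := h1.mul h2
      rw [mul_one] at h3
      refine h3.congr' ?_
      obtain ⟨N, hN⟩ := exists_nat_gt |s + 1|
      filter_upwards [eventually_ge_atTop (N + 1)] with n hn
      have hn' : ((N : ℝ) + 1) ≤ n := by exact_mod_cast hn
      have hn0 : (0 : ℝ) < n := by have := abs_nonneg (s + 1); linarith
      have hne : s + n + 1 ≠ 0 := by have := neg_abs_le (s + 1); linarith
      have hne' : (n : ℝ) + (s + 1) ≠ 0 := by rwa [add_comm, add_right_comm]
      rw [show s + 1 + n + 1 = s + n + 1 + 1 by ring, Real.Gamma_add_one hne,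
        Real.rpow_add_one hn0.ne']
      have : (n : ℝ) ^ s ≠ 0 := (Real.rpow_pos_of_pos hn0 s).ne'
      have hf : (n.factorial : ℝ) ≠ 0 := by positivity
      field_simp
      ring
  obtain ⟨n, hn⟩ := exists_nat_gt (-s)
  exact step n s (by linarith)

lemma regKummer_zero_left (b z : ℂ) : regKummer 0 b z = rGamma b := by
  rw [regKummer, tsum_eq_single 0, regKummerTerm_zero]
  intro r hr
  obtain ⟨r, rfl⟩ := Nat.exists_eq_succ_of_ne_zero hr
  simp [regKummerTerm]

lemma regKummer_one_eq (b z : ℂ) : regKummer 1 b z = rGamma b + z * regKummer 1 (b + 1) z := by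
  have := regKummer_add_one_left 0 b z
  rwa [zero_add, regKummer_zero_left] at this

lemma ofReal_Gamma_ne_zero_rGamma {p : ℝ} (hp : 0 < p) :
    rGamma p * (Real.Gamma p : ℂ) = 1 := by
  have h : (Real.Gamma p : ℂ) ≠ 0 := by exact_mod_cast (Real.Gamma_pos_of_pos hp).ne'
  rw [rGamma, Complex.Gamma_ofReal, inv_mul_cancel₀ h]

lemma tendsto_rpow_mul_exp_neg_atTop (p : ℝ) :
    Tendsto (fun x : ℝ => x ^ p * Real.exp (-x)) atTop (𝓝 0) := by
  simpa using tendsto_rpow_mul_exp_neg_mul_atTop_nhds_zero p 1 one_pos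

/-- For `p > 0` the function is the normalised lower incomplete Gamma integral, as both have the
same derivative and vanish at `0`. For smaller `p`, raising `p` by one changes it only by a multiple
of `x^p exp(-x)`. -/
lemma tendsto_regKummer_one (p : ℝ) :
    Tendsto (fun x : ℝ => ((x ^ p * Real.exp (-x) : ℝ) : ℂ) * regKummer 1 (1 + p) x) atTop
      (𝓝 1) := by
  have pos : ∀ p : ℝ, 0 < p →
      Tendsto (fun x : ℝ => ((x ^ p * Real.exp (-x) : ℝ) : ℂ) * regKummer 1 (1 + p) x) atTop
        (𝓝 1) := by
    intro p hp
    have hint := Real.GammaIntegral_convergent hp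
    have hlim := (intervalIntegral_tendsto_integral_Ioi 0 hint tendsto_id)
    rw [← Real.Gamma_eq_integral hp] at hlim
    have hlim' := ((Complex.continuous_ofReal.tendsto _).comp hlim).const_mul (rGamma p)
    rw [ofReal_Gamma_ne_zero_rGamma hp] at hlim'
    refine hlim'.congr' ?_
    filter_upwards [eventually_gt_atTop 0] with x hx
    have hderiv : ∀ t ∈ Ioo 0 x, HasDerivAt
        (fun t : ℝ => ((t ^ p * Real.exp (-t) : ℝ) : ℂ) * regKummer 1 (1 + p) t)
        (rGamma p * ((Real.exp (-t) * t ^ (p - 1) : ℝ) : ℂ)) t := by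
      intro t ht
      have ht0 : t ≠ 0 := ht.1.ne'
      have h1 : HasDerivAt (fun t : ℝ => t ^ p * Real.exp (-t))
          (p * t ^ (p - 1) * Real.exp (-t) + t ^ p * (Real.exp (-t) * (-1))) t :=
        (Real.hasDerivAt_rpow_const (Or.inl ht0)).mul (hasDerivAt_neg t).exp
      have h2 := (hasDerivAt_regKummer 1 (1 + p) t).comp_ofReal
      refine (h1.ofReal_comp.mul h2).congr_deriv ?_
      have e1 := regKummer_sub_one 1 (1 + p) t
      have e2 := regKummer_one_eq p t
      rw [add_sub_cancel_left] at e1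
      have e3 : t ^ p = t ^ (p - 1) * t := by
        rw [← Real.rpow_add_one ht0, sub_add_cancel]
      rw [add_comm (p : ℂ) 1] at e2
      rw [e3]
      push_cast
      linear_combination (((t ^ (p - 1) : ℝ) : ℂ) * Complex.exp (-t)) * (e2 - e1)
    have hcont : ContinuousOn
        (fun t : ℝ => ((t ^ p * Real.exp (-t) : ℝ) : ℂ) * regKummer 1 (1 + p) t) (Icc 0 x) := by
      have h1 : Continuous fun t : ℝ => t ^ p := Real.continuous_rpow_const hp.le
      have h2 : Continuous fun t : ℝ => ((t ^ p * Real.exp (-t) : ℝ) : ℂ) := by fun_prop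
      have h3 : Continuous fun t : ℝ => regKummer 1 (1 + p) t := by fun_prop
      exact (h2.mul h3).continuousOn
    have hint' : IntervalIntegrable (fun t : ℝ => Real.exp (-t) * t ^ (p - 1)) volume 0 x :=
      (intervalIntegrable_iff_integrableOn_Ioc_of_le hx.le).2
        (hint.mono_set Ioc_subset_Ioi_self)
    have := intervalIntegral.integral_eq_sub_of_hasDerivAt_of_le hx.le hcont hderiv
      (IntervalIntegrable.const_mul (f := fun t : ℝ => ((Real.exp (-t) * t ^ (p - 1) : ℝ) : ℂ))
        ⟨Integrable.ofReal hint'.1, Integrable.ofReal hint'.2⟩ _)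
    rw [intervalIntegral.integral_const_mul] at this
    simp only [Function.comp, id]
    rw [← intervalIntegral.integral_ofReal, this]
    simp [Real.zero_rpow hp.ne']
  have step : ∀ n : ℕ, ∀ p : ℝ, 0 < p + n →
      Tendsto (fun x : ℝ => ((x ^ p * Real.exp (-x) : ℝ) : ℂ) * regKummer 1 (1 + p) x) atTop
        (𝓝 1) := by
    intro n
    induction n with
    | zero => intro p hp; exact pos p (by simpa using hp)
    | succ m ih =>
      intro p hp
      have h1 := ih (p + 1) (by push_cast at hp; linarith)
      have h2 := ((Complex.continuous_ofReal.tendsto 0).comp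
        (tendsto_rpow_mul_exp_neg_atTop p)).mul_const (rGamma (1 + p))
      have h3 := h2.add h1
      simp only [Complex.ofReal_zero, zero_mul, zero_add] at h3
      refine h3.congr' ?_
      filter_upwards [eventually_gt_atTop 0] with x hx
      rw [Real.rpow_add_one hx.ne', regKummer_one_eq (1 + p)]
      simp only [Function.comp]
      push_cast
      rw [show (1 : ℂ) + (p + 1) = 1 + p + 1 by ring]
      ring
  obtain ⟨n, hn⟩ := exists_nat_gt (-p)
  exact step n p (by linarith)

/-- If the coefficients of an entire function are asymptotically proportional to eventually positive
ones, then so is its growth on the positive axis. -/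
lemma tendsto_mul_of_coeff_tendsto {c : ℕ → ℂ} {d : ℕ → ℝ} {l : ℂ} {f D : ℝ → ℂ} {w : ℝ → ℝ}
    (hf : ∀ x : ℝ, HasSum (fun r => c r * (x : ℂ) ^ r) (f x))
    (hD : ∀ x : ℝ, HasSum (fun r => (d r : ℂ) * (x : ℂ) ^ r) (D x))
    (hd : ∀ᶠ r in atTop, 0 < d r)
    (hcd : Tendsto (fun r => c r / d r) atTop (𝓝 l))
    (hw : ∀ x, 0 < x → 0 ≤ w x) (hwr : ∀ r : ℕ, Tendsto (fun x => w x * x ^ r) atTop (𝓝 0))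
    (hwD : Tendsto (fun x => (w x : ℂ) * D x) atTop (𝓝 1)) :
    Tendsto (fun x => (w x : ℂ) * f x) atTop (𝓝 l) := by
  have key : Tendsto (fun x => (w x : ℂ) * (f x - l * D x)) atTop (𝓝 0) := by
    rw [Metric.tendsto_atTop']
    intro ε hε
    have hε2 : 0 < ε / 2 := half_pos hε
    obtain ⟨N, hN⟩ := eventually_atTop.1 (hd.and (Metric.tendsto_nhds.1 hcd (ε / 4) (by linarith)))
    have hN' : ∀ r ≥ N, ‖c r - l * d r‖ ≤ ε / 4 * d r := by
      intro r hr
      obtain ⟨h1, h2⟩ := hN r hr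
      have h3 : (d r : ℂ) ≠ 0 := by exact_mod_cast h1.ne'
      rw [dist_eq_norm, div_sub' h3, norm_div, Complex.norm_real, Real.norm_of_nonneg h1.le,
        div_lt_iff₀ h1] at h2
      rw [mul_comm l]
      exact h2.le
    -- The tail from `N` on is at most `ε/4` times the tail of `D` term by term; the first `N` terms
    -- form a polynomial, which the weight `w` kills.
    have hbound : ∀ x : ℝ, 0 < x → ‖f x - l * D x‖ ≤
        (∑ r ∈ Finset.range N, (‖c r - l * d r‖ + ε / 4 * |d r|) * x ^ r) + ε / 4 * ‖D x‖ := by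
      intro x hx
      have h1 := (hf x).sub ((hD x).mul_left l)
      have h2 := h1.mul_left 1
      have hDre : HasSum (fun r => d r * x ^ r) (D x).re := by
        have := Complex.hasSum_re (hD x)
        refine this.congr_fun fun r => ?_
        rw [← Complex.ofReal_pow, ← Complex.ofReal_mul, Complex.ofReal_re]
      set F : ℕ → ℂ := fun r => c r * (x : ℂ) ^ r - l * ((d r : ℂ) * (x : ℂ) ^ r) with hF
      have h3 : HasSum (fun r => F (r + N)) (f x - l * D x - ∑ r ∈ Finset.range N, F r) :=
        (hasSum_nat_add_iff' N).2 h1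
      have h4 : HasSum (fun r => ε / 4 * (d (r + N) * x ^ (r + N)))
          (ε / 4 * ((D x).re - ∑ r ∈ Finset.range N, d r * x ^ r)) :=
        ((hasSum_nat_add_iff' N).2 hDre).mul_left _
      have hFn : ∀ r, ‖F r‖ = ‖c r - l * d r‖ * x ^ r := fun r => by
        rw [hF]
        simp only
        rw [← mul_assoc, ← sub_mul, norm_mul, norm_pow, Complex.norm_real,
          Real.norm_of_nonneg hx.le]
      have h5 : ‖f x - l * D x - ∑ r ∈ Finset.range N, F r‖
          ≤ ε / 4 * ((D x).re - ∑ r ∈ Finset.range N, d r * x ^ r) := by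
        refine h3.norm_le_of_bounded h4 fun r => ?_
        rw [hFn, ← mul_assoc]
        exact mul_le_mul_of_nonneg_right (hN' _ (by omega)) (by positivity)
      have h6 : ‖∑ r ∈ Finset.range N, F r‖ ≤ ∑ r ∈ Finset.range N, ‖c r - l * d r‖ * x ^ r :=
        (norm_sum_le _ _).trans (le_of_eq (Finset.sum_congr rfl fun r _ => hFn r))
      have h7 : -∑ r ∈ Finset.range N, d r * x ^ r ≤ ∑ r ∈ Finset.range N, |d r| * x ^ r := by
        rw [← Finset.sum_neg_distrib]
        refine Finset.sum_le_sum fun r _ => ?_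
        have := neg_le_abs (d r)
        have hx' : 0 ≤ x ^ r := by positivity
        nlinarith
      have h8 := Complex.re_le_norm (D x)
      have h9 : ‖f x - l * D x‖ ≤ ‖f x - l * D x - ∑ r ∈ Finset.range N, F r‖
          + ‖∑ r ∈ Finset.range N, F r‖ := by
        simpa using norm_add_le (f x - l * D x - ∑ r ∈ Finset.range N, F r)
          (∑ r ∈ Finset.range N, F r)
      have h10 : (∑ r ∈ Finset.range N, (‖c r - l * d r‖ + ε / 4 * |d r|) * x ^ r)
          = (∑ r ∈ Finset.range N, ‖c r - l * d r‖ * x ^ r)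
            + ε / 4 * ∑ r ∈ Finset.range N, |d r| * x ^ r := by
        rw [Finset.mul_sum, ← Finset.sum_add_distrib]
        exact Finset.sum_congr rfl fun r _ => by ring
      rw [h10]
      nlinarith
    have hpoly : Tendsto (fun x => ∑ r ∈ Finset.range N,
        (‖c r - l * d r‖ + ε / 4 * |d r|) * (w x * x ^ r)) atTop (𝓝 0) := by
      have := tendsto_finsetSum (Finset.range N) fun r _ =>
        (hwr r).const_mul (‖c r - l * d r‖ + ε / 4 * |d r|)
      simpa using this
    have hlim := hpoly.add (hwD.norm.const_mul (ε / 4))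
    rw [norm_one, mul_one, zero_add] at hlim
    obtain ⟨X, hX⟩ := eventually_atTop.1 ((hlim.eventually_lt_const
      (by linarith : ε / 4 < ε)).and (eventually_gt_atTop 0))
    refine ⟨X, fun x hx => ?_⟩
    obtain ⟨h1, h2⟩ := hX x hx.le
    rw [dist_zero_right, norm_mul, Complex.norm_real, Real.norm_of_nonneg (hw x h2)]
    refine lt_of_le_of_lt ?_ h1
    calc w x * ‖f x - l * D x‖ ≤ w x * ((∑ r ∈ Finset.range N,
          (‖c r - l * d r‖ + ε / 4 * |d r|) * x ^ r) + ε / 4 * ‖D x‖) :=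
        mul_le_mul_of_nonneg_left (hbound x h2) (hw x h2)
      _ = _ := by
        rw [mul_add, Finset.mul_sum, norm_mul, Complex.norm_real, Real.norm_of_nonneg (hw x h2)]
        congr 1
        · exact Finset.sum_congr rfl fun r _ => by ring
        · ring
  have := key.add (hwD.const_mul l)
  rw [mul_one, zero_add] at this
  exact this.congr fun x => by ring

/-- The coefficients are compared with those of `M(1, 1+b-a, ·) / Γ(1+b-a)`, whose growth is known.
In the ratio the powers of `r` cancel because `(a - 1) + (b - a) = b - 1`, leaving `1 / Γ(a)`. -/
lemma tendsto_regKummer (a b : ℝ) :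
    Tendsto (fun x : ℝ => ((x ^ (b - a) * Real.exp (-x) : ℝ) : ℂ) * regKummer a b x) atTop
      (𝓝 (rGamma a)) := by
  have hwD := tendsto_regKummer_one (b - a)
  refine tendsto_mul_of_coeff_tendsto (l := rGamma a)
    (c := fun r => (ascPochhammer ℂ r).eval (a : ℂ) * rGamma (b + r) / (r.factorial : ℂ))
    (d := fun r => (Real.Gamma (b - a + r + 1))⁻¹)
    (fun x => (hasSum_regKummer a b x).congr_fun fun r => ?_)
    (fun x => (hasSum_regKummer 1 (1 + (b - a : ℝ)) x).congr_fun fun r => ?_) ?_ ?_ ?_ ?_ hwD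
  · simp only [regKummerTerm]
    ring
  · have hf : (r.factorial : ℂ) ≠ 0 := by exact_mod_cast r.factorial_ne_zero
    simp only [regKummerTerm]
    rw [ascPochhammer_eval_one, ofReal_Gamma_inv,
      show ((b - a + r + 1 : ℝ) : ℂ) = 1 + (b - a : ℝ) + r by push_cast; ring]
    field_simp
  · obtain ⟨N, hN⟩ := exists_nat_gt (-(b - a))
    filter_upwards [eventually_ge_atTop N] with r hr
    have : (N : ℝ) ≤ r := by exact_mod_cast hr
    exact inv_pos.2 (Real.Gamma_pos_of_pos (by linarith))
  · have t1 := Real.tendsto_Gamma_add_nat_div (a - 1)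
    have t2 := Real.tendsto_Gamma_add_nat_div (b - a)
    have t3 := Real.tendsto_Gamma_add_nat_div (b - 1)
    have t4 := ((Complex.continuous_ofReal.tendsto _).comp
      ((t1.mul t2).div t3 one_ne_zero)).const_mul (rGamma a)
    simp only [mul_one, div_one, Complex.ofReal_one] at t4
    refine t4.congr' ?_
    obtain ⟨N, hN⟩ := exists_nat_gt (|a| + |b|)
    filter_upwards [eventually_ge_atTop (N + 1)] with r hr
    have hr' : (N : ℝ) + 1 ≤ r := by exact_mod_cast hr
    have hr0 : (0 : ℝ) < r := by have := abs_nonneg a; have := abs_nonneg b; linarith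
    have ha : Real.Gamma (a + r) ≠ 0 :=
      (Real.Gamma_pos_of_pos (by have := neg_abs_le a; have := abs_nonneg b; linarith)).ne'
    have hb : Real.Gamma (b + r) ≠ 0 :=
      (Real.Gamma_pos_of_pos (by have := neg_abs_le b; have := abs_nonneg a; linarith)).ne'
    have hG : Complex.Gamma (a + r) ≠ 0 := by
      have : ((Real.Gamma (a + r) : ℝ) : ℂ) ≠ 0 := by exact_mod_cast ha
      rwa [← Complex.Gamma_ofReal, Complex.ofReal_add, Complex.ofReal_natCast] at this
    have h1 := rGamma_eq_ascPochhammer_mul a r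
    have h2 : (ascPochhammer ℂ r).eval (a : ℂ) = rGamma a * (Real.Gamma (a + r) : ℝ) := by
      rw [h1, ← Complex.Gamma_ofReal, Complex.ofReal_add, Complex.ofReal_natCast, mul_assoc, rGamma,
        inv_mul_cancel₀ hG, mul_one]
    have h3 : rGamma (b + r) = (((Real.Gamma (b + r))⁻¹ : ℝ) : ℂ) := by
      rw [ofReal_Gamma_inv]; push_cast; rfl
    have h4 : (r : ℝ) ^ (a - 1) * (r : ℝ) ^ (b - a) = (r : ℝ) ^ (b - 1) := by
      rw [← Real.rpow_add hr0]; ring_nf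
    have h5 : (r : ℝ) ^ (b - 1) ≠ 0 := (Real.rpow_pos_of_pos hr0 _).ne'
    have hf : (r.factorial : ℝ) ≠ 0 := by positivity
    rw [h2, h3]
    simp only [Function.comp, Pi.div_apply]
    rw [show a - 1 + r + 1 = a + r by ring, show b - 1 + r + 1 = b + r by ring, div_mul_div_comm,
      mul_mul_mul_comm ((r : ℝ) ^ (a - 1)), h4]
    rw [mul_assoc (rGamma a), mul_div_assoc (rGamma a), mul_div_assoc (rGamma a),
      ← Complex.ofReal_natCast r.factorial, ← Complex.ofReal_mul, ← Complex.ofReal_div,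
      ← Complex.ofReal_div]
    congr 2
    field_simp
  · intro x hx
    positivity
  · intro r
    refine (tendsto_rpow_mul_exp_neg_atTop (b - a + r)).congr' ?_
    filter_upwards [eventually_gt_atTop 0] with x hx
    rw [Real.rpow_add_natCast hx.ne']
    ring

/-- Both summands of `U` grow like `x^(a-b) exp x` with the same constant `1 / (Γ(a) Γ(a-b+1))`, and
the leading terms cancel. This weak bound suffices for the Wronskian with a recessive solution. -/
lemma tendsto_tricomiSurf_log (a : ℝ) {b : ℝ} (hb : ¬∃ m : ℤ, b = m) :
    Tendsto (fun x : ℝ => ((x ^ (b - a) * Real.exp (-x) : ℝ) : ℂ) * tricomiSurf a b (Real.log x))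
      atTop (𝓝 0) := by
  have t1 := (tendsto_regKummer a b).const_mul (rGamma (a - b + 1))
  have t2 := (tendsto_regKummer (a - b + 1) (2 - b)).const_mul (rGamma a)
  push_cast at t1 t2
  have t3 := (t1.sub t2).const_mul (Real.pi / Complex.sin (Real.pi * b))
  rw [mul_comm (rGamma a), sub_self, mul_zero] at t3
  refine t3.congr' ?_
  filter_upwards [eventually_gt_atTop 0] with x hx
  have e1 : Complex.exp (Real.log x) = x := by rw [← Complex.ofReal_exp, Real.exp_log hx]
  have e2 : Complex.exp ((1 - b) * Real.log x) = ((x ^ (1 - b) : ℝ) : ℂ) := by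
    rw [Real.rpow_def_of_pos hx]; push_cast; ring_nf
  have e3 : x ^ (2 - b - (a - b + 1)) = x ^ (b - a) * x ^ (1 - b) := by
    rw [← Real.rpow_add hx]; ring_nf
  rw [tricomiSurf_eq_tricomiGen _ _ (ofReal_ne_intCast hb), tricomiGen, tricomiNum, e1, e2, e3]
  push_cast
  ring

/-! ### Laplace integrals -/

/-- The Laplace transform of `s ^ p * g s`. -/
def laplaceRpow (p : ℝ) (g : ℝ → ℂ) (ζ : ℂ) : ℂ :=
  ∫ s in Ioi (0 : ℝ), Complex.exp (-(ζ * s)) * ((s ^ p : ℝ) : ℂ) * g s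

/-- The class of functions on `(0, ∞)` bounded by a multiple of `exp`. -/
def ExpBounded (K : ℝ) (g : ℝ → ℂ) : Prop :=
  AEStronglyMeasurable g (volume.restrict (Ioi 0)) ∧ ∀ s : ℝ, 0 < s → ‖g s‖ ≤ K * Real.exp s

lemma integrableOn_rpow_mul_exp_neg_mul {p r : ℝ} (hp : -1 < p) (hr : 0 < r) :
    IntegrableOn (fun s : ℝ => s ^ p * Real.exp (-(r * s))) (Ioi 0) := by
  simpa using integrableOn_rpow_mul_exp_neg_mul_rpow hp one_pos hr

lemma aestronglyMeasurable_laplaceRpow {K : ℝ} {g : ℝ → ℂ} (hg : ExpBounded K g) (p : ℝ) (ζ : ℂ) :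
    AEStronglyMeasurable (fun s : ℝ => Complex.exp (-(ζ * s)) * ((s ^ p : ℝ) : ℂ) * g s)
      (volume.restrict (Ioi 0)) := by
  refine AEStronglyMeasurable.mul ?_ hg.1
  refine ContinuousOn.aestronglyMeasurable ?_ measurableSet_Ioi
  refine ContinuousOn.mul (by fun_prop) ?_
  exact Complex.continuous_ofReal.comp_continuousOn
    (continuousOn_id.rpow_const fun s hs => Or.inl (ne_of_gt hs))

lemma norm_laplaceRpow_integrand_le {K r s : ℝ} {g : ℝ → ℂ} (hg : ExpBounded K g) (p : ℝ) {ζ : ℂ}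
    (hr : r ≤ ζ.re) (hs : 0 < s) :
    ‖Complex.exp (-(ζ * s)) * ((s ^ p : ℝ) : ℂ) * g s‖
      ≤ K * (s ^ p * Real.exp (-((r - 1) * s))) := by
  have h1 := hg.2 s hs
  have hK : 0 ≤ K := nonneg_of_mul_nonneg_left ((norm_nonneg _).trans h1) (Real.exp_pos s)
  rw [norm_mul, norm_mul, Complex.norm_exp, Complex.norm_real,
    Real.norm_of_nonneg (Real.rpow_nonneg hs.le p)]
  have h2 : (-(ζ * (s : ℂ))).re ≤ -(r * s) := by
    simp only [Complex.neg_re, Complex.mul_re, Complex.ofReal_re, Complex.ofReal_im, mul_zero,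
      sub_zero]
    nlinarith
  calc _ ≤ Real.exp (-(r * s)) * s ^ p * (K * Real.exp s) := by gcongr
    _ = K * (s ^ p * (Real.exp (-(r * s)) * Real.exp s)) := by ring
    _ = _ := by rw [← Real.exp_add]; ring_nf

lemma integrableOn_laplaceRpow {K p : ℝ} {g : ℝ → ℂ} (hg : ExpBounded K g) (hp : -1 < p) {ζ : ℂ}
    (hζ : 1 < ζ.re) :
    IntegrableOn (fun s : ℝ => Complex.exp (-(ζ * s)) * ((s ^ p : ℝ) : ℂ) * g s) (Ioi 0) := by
  refine Integrable.mono' ((integrableOn_rpow_mul_exp_neg_mul hp (sub_pos.2 hζ)).const_mul K)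
    (aestronglyMeasurable_laplaceRpow hg p ζ) ?_
  filter_upwards [ae_restrict_mem measurableSet_Ioi] with s hs
  exact norm_laplaceRpow_integrand_le hg p le_rfl hs

lemma norm_laplaceRpow_le {K p : ℝ} {g : ℝ → ℂ} (hg : ExpBounded K g) (hp : -1 < p) {ζ : ℂ}
    (hζ : 1 < ζ.re) :
    ‖laplaceRpow p g ζ‖ ≤ K * Real.Gamma (p + 1) * (ζ.re - 1) ^ (-(p + 1)) := by
  have h0 := sub_pos.2 hζ
  have h1 : ‖laplaceRpow p g ζ‖
      ≤ ∫ s in Ioi (0 : ℝ), K * (s ^ p * Real.exp (-((ζ.re - 1) * s))) := by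
    refine norm_integral_le_of_norm_le ((integrableOn_rpow_mul_exp_neg_mul hp h0).const_mul K) ?_
    filter_upwards [ae_restrict_mem measurableSet_Ioi] with s hs
    exact norm_laplaceRpow_integrand_le hg p le_rfl hs
  have h2 := Real.integral_rpow_mul_exp_neg_mul_Ioi (a := p + 1) (by linarith) h0
  rw [add_sub_cancel_right, one_div, Real.inv_rpow h0.le, ← Real.rpow_neg h0.le] at h2
  rw [integral_const_mul, h2] at h1
  linarith

lemma hasDerivAt_laplaceRpow {K p : ℝ} {g : ℝ → ℂ} (hg : ExpBounded K g) (hp : -1 < p) {ζ : ℂ}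
    (hζ : 1 < ζ.re) : HasDerivAt (laplaceRpow p g) (-laplaceRpow (p + 1) g ζ) ζ := by
  set r := (ζ.re + 1) / 2 with hr
  have hr1 : 1 < r := by linarith
  have hs : {w : ℂ | r < w.re} ∈ 𝓝 ζ :=
    (isOpen_lt continuous_const Complex.continuous_re).mem_nhds
      (show r < ζ.re by linarith)
  have key := hasDerivAt_integral_of_dominated_loc_of_deriv_le (μ := volume.restrict (Ioi (0 : ℝ)))
    (F := fun (w : ℂ) (s : ℝ) => Complex.exp (-(w * s)) * ((s ^ p : ℝ) : ℂ) * g s)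
    (F' := fun (w : ℂ) (s : ℝ) => -(Complex.exp (-(w * s)) * ((s ^ (p + 1) : ℝ) : ℂ) * g s))
    (x₀ := ζ) (bound := fun s => K * (s ^ (p + 1) * Real.exp (-((r - 1) * s)))) hs
    (Eventually.of_forall fun w => aestronglyMeasurable_laplaceRpow hg p w)
    (integrableOn_laplaceRpow hg hp hζ)
    (aestronglyMeasurable_laplaceRpow hg (p + 1) ζ).neg ?_
    ((integrableOn_rpow_mul_exp_neg_mul (by linarith) (sub_pos.2 hr1)).const_mul K) ?_
  · refine key.2.congr_deriv ?_
    rw [integral_neg, laplaceRpow]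
  · filter_upwards [ae_restrict_mem measurableSet_Ioi] with s hs w hw
    rw [norm_neg]
    exact norm_laplaceRpow_integrand_le hg (p + 1) (le_of_lt hw) hs
  · filter_upwards [ae_restrict_mem measurableSet_Ioi] with s hs w hw
    have h1 : HasDerivAt (fun w : ℂ => Complex.exp (-(w * s)))
        (Complex.exp (-(w * s)) * -(1 * s)) w :=
      (((hasDerivAt_id w).mul_const (s : ℂ)).neg).cexp
    refine ((h1.mul_const _).mul_const _).congr_deriv ?_
    rw [Real.rpow_add_one (ne_of_gt hs)]
    push_cast
    ring

/-! ### Weights along rotated rays -/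

/-- The weight `(1 + c s) ^ β`. -/
def rayPow (c : ℂ) (β : ℝ) (s : ℝ) : ℂ := (1 + c * s) ^ (β : ℂ)

/-- A ray direction avoiding the branch cut of `rayPow`. -/
def GoodDirection (c : ℂ) : Prop :=
  ‖c‖ ≤ 1 ∧ ∀ s : ℝ, 0 ≤ s → 1 + c * s ∈ Complex.slitPlane ∧ 1 / 2 ≤ ‖1 + c * (s : ℂ)‖

lemma one_add_rpow_le (β : ℝ) : ∃ K : ℝ, 0 ≤ K ∧ ∀ s : ℝ, 0 ≤ s → (1 + s) ^ β ≤ K * Real.exp s := by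
  obtain ⟨n, hn⟩ := exists_nat_ge β
  refine ⟨n.factorial * Real.exp 1, by positivity, fun s hs => ?_⟩
  calc (1 + s) ^ β ≤ (1 + s) ^ (n : ℝ) :=
        Real.rpow_le_rpow_of_exponent_le (by linarith) hn
    _ = (1 + s) ^ n := Real.rpow_natCast _ _
    _ ≤ n.factorial * Real.exp (1 + s) := by
        have := Real.pow_div_factorial_le_exp (1 + s) (by linarith) n
        rw [div_le_iff₀ (by positivity)] at this
        linarith
    _ = _ := by rw [Real.exp_add]; ring

/-- The constant is uniform in `|β| ≤ B`, as dominated convergence in the parameter `b` requires.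
The lower bound `1/2` on `‖1 + c s‖` handles negative exponents. -/
lemma norm_rayPow_le {c : ℂ} (hc : GoodDirection c) (B : ℝ) :
    ∃ K : ℝ, 0 ≤ K ∧ ∀ β : ℝ, |β| ≤ B → ∀ s : ℝ, 0 ≤ s → ‖rayPow c β s‖ ≤ K * Real.exp s := by
  obtain ⟨K, hK0, hK⟩ := one_add_rpow_le B
  refine ⟨K + 2 ^ B, by positivity, fun β hβ s hs => ?_⟩
  obtain ⟨h1, h2⟩ := hc.2 s hs
  obtain ⟨h3, h4⟩ := abs_le.1 hβ
  have h5 : ‖1 + c * (s : ℂ)‖ ≤ 1 + s := by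
    refine (norm_add_le _ _).trans ?_
    rw [norm_one, norm_mul, Complex.norm_real, Real.norm_of_nonneg hs]
    have := hc.1
    nlinarith
  have hexp : 1 ≤ Real.exp s := Real.one_le_exp hs
  have h2B : (0 : ℝ) < 2 ^ B := by positivity
  have hKs := hK s hs
  rw [rayPow, Complex.norm_cpow_real]
  have hpos : 0 < ‖1 + c * (s : ℂ)‖ := by linarith
  rcases le_total 1 ‖1 + c * (s : ℂ)‖ with h | h
  · calc ‖1 + c * (s : ℂ)‖ ^ β ≤ ‖1 + c * (s : ℂ)‖ ^ B := Real.rpow_le_rpow_of_exponent_le h h4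
      _ ≤ (1 + s) ^ B := Real.rpow_le_rpow hpos.le h5 (by linarith)
      _ ≤ _ := by nlinarith
  · calc ‖1 + c * (s : ℂ)‖ ^ β ≤ ‖1 + c * (s : ℂ)‖ ^ (-B) :=
          Real.rpow_le_rpow_of_exponent_ge hpos h h3
      _ ≤ (1 / 2) ^ (-B) := Real.rpow_le_rpow_of_nonpos (by norm_num) h2 (by linarith)
      _ = 2 ^ B := by rw [one_div, Real.inv_rpow (by norm_num), Real.rpow_neg (by norm_num), inv_inv]
      _ ≤ _ := by nlinarith

lemma hasDerivAt_rayPow {c : ℂ} (hc : GoodDirection c) (β : ℝ) {s : ℝ} (hs : 0 ≤ s) :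
    HasDerivAt (rayPow c β) (β * rayPow c (β - 1) s * c) s := by
  have h1 : HasDerivAt (fun w : ℂ => 1 + c * w) (c * 1) (s : ℂ) :=
    ((hasDerivAt_id (s : ℂ)).const_mul c).const_add 1
  refine (h1.cpow_const (c := (β : ℂ)) (hc.2 s hs).1).comp_ofReal.congr_deriv ?_
  simp only [rayPow]
  push_cast
  ring

lemma continuousOn_rayPow {c : ℂ} (hc : GoodDirection c) (β : ℝ) :
    ContinuousOn (rayPow c β) (Ici 0) :=
  fun _ hs => (hasDerivAt_rayPow hc β hs).continuousAt.continuousWithinAt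

lemma exists_expBounded_rayPow {c : ℂ} (hc : GoodDirection c) (β : ℝ) :
    ∃ K, 0 ≤ K ∧ ExpBounded K (rayPow c β) := by
  obtain ⟨K, hK0, hK⟩ := norm_rayPow_le hc |β|
  exact ⟨K, hK0, ((continuousOn_rayPow hc β).mono Ioi_subset_Ici_self).aestronglyMeasurable
    measurableSet_Ioi, fun s hs => hK β le_rfl s hs.le⟩

lemma rayPow_zero (c : ℂ) (β : ℝ) : rayPow c β 0 = 1 := by simp [rayPow]

lemma rayPow_add_one {c : ℂ} (hc : GoodDirection c) (β : ℝ) {s : ℝ} (hs : 0 ≤ s) :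
    rayPow c (β + 1) s = rayPow c β s * (1 + c * s) := by
  rw [rayPow, rayPow, Complex.ofReal_add, Complex.ofReal_one,
    Complex.cpow_add _ _ (Complex.slitPlane_ne_zero (hc.2 s hs).1), Complex.cpow_one]

/-- The factor `s`, from the mean value inequality, becomes one extra power of `1/ζ` after the
Laplace transform. -/
lemma exists_norm_rayPow_sub_one_le {c : ℂ} (hc : GoodDirection c) (β : ℝ) :
    ∃ K : ℝ, 0 ≤ K ∧ ∀ s : ℝ, 0 ≤ s → ‖rayPow c β s - 1‖ ≤ K * Real.exp s * s := by
  obtain ⟨K, hK0, hK⟩ := norm_rayPow_le hc |β - 1|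
  refine ⟨|β| * K, by positivity, fun s hs => ?_⟩
  have := Convex.norm_image_sub_le_of_norm_hasDerivWithin_le (f := rayPow c β) (𝕜 := ℝ)
    (s := Icc 0 s) (x := 0) (y := s) (C := |β| * K * Real.exp s)
    (fun t ht => (hasDerivAt_rayPow hc β ht.1).hasDerivWithinAt) (fun t ht => ?_)
    (convex_Icc 0 s) ⟨le_rfl, hs⟩ ⟨hs, le_rfl⟩
  · rwa [rayPow_zero, sub_zero, Real.norm_of_nonneg hs] at this
  · rw [norm_mul, norm_mul, Complex.norm_real, Real.norm_eq_abs]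
    have h1 := hK (β - 1) le_rfl t ht.1
    have h2 : Real.exp t ≤ Real.exp s := Real.exp_le_exp.2 ht.2
    calc |β| * ‖rayPow c (β - 1) t‖ * ‖c‖ ≤ |β| * (K * Real.exp s) * 1 := by
          gcongr
          · exact h1.trans (by gcongr)
          · exact hc.1
      _ = _ := by ring

/-- The differential equation of the Laplace integral, by integration by parts. -/
lemma laplaceRpow_rayPow_ode {c : ℂ} (hc : GoodDirection c) {a b : ℝ} (ha : 0 < a) {ζ : ℂ}
    (hζ : 1 < ζ.re) :
    c * ζ * laplaceRpow (a + 1) (rayPow c (b - a - 1)) ζ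
      + (ζ - b * c) * laplaceRpow a (rayPow c (b - a - 1)) ζ
      - a * laplaceRpow (a - 1) (rayPow c (b - a - 1)) ζ = 0 := by
  obtain ⟨K, hK0, hK⟩ := exists_expBounded_rayPow hc (b - a - 1)
  obtain ⟨K', hK0', hK'⟩ := exists_expBounded_rayPow hc (b - a)
  have i0 := integrableOn_laplaceRpow hK (p := a - 1) (by linarith) hζ
  have i1 := integrableOn_laplaceRpow hK (p := a) (by linarith) hζ
  have i2 := integrableOn_laplaceRpow hK (p := a + 1) (by linarith) hζ
  -- The function `exp(-ζ s) s^a (1 + c s)^(b-a)` vanishes at `0` and at infinity. Splitting one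
  -- factor `1 + c s` off the weight writes its derivative in the three integrands of the claim.
  have hder : ∀ s ∈ Ioi (0 : ℝ), HasDerivAt
      (fun s : ℝ => Complex.exp (-(ζ * s)) * ((s ^ a : ℝ) : ℂ) * rayPow c (b - a) s)
      (a * (Complex.exp (-(ζ * s)) * ((s ^ (a - 1) : ℝ) : ℂ) * rayPow c (b - a - 1) s)
        - (ζ - b * c) * (Complex.exp (-(ζ * s)) * ((s ^ a : ℝ) : ℂ) * rayPow c (b - a - 1) s)
        - c * ζ * (Complex.exp (-(ζ * s)) * ((s ^ (a + 1) : ℝ) : ℂ) * rayPow c (b - a - 1) s))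
      s := by
    intro s hs
    have hs0 : s ≠ 0 := ne_of_gt hs
    have h1 : HasDerivAt (fun w : ℂ => Complex.exp (-(ζ * w)))
        (Complex.exp (-(ζ * s)) * -(ζ * 1)) (s : ℂ) :=
      (((hasDerivAt_id (s : ℂ)).const_mul ζ).neg).cexp
    have h2 := (Real.hasDerivAt_rpow_const (x := s) (p := a) (Or.inl hs0)).ofReal_comp
    have h3 := hasDerivAt_rayPow hc (b - a) (le_of_lt hs)
    refine ((h1.comp_ofReal.mul h2).mul h3).congr_deriv ?_
    have e1 := rayPow_add_one hc (b - a - 1) (le_of_lt hs)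
    rw [sub_add_cancel] at e1
    have e2 : s ^ a = s ^ (a - 1) * s := by rw [← Real.rpow_add_one hs0, sub_add_cancel]
    simp only [Pi.mul_apply]
    rw [Real.rpow_add_one hs0, e1, e2]
    push_cast
    ring
  have hlim : Tendsto (fun s : ℝ => Complex.exp (-(ζ * s)) * ((s ^ a : ℝ) : ℂ) * rayPow c (b - a) s)
      atTop (𝓝 0) := by
    have h1 : Tendsto (fun s : ℝ => K' * (s ^ a * Real.exp (-((ζ.re - 1) * s)))) atTop (𝓝 0) := by
      have := (tendsto_rpow_mul_exp_neg_mul_atTop_nhds_zero a (ζ.re - 1)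
        (sub_pos.2 hζ)).const_mul K'
      simpa only [mul_zero, neg_mul] using this
    refine squeeze_zero_norm' ?_ h1
    filter_upwards [eventually_gt_atTop 0] with s hs
    exact norm_laplaceRpow_integrand_le hK' a le_rfl hs
  have hcont : ContinuousWithinAt
      (fun s : ℝ => Complex.exp (-(ζ * s)) * ((s ^ a : ℝ) : ℂ) * rayPow c (b - a) s) (Ici 0) 0 := by
    have h1 : Continuous fun s : ℝ => s ^ a := Real.continuous_rpow_const ha.le
    have h2 : Continuous fun s : ℝ => Complex.exp (-(ζ * s)) * ((s ^ a : ℝ) : ℂ) := by fun_prop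
    exact h2.continuousWithinAt.mul (continuousOn_rayPow hc _ 0 (mem_Ici.2 le_rfl))
  have j0 := i0.const_mul (a : ℂ)
  have j1 := i1.const_mul (ζ - b * c)
  have j2 := i2.const_mul (c * ζ)
  have j01 : IntegrableOn (fun s : ℝ =>
      a * (Complex.exp (-(ζ * s)) * ((s ^ (a - 1) : ℝ) : ℂ) * rayPow c (b - a - 1) s)
        - (ζ - b * c) * (Complex.exp (-(ζ * s)) * ((s ^ a : ℝ) : ℂ) * rayPow c (b - a - 1) s))
      (Ioi 0) := j0.sub j1
  have key := integral_Ioi_of_hasDerivAt_of_tendsto hcont hder (j01.sub j2) hlim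
  rw [integral_sub j01 j2, integral_sub j0 j1, integral_const_mul, integral_const_mul,
    integral_const_mul, Real.zero_rpow ha.ne'] at key
  simp only [laplaceRpow]
  simp only [Complex.ofReal_zero, mul_zero, zero_mul, sub_zero] at key
  linear_combination -key

lemma continuous_laplaceRpow_rayPow {c : ℂ} (hc : GoodDirection c) {p : ℝ} (hp : -1 < p) {ζ : ℂ}
    (hζ : 1 < ζ.re) : Continuous fun β : ℝ => laplaceRpow p (rayPow c β) ζ := by
  rw [continuous_iff_continuousAt]
  intro β₀
  obtain ⟨K, hK0, hK⟩ := norm_rayPow_le hc (|β₀| + 1)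
  have hev : ∀ᶠ β in 𝓝 β₀, |β| ≤ |β₀| + 1 := by
    filter_upwards [continuous_abs.continuousAt.eventually_lt_const
      (lt_add_one |β₀|)] with β h using le_of_lt h
  have hB : ∀ᶠ β in 𝓝 β₀, ExpBounded K (rayPow c β) := by
    filter_upwards [hev] with β hβ
    exact ⟨((continuousOn_rayPow hc β).mono Ioi_subset_Ici_self).aestronglyMeasurable
      measurableSet_Ioi, fun s hs => hK β hβ s hs.le⟩
  refine continuousAt_of_dominated
    (bound := fun s => K * (s ^ p * Real.exp (-((ζ.re - 1) * s)))) ?_ ?_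
    ((integrableOn_rpow_mul_exp_neg_mul hp (sub_pos.2 hζ)).const_mul K) ?_
  · filter_upwards [hB] with β hβ using aestronglyMeasurable_laplaceRpow hβ p ζ
  · filter_upwards [hB] with β hβ
    filter_upwards [ae_restrict_mem measurableSet_Ioi] with s hs
    exact norm_laplaceRpow_integrand_le hβ p le_rfl hs
  · filter_upwards [ae_restrict_mem measurableSet_Ioi] with s hs
    have hne := Complex.slitPlane_ne_zero (hc.2 s (le_of_lt hs)).1
    have : Continuous fun β : ℝ => rayPow c β s := by
      simp only [rayPow, Complex.cpow_def_of_ne_zero hne]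
      fun_prop
    fun_prop

/-! ### Recessive solutions on half strips -/

/-- The half strip `X < Re L`, `|Im L + θ| < 5π/12`. -/
def halfStrip (θ X : ℝ) : Set ℂ :=
  Ioi X ×ℂ Ioo (-θ - 5 * Real.pi / 12) (-θ + 5 * Real.pi / 12)

lemma mem_halfStrip {θ X : ℝ} {L : ℂ} :
    L ∈ halfStrip θ X ↔ X < L.re ∧ |L.im + θ| < 5 * Real.pi / 12 := by
  rw [halfStrip, Complex.mem_reProdIm, mem_Ioi, mem_Ioo, abs_lt]
  constructor
  · rintro ⟨h1, h2, h3⟩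
    exact ⟨h1, by linarith, by linarith⟩
  · rintro ⟨h1, h2, h3⟩
    exact ⟨h1, by linarith, by linarith⟩

lemma isOpen_halfStrip (θ X : ℝ) : IsOpen (halfStrip θ X) := isOpen_Ioi.reProdIm isOpen_Ioo

lemma isPreconnected_halfStrip (θ X : ℝ) : IsPreconnected (halfStrip θ X) :=
  (((convex_Ioi X).linear_preimage Complex.reLm).inter
    ((convex_Ioo _ _).linear_preimage Complex.imLm)).isPreconnected

lemma halfStrip_anti (θ : ℝ) {X Y : ℝ} (h : X ≤ Y) : halfStrip θ Y ⊆ halfStrip θ X :=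
  fun _ hL => mem_halfStrip.2 ⟨h.trans_lt (mem_halfStrip.1 hL).1, (mem_halfStrip.1 hL).2⟩

lemma SolvesLogKummer.mono {a b : ℂ} {D E : Set ℂ} {f f' : ℂ → ℂ} (h : SolvesLogKummer a b D f f')
    (hE : E ⊆ D) : SolvesLogKummer a b E f f' := fun L hL => h L (hE hL)

/-- As `5π/12 < π/2`, `Re (exp M)` is at least `κ exp(Re M)` with `κ = cos (5π/12) > 0`; beyond `log
(2/κ)` half of this absorbs the `1`. -/
lemma exists_re_exp_bounds : ∃ X η : ℝ, 0 < η ∧ ∀ M : ℂ, M ∈ halfStrip 0 X →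
    1 < (Complex.exp M).re ∧ η * Real.exp M.re ≤ (Complex.exp M).re - 1 := by
  have hpi := Real.pi_pos
  set κ := Real.cos (5 * Real.pi / 12) with hκ
  have hκ0 : 0 < κ := Real.cos_pos_of_mem_Ioo ⟨by linarith, by linarith⟩
  refine ⟨Real.log (2 / κ), κ / 2, by positivity, fun M hM => ?_⟩
  obtain ⟨h1, h2⟩ := mem_halfStrip.1 hM
  rw [add_zero] at h2
  have h3 : κ ≤ Real.cos M.im := by
    rw [← Real.cos_abs M.im]
    exact Real.cos_le_cos_of_nonneg_of_le_pi (abs_nonneg _) (by linarith) h2.le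
  have h4 : 2 / κ < Real.exp M.re := by
    rwa [← Real.exp_lt_exp, Real.exp_log (by positivity)] at h1
  rw [div_lt_iff₀ hκ0] at h4
  rw [Complex.exp_re]
  have h5 : Real.exp M.re * κ ≤ Real.exp M.re * Real.cos M.im := by gcongr
  constructor <;> nlinarith

/-- For every second parameter there is a solution of size `|z| ^ (-a)` on a half strip; it depends
continuously on that parameter. -/
def HasRecessiveFamily (a θ : ℝ) : Prop :=
  ∃ (X : ℝ) (R R' : ℝ → ℂ → ℂ),
    (∀ b : ℝ, SolvesLogKummer a b (halfStrip θ X) (R b) (R' b)) ∧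
    (∀ L ∈ halfStrip θ X, Continuous (fun b => R b L) ∧ Continuous fun b => R' b L) ∧
    ∀ b : ℝ, ∃ Y K κ : ℝ, 0 < κ ∧ ∀ L ∈ halfStrip θ Y,
      ‖R b L‖ ≤ K * Real.exp (-a * L.re) ∧ ‖R' b L‖ ≤ K * Real.exp (-a * L.re) ∧
      κ * Real.exp (-a * L.re) ≤ ‖R b L‖

lemma goodDirection_zero : GoodDirection 0 := by
  refine ⟨by simp, fun s _ => ?_⟩
  simp only [zero_mul, add_zero, norm_one]
  exact ⟨by simp, by norm_num⟩

/-- Here `|1 + e^{iθ} s|² = 1 + 2 s cos θ + s² ≥ (s - 1/2)² + 3/4`. The angles `±2π/3` used later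
are the extreme case `cos θ = -1/2`. -/
lemma goodDirection_exp {θ : ℝ} (hθ : -1 / 2 ≤ Real.cos θ) :
    GoodDirection (Complex.exp (θ * Complex.I)) := by
  refine ⟨(Complex.norm_exp_ofReal_mul_I θ).le, fun s hs => ?_⟩
  have hre : (1 + Complex.exp (θ * Complex.I) * (s : ℂ)).re = 1 + Real.cos θ * s := by
    simp [Complex.exp_ofReal_mul_I_re]
  have him : (1 + Complex.exp (θ * Complex.I) * (s : ℂ)).im = Real.sin θ * s := by
    simp [Complex.exp_ofReal_mul_I_im]
  have hsc := Real.sin_sq_add_cos_sq θ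
  constructor
  · rw [Complex.mem_slitPlane_iff, hre, him]
    by_contra! h
    obtain ⟨h1, h2⟩ := h
    have hs0 : s ≠ 0 := by
      rintro rfl
      simp at h1
      linarith
    have h3 : Real.sin θ = 0 := (mul_eq_zero.1 h2).resolve_right hs0
    rw [h3] at hsc
    have h4 : 0 ≤ Real.cos θ := by nlinarith
    nlinarith
  · refine (pow_le_pow_iff_left₀ (by norm_num) (norm_nonneg _) two_ne_zero).1 ?_
    rw [Complex.sq_norm, Complex.normSq_apply, hre, him]
    nlinarith [sq_nonneg (s - 1 / 2), mul_nonneg hs (by linarith : 0 ≤ Real.cos θ + 1 / 2)]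

lemma rayPow_zero_left (β s : ℝ) : rayPow 0 β s = 1 := by simp [rayPow]

lemma expBounded_one : ExpBounded 1 fun _ => 1 :=
  ⟨aestronglyMeasurable_const, fun s hs => by simpa using hs.le⟩

lemma hasDerivAt_laplaceRpow_exp {K p : ℝ} {g : ℝ → ℂ} (hg : ExpBounded K g) (hp : -1 < p) {M : ℂ}
    (hM : 1 < (Complex.exp M).re) :
    HasDerivAt (fun M => laplaceRpow p g (Complex.exp M))
      (-(Complex.exp M * laplaceRpow (p + 1) g (Complex.exp M))) M := by
  refine ((hasDerivAt_laplaceRpow hg hp hM).comp M (Complex.hasDerivAt_exp M)).congr_deriv ?_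
  ring

/-- The case `c = 0` of the differential equation shows that the integral times `exp(a M)` is
constant on the half strip; its value comes from the real Gamma integral. -/
lemma laplaceRpow_one_eq {X : ℝ} (hX : ∀ M ∈ halfStrip 0 X, 1 < (Complex.exp M).re) {a : ℝ}
    (ha : 0 < a) {M : ℂ} (hM : M ∈ halfStrip 0 X) :
    laplaceRpow (a - 1) (fun _ => 1) (Complex.exp M) = Real.Gamma a * Complex.exp (-(a * M)) := by
  have hd : ∀ M ∈ halfStrip 0 X, HasDerivAt (fun M => laplaceRpow (a - 1) (fun _ => 1)
      (Complex.exp M) * Complex.exp (a * M)) 0 M := by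
    intro M hM
    have h1 := hasDerivAt_laplaceRpow_exp expBounded_one (p := a - 1) (by linarith) (hX M hM)
    have h2 : HasDerivAt (fun M : ℂ => Complex.exp (a * M)) (Complex.exp (a * M) * (a * 1)) M :=
      ((hasDerivAt_id M).const_mul (a : ℂ)).cexp
    refine (h1.mul h2).congr_deriv ?_
    have h3 := laplaceRpow_rayPow_ode goodDirection_zero (b := 0) ha (hX M hM)
    simp only [funext (rayPow_zero_left _)] at h3
    rw [sub_add_cancel]
    linear_combination (-Complex.exp (a * M)) * h3
  set t : ℝ := X + 1 with ht
  have htm : (t : ℂ) ∈ halfStrip 0 X := by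
    rw [mem_halfStrip]
    simp only [Complex.ofReal_re, Complex.ofReal_im, add_zero, abs_zero]
    exact ⟨by linarith, by positivity⟩
  have hc := (isOpen_halfStrip 0 X).is_const_of_deriv_eq_zero (isPreconnected_halfStrip 0 X)
    (fun L hL => (hd L hL).differentiableAt.differentiableWithinAt)
    (fun L hL => (hd L hL).deriv) hM htm
  have hval : laplaceRpow (a - 1) (fun _ => 1) (Complex.exp t) = Real.Gamma a * Complex.exp (-(a * t)) := by
    have h1 := Real.integral_rpow_mul_exp_neg_mul_Ioi ha (Real.exp_pos t)
    rw [one_div, ← Real.exp_neg, ← Real.exp_mul] at h1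
    have h2 : laplaceRpow (a - 1) (fun _ => 1) (Complex.exp t)
        = ((∫ s in Ioi (0 : ℝ), s ^ (a - 1) * Real.exp (-(Real.exp t * s)) : ℝ) : ℂ) := by
      rw [laplaceRpow, ← integral_complex_ofReal]
      refine integral_congr_ae (Eventually.of_forall fun s => ?_)
      push_cast
      ring
    rw [h2, h1]
    push_cast
    rw [mul_comm]
    ring_nf
  rw [hval, mul_assoc, ← Complex.exp_add, neg_add_cancel, Complex.exp_zero, mul_one] at hc
  rw [← hc, mul_assoc, ← Complex.exp_add, add_neg_cancel, Complex.exp_zero, mul_one]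

lemma exists_norm_laplaceRpow_rayPow_sub_le {c : ℂ} (hc : GoodDirection c) {a : ℝ} (ha : 0 < a)
    (β : ℝ) : ∃ K : ℝ, 0 ≤ K ∧ ∀ ζ : ℂ, 1 < ζ.re →
      ‖laplaceRpow (a - 1) (rayPow c β) ζ - laplaceRpow (a - 1) (fun _ => 1) ζ‖
        ≤ K * (ζ.re - 1) ^ (-(a + 1)) := by
  obtain ⟨K, hK0, hK⟩ := exists_norm_rayPow_sub_one_le hc β
  obtain ⟨K₁, -, hK₁⟩ := exists_expBounded_rayPow hc β
  set h : ℝ → ℂ := fun s => (rayPow c β s - 1) * ((s : ℂ))⁻¹ with hh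
  have hb : ExpBounded K h := by
    constructor
    · refine ContinuousOn.aestronglyMeasurable ?_ measurableSet_Ioi
      refine (((continuousOn_rayPow hc β).mono Ioi_subset_Ici_self).sub continuousOn_const).mul ?_
      exact Complex.continuous_ofReal.continuousOn.inv₀ fun s hs => by
        exact_mod_cast (ne_of_gt hs)
    · intro s hs
      rw [hh]
      simp only
      rw [norm_mul, norm_inv, Complex.norm_real, Real.norm_of_nonneg hs.le, ← div_eq_mul_inv,
        div_le_iff₀ hs]
      exact hK s hs.le
  refine ⟨K * Real.Gamma (a + 1), mul_nonneg hK0 (Real.Gamma_pos_of_pos (by linarith)).le,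
    fun ζ hζ => ?_⟩
  have h1 : laplaceRpow (a - 1) (rayPow c β) ζ - laplaceRpow (a - 1) (fun _ => 1) ζ
      = laplaceRpow a h ζ := by
    rw [laplaceRpow, laplaceRpow, laplaceRpow,
      ← integral_sub (integrableOn_laplaceRpow hK₁ (by linarith) hζ)
        (integrableOn_laplaceRpow expBounded_one (by linarith) hζ)]
    refine setIntegral_congr_fun measurableSet_Ioi fun s hs => ?_
    have hs0 : s ≠ 0 := ne_of_gt hs
    have hs0' : (s : ℂ) ≠ 0 := by exact_mod_cast hs0
    have e2 : s ^ a = s ^ (a - 1) * s := by rw [← Real.rpow_add_one hs0, sub_add_cancel]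
    simp only [hh]
    rw [e2]
    push_cast
    field_simp
  rw [h1]
  exact norm_laplaceRpow_le hb (by linarith) hζ

/-- The solution is the Laplace integral of `s^(a-1) (1 + e^{iθ} s)^(b-a-1)` at `ζ = z e^{iθ}`, that
is, the classical one with its ray turned by `θ`. It differs from `Γ(a) ζ^(-a)` by `O(|ζ|^(-a-1))`,
which gives the lower bound for large `|z|`. -/
lemma hasRecessiveFamily_of_pos {a θ : ℝ} (ha : 0 < a) (hθ : -1 / 2 ≤ Real.cos θ) :
    HasRecessiveFamily a θ := by
  obtain ⟨X, η, hη, hX⟩ := exists_re_exp_bounds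
  set c := Complex.exp (θ * Complex.I) with hcdef
  have hc : GoodDirection c := goodDirection_exp hθ
  have hmem : ∀ {Y : ℝ} {L : ℂ}, L ∈ halfStrip θ Y → L + θ * Complex.I ∈ halfStrip 0 Y := by
    intro Y L hL
    rw [mem_halfStrip] at hL ⊢
    simpa using hL
  refine ⟨X, fun b L => laplaceRpow (a - 1) (rayPow c (b - a - 1)) (Complex.exp (L + θ * Complex.I)),
    fun b L => -(Complex.exp (L + θ * Complex.I)
      * laplaceRpow a (rayPow c (b - a - 1)) (Complex.exp (L + θ * Complex.I))), ?_, ?_, ?_⟩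
  · intro b L hL
    obtain ⟨K, -, hK⟩ := exists_expBounded_rayPow hc (b - a - 1)
    have h1 := (hX _ (hmem hL)).1
    have d1 := (hasDerivAt_laplaceRpow_exp hK (p := a - 1) (by linarith) h1).comp_add_const L _
    have d2 := (hasDerivAt_laplaceRpow_exp hK (p := a) (by linarith) h1).comp_add_const L _
    have d3 := (Complex.hasDerivAt_exp (L + θ * Complex.I)).comp_add_const L _
    rw [sub_add_cancel] at d1
    refine ⟨d1, (d3.mul d2).neg.congr_deriv ?_⟩
    have h2 := laplaceRpow_rayPow_ode hc (b := b) ha h1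
    have h3 : Complex.exp (L + θ * Complex.I) = Complex.exp L * c := Complex.exp_add _ _
    have hc0 : c ≠ 0 := Complex.exp_ne_zero _
    simp only [h3] at h2 ⊢
    linear_combination (Complex.exp L) * h2
  · intro L hL
    have h1 := (hX _ (hmem hL)).1
    have c1 := (continuous_laplaceRpow_rayPow hc (p := a - 1) (by linarith) h1).comp
      (by fun_prop : Continuous fun b : ℝ => b - a - 1)
    have c2 := (continuous_laplaceRpow_rayPow hc (p := a) (by linarith) h1).comp
      (by fun_prop : Continuous fun b : ℝ => b - a - 1)
    exact ⟨c1, (continuous_const.mul c2).neg⟩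
  · intro b
    obtain ⟨K, hK0, hK⟩ := exists_expBounded_rayPow hc (b - a - 1)
    obtain ⟨K₂, hK₂0, hK₂⟩ := exists_norm_laplaceRpow_rayPow_sub_le hc ha (b - a - 1)
    have hG := Real.Gamma_pos_of_pos ha
    have hG1 := Real.Gamma_pos_of_pos (by linarith : 0 < a + 1)
    have hpow : ∀ (q : ℝ) (L : ℂ), 0 < q → L ∈ halfStrip θ X →
        ((Complex.exp (L + θ * Complex.I)).re - 1) ^ (-q) ≤ η ^ (-q) * Real.exp (-q * L.re) := by
      intro q L hq hL
      have h2 := (hX _ (hmem hL)).2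
      have h3 : (L + θ * Complex.I).re = L.re := by simp
      rw [h3] at h2
      have h4 : Real.exp (-q * L.re) = (Real.exp L.re) ^ (-q) := by
        rw [← Real.exp_mul, mul_comm]
      rw [h4, ← Real.mul_rpow hη.le (Real.exp_pos _).le]
      exact Real.rpow_le_rpow_of_nonpos (by positivity) h2 (by linarith)
    set C₁ := K * Real.Gamma a * η ^ (-a)
    set C₂ := K * Real.Gamma (a + 1) * η ^ (-(a + 1))
    set C₃ := K₂ * η ^ (-(a + 1)) with hC₃
    have hC₃0 : 0 ≤ C₃ := by positivity
    have hC₁0 : 0 ≤ C₁ := by positivity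
    have hC₂0 : 0 ≤ C₂ := by positivity
    refine ⟨max X (Real.log (2 * C₃ / Real.Gamma a + 1)), C₁ + C₂, Real.Gamma a / 2, by positivity,
      fun L hL => ?_⟩
    have hL' : L ∈ halfStrip θ X := halfStrip_anti θ (le_max_left _ _) hL
    have h1 := (hX _ (hmem hL')).1
    have hexp := Real.exp_pos (-a * L.re)
    have n0 := norm_laplaceRpow_le hK (p := a - 1) (by linarith) h1
    rw [sub_add_cancel] at n0
    have n1 := n0.trans (mul_le_mul_of_nonneg_left (hpow a L ha hL') (mul_nonneg hK0 hG.le))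
    have n2 := (norm_laplaceRpow_le hK (p := a) (by linarith) h1).trans
      (mul_le_mul_of_nonneg_left (hpow (a + 1) L (by linarith) hL') (mul_nonneg hK0 hG1.le))
    have n3 := (hK₂ _ h1).trans
      (mul_le_mul_of_nonneg_left (hpow (a + 1) L (by linarith) hL') hK₂0)
    have e1 : ‖Complex.exp (L + θ * Complex.I)‖ = Real.exp L.re := by
      rw [Complex.norm_exp]; simp
    have e2 : Real.exp (-(a + 1) * L.re) * Real.exp L.re = Real.exp (-a * L.re) := by
      rw [← Real.exp_add]; ring_nf
    refine ⟨?_, ?_, ?_⟩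
    · simp only [C₁] at *
      nlinarith
    · rw [norm_neg, norm_mul, e1]
      calc _ ≤ Real.exp L.re * (K * Real.Gamma (a + 1)
            * (η ^ (-(a + 1)) * Real.exp (-(a + 1) * L.re))) := by gcongr
        _ = C₂ * (Real.exp (-(a + 1) * L.re) * Real.exp L.re) := by ring
        _ ≤ _ := by rw [e2]; nlinarith
    · have h5 := laplaceRpow_one_eq (fun M hM => (hX M hM).1) ha (hmem hL')
      have h6 : ‖laplaceRpow (a - 1) (fun _ => 1) (Complex.exp (L + θ * Complex.I))‖
          = Real.Gamma a * Real.exp (-a * L.re) := by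
        rw [h5, norm_mul, Complex.norm_real, Real.norm_of_nonneg hG.le, Complex.norm_exp]
        simp
      have h7 : 2 * C₃ / Real.Gamma a + 1 < Real.exp L.re := by
        have := (le_max_right X _).trans_lt (mem_halfStrip.1 hL).1
        rwa [← Real.exp_lt_exp, Real.exp_log (by positivity)] at this
      have h8 : 2 * C₃ ≤ Real.Gamma a * Real.exp L.re := by
        have h9 : 2 * C₃ / Real.Gamma a ≤ Real.exp L.re := by linarith
        rw [div_le_iff₀ hG] at h9
        linarith
      have h10 := norm_sub_norm_le
        (laplaceRpow (a - 1) (fun _ => 1) (Complex.exp (L + θ * Complex.I)))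
        (laplaceRpow (a - 1) (rayPow c (b - a - 1)) (Complex.exp (L + θ * Complex.I)))
      rw [norm_sub_rev, h6] at h10
      have h11 : K₂ * (η ^ (-(a + 1)) * Real.exp (-(a + 1) * L.re))
          ≤ Real.Gamma a / 2 * Real.exp (-a * L.re) := by
        rw [← e2, ← mul_assoc, ← hC₃]
        have := Real.exp_pos (-(a + 1) * L.re)
        nlinarith
      linarith

/-- The relation `U(a) = (a + 1 - b + z) U(a+1) - z U'(a+1)` maps solutions for `a + 1` to solutions
for `a`. The term `z U(a+1)` dominates for large `|z|`, so the exact order is kept. This removes the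
condition `a > 0` of the Laplace integral. -/
lemma HasRecessiveFamily.of_add_one {a θ : ℝ} (h : HasRecessiveFamily (a + 1) θ) :
    HasRecessiveFamily a θ := by
  obtain ⟨X, R, R', hode, hcont, hbd⟩ := h
  refine ⟨X, fun b L => (a + 1 - b + Complex.exp L) * R b L - R' b L,
    fun b L => -(a * Complex.exp L * R b L) + a * R' b L, ?_, ?_, ?_⟩
  · intro b L hL
    obtain ⟨h1, h2⟩ := hode b L hL
    have hE := Complex.hasDerivAt_exp L
    push_cast at h2
    refine ⟨(((hE.const_add (a + 1 - b : ℂ)).mul h1).sub h2).congr_deriv ?_,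
      (((hE.const_mul (a : ℂ)).mul h1).neg.add (h2.const_mul (a : ℂ))).congr_deriv ?_⟩
    · ring
    · ring
  · intro L hL
    obtain ⟨c1, c2⟩ := hcont L hL
    exact ⟨by fun_prop, by fun_prop⟩
  · intro b
    obtain ⟨Y, K, κ, hκ, hb⟩ := hbd b
    set B := |a + 1 - b| with hB
    have hB0 : 0 ≤ B := abs_nonneg _
    refine ⟨max (max Y 0) (Real.log (2 * (B + |K| / κ) + 1)), (B + 2 + 2 * |a|) * |K|, κ / 2,
      by positivity, fun L hL => ?_⟩
    obtain ⟨hr, -⟩ := mem_halfStrip.1 hL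
    have hY : L ∈ halfStrip θ Y := halfStrip_anti θ ((le_max_left _ _).trans (le_max_left _ _)) hL
    have hr0 : 0 < L.re := (le_max_right Y 0).trans_lt ((le_max_left _ _).trans_lt hr)
    have hrl : 2 * (B + |K| / κ) + 1 < Real.exp L.re := by
      have := (le_max_right (max Y 0) _).trans_lt hr
      rwa [← Real.exp_lt_exp, Real.exp_log (by positivity)] at this
    obtain ⟨b1, b2, b3⟩ := hb L hY
    have hE1 : 1 ≤ Real.exp L.re := Real.one_le_exp hr0.le
    set E := Real.exp L.re with hE
    set q := Real.exp (-(a + 1) * L.re) with hq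
    have hq0 : 0 < q := Real.exp_pos _
    have e2 : Real.exp (-a * L.re) = q * E := by
      rw [hq, hE, ← Real.exp_add]; ring_nf
    have e3 : ‖Complex.exp L‖ = E := Complex.norm_exp L
    have e4 : ‖(a + 1 - b : ℂ)‖ = B := by
      rw [hB, ← Real.norm_eq_abs, ← Complex.norm_real]; push_cast; rfl
    have hK : K ≤ |K| := le_abs_self K
    have hK0 := abs_nonneg K
    have b1' : ‖R b L‖ ≤ |K| * q := b1.trans (by gcongr)
    have b2' : ‖R' b L‖ ≤ |K| * q := b2.trans (by gcongr)
    have e5 : ‖(a : ℂ)‖ = |a| := by rw [Complex.norm_real, Real.norm_eq_abs]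
    have hKq : 0 ≤ |K| * q := by positivity
    have ha0 := abs_nonneg a
    rw [e2]
    refine ⟨?_, ?_, ?_⟩
    · calc ‖(a + 1 - b + Complex.exp L) * R b L - R' b L‖
          ≤ (B + E) * (|K| * q) + |K| * q := by
            refine (norm_sub_le _ _).trans (add_le_add ?_ b2')
            rw [norm_mul]
            have := norm_add_le (a + 1 - b : ℂ) (Complex.exp L)
            rw [e3, e4] at this
            gcongr
        _ ≤ (B + 2) * |K| * (q * E) := by nlinarith [mul_nonneg hB0 hKq]
        _ ≤ _ := by
          have : 0 ≤ 2 * |a| * |K| * (q * E) := by positivity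
          nlinarith
    · calc ‖-(a * Complex.exp L * R b L) + a * R' b L‖
          ≤ |a| * E * (|K| * q) + |a| * (|K| * q) := by
            refine (norm_add_le _ _).trans ?_
            rw [norm_neg, norm_mul, norm_mul, norm_mul, e3, e5]
            gcongr
        _ ≤ (2 * |a|) * |K| * (q * E) := by nlinarith [mul_nonneg ha0 hKq]
        _ ≤ _ := by
          have : 0 ≤ (B + 2) * |K| * (q * E) := by positivity
          nlinarith
    · have h1 : E * ‖R b L‖ - B * ‖R b L‖ - |K| * q
          ≤ ‖(a + 1 - b + Complex.exp L) * R b L - R' b L‖ := by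
        have h2 := norm_sub_norm_le (Complex.exp L * R b L)
          (-((a + 1 - b : ℂ) * R b L) + R' b L)
        have h3 := norm_add_le (-((a + 1 - b : ℂ) * R b L)) (R' b L)
        rw [norm_neg, norm_mul, e4] at h3
        rw [norm_mul, e3] at h2
        have h4 : Complex.exp L * R b L - (-((a + 1 - b : ℂ) * R b L) + R' b L)
            = (a + 1 - b + Complex.exp L) * R b L - R' b L := by ring
        rw [h4] at h2
        linarith
      have h2 : |K| * q ≤ |K| / κ * ‖R b L‖ := by
        rw [div_mul_eq_mul_div, le_div_iff₀ hκ]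
        nlinarith
      have hR0 := norm_nonneg (R b L)
      have h3 : (B + |K| / κ) * ‖R b L‖ ≤ E / 2 * ‖R b L‖ := by
        gcongr
        linarith
      have h4 : E / 2 * (κ * q) ≤ E / 2 * ‖R b L‖ := by gcongr
      nlinarith

lemma hasRecessiveFamily (a : ℝ) {θ : ℝ} (hθ : -1 / 2 ≤ Real.cos θ) : HasRecessiveFamily a θ := by
  have key : ∀ n : ℕ, ∀ a : ℝ, 0 < a + n → HasRecessiveFamily a θ := by
    intro n
    induction n with
    | zero => intro a ha; exact hasRecessiveFamily_of_pos (by simpa using ha) hθ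
    | succ n ih =>
      intro a ha
      exact (ih (a + 1) (by push_cast at ha; linarith)).of_add_one
  obtain ⟨n, hn⟩ := exists_nat_gt (-a)
  exact key n a (by linarith)

/-! ### The Tricomi function is recessive -/

lemma SolvesLogKummer.wronskian_eq_zero {a b : ℂ} {D : Set ℂ} {f f' h h' : ℂ → ℂ}
    (hf : SolvesLogKummer a b D f f') (hh : SolvesLogKummer a b D h h') (hD : IsOpen D)
    (hDc : IsPreconnected D) {v : ℝ → ℂ} (hv : ∀ᶠ t in atTop, v t ∈ D)
    (hlim : Tendsto (fun t => (f (v t) * h' (v t) - f' (v t) * h (v t))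
      * Complex.exp (-((1 - b) * v t + Complex.exp (v t)))) atTop (𝓝 0)) {L : ℂ} (hL : L ∈ D) :
    f L * h' L - f' L * h L = 0 := by
  have h1 : Tendsto (fun t => (f (v t) * h' (v t) - f' (v t) * h (v t))
      * Complex.exp (-((1 - b) * v t + Complex.exp (v t)))) atTop
      (𝓝 ((f L * h' L - f' L * h L) * Complex.exp (-((1 - b) * L + Complex.exp L)))) := by
    refine tendsto_const_nhds.congr' ?_
    filter_upwards [hv] with t ht
    exact hf.wronskian_eq hh hD hDc hL ht
  exact (mul_eq_zero.1 (tendsto_nhds_unique h1 hlim)).resolve_right (Complex.exp_ne_zero _)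

lemma log_mem_halfStrip_zero {X x : ℝ} (h : X < Real.log x) :
    (Real.log x : ℂ) ∈ halfStrip 0 X := by
  rw [mem_halfStrip]
  simp only [Complex.ofReal_re, Complex.ofReal_im, add_zero, abs_zero]
  exact ⟨h, by positivity⟩

/-- Along the positive axis Abel's weight splits as `x^(b-a) exp(-x)` times `x^(a-1)`. The first
factor sends `U` to `0`, the second keeps `R'` bounded. The derivative of `U` is `-a x U(a+1, b+1)`:
its `x` restores the factor `x^a` for `R`, and `b - a` is unchanged. -/
lemma tricomiSurf_wronskian_eq_zero_of_not_int {a b : ℝ} (hb : ¬∃ m : ℤ, b = m) {X Y K : ℝ}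
    {R R' : ℂ → ℂ} (hR : SolvesLogKummer a b (halfStrip 0 X) R R')
    (hbd : ∀ L ∈ halfStrip 0 Y, ‖R L‖ ≤ K * Real.exp (-a * L.re) ∧
      ‖R' L‖ ≤ K * Real.exp (-a * L.re)) {L : ℂ} (hL : L ∈ halfStrip 0 X) :
    tricomiSurf a b L * R' L - tricomiSurfDeriv a b L * R L = 0 := by
  refine (solvesLogKummer_tricomiSurf a b _).wronskian_eq_zero hR (isOpen_halfStrip 0 X)
    (isPreconnected_halfStrip 0 X) (v := fun x : ℝ => (Real.log x : ℂ)) ?_ ?_ hL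
  · filter_upwards [Real.tendsto_log_atTop.eventually_gt_atTop X] with x hx
    exact log_mem_halfStrip_zero hx
  · have hb' : ¬∃ m : ℤ, b + 1 = m := by
      rintro ⟨m, hm⟩
      exact hb ⟨m - 1, by push_cast; linarith⟩
    have t1 := (tendsto_tricomiSurf_log a hb).norm
    have t2 := (tendsto_tricomiSurf_log (a + 1) hb').norm
    rw [norm_zero] at t1 t2
    have t3 := (t1.mul_const |K|).add ((t2.const_mul |a|).mul_const |K|)
    simp only [zero_mul, mul_zero, add_zero] at t3
    refine squeeze_zero_norm' ?_ t3
    filter_upwards [Real.tendsto_log_atTop.eventually_gt_atTop Y, eventually_ge_atTop 1]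
      with x hxY hx1
    have hx : 0 < x := by linarith
    obtain ⟨b1, b2⟩ := hbd _ (log_mem_halfStrip_zero hxY)
    have e1 : Complex.exp (Real.log x) = x := by rw [← Complex.ofReal_exp, Real.exp_log hx]
    have e2 : Real.exp (-a * (Real.log x : ℂ).re) = x ^ (-a) := by
      rw [Complex.ofReal_re, Real.rpow_def_of_pos hx, mul_comm]
    have e3 : Complex.exp (-((1 - b) * Real.log x + x))
        = ((x ^ (b - a) * Real.exp (-x) * (x ^ a * x⁻¹) : ℝ) : ℂ) := by
      have : x ^ (b - a) * Real.exp (-x) * (x ^ a * x⁻¹) = x ^ (b - 1) * Real.exp (-x) := by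
        rw [← Real.rpow_neg_one x, mul_right_comm, ← Real.rpow_add hx, ← Real.rpow_add hx]
        ring_nf
      rw [this, Real.rpow_def_of_pos hx, ← Real.exp_add, Complex.ofReal_exp]
      push_cast
      ring_nf
    rw [e2] at b1 b2
    have e4 : x ^ a * x ^ (-a) = 1 := by
      rw [← Real.rpow_add hx, add_neg_cancel, Real.rpow_zero]
    have hxa : 0 < x ^ a := Real.rpow_pos_of_pos hx a
    have b1' : x ^ a * ‖R (Real.log x)‖ ≤ |K| := by
      calc _ ≤ x ^ a * (|K| * x ^ (-a)) := by
            refine mul_le_mul_of_nonneg_left (b1.trans ?_) hxa.le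
            gcongr
            exact le_abs_self K
        _ = |K| * (x ^ a * x ^ (-a)) := by ring
        _ = |K| := by rw [e4, mul_one]
    have b2' : x ^ a * x⁻¹ * ‖R' (Real.log x)‖ ≤ |K| := by
      have hinv : x⁻¹ ≤ 1 := inv_le_one_of_one_le₀ hx1
      calc _ ≤ x ^ a * 1 * (|K| * x ^ (-a)) := by
            refine mul_le_mul (by gcongr) (b2.trans ?_) (norm_nonneg _) (by positivity)
            gcongr
            exact le_abs_self K
        _ = |K| * (x ^ a * x ^ (-a)) := by ring
        _ = |K| := by rw [e4, mul_one]
    rw [e1, e3, tricomiSurfDeriv, e1]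
    have e5 : b + 1 - (a + 1) = b - a := by ring
    rw [e5]
    have e6 : (tricomiSurf a b (Real.log x) * R' (Real.log x)
        - -(a * x * tricomiSurf (a + 1) (b + 1) (Real.log x)) * R (Real.log x))
        * ((x ^ (b - a) * Real.exp (-x) * (x ^ a * x⁻¹) : ℝ) : ℂ)
        = (((x ^ (b - a) * Real.exp (-x) : ℝ) : ℂ) * tricomiSurf a b (Real.log x))
            * (((x ^ a * x⁻¹ : ℝ) : ℂ) * R' (Real.log x))
          + a * (((x ^ (b - a) * Real.exp (-x) : ℝ) : ℂ)
            * tricomiSurf (a + 1) (b + 1) (Real.log x)) * (((x ^ a : ℝ) : ℂ) * R (Real.log x)) := by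
      have hx0 : (x : ℂ) ≠ 0 := by exact_mod_cast hx.ne'
      push_cast
      field_simp
      ring
    rw [e6]
    have hcast : ((a + 1 : ℝ) : ℂ) = a + 1 := by push_cast; rfl
    have hcast' : ((b + 1 : ℝ) : ℂ) = b + 1 := by push_cast; rfl
    rw [hcast, hcast']
    refine (norm_add_le _ _).trans (add_le_add ?_ ?_)
    · rw [norm_mul]
      refine mul_le_mul_of_nonneg_left ?_ (norm_nonneg _)
      rw [norm_mul, Complex.norm_real, Real.norm_of_nonneg (by positivity)]
      exact b2'
    · rw [norm_mul, norm_mul (a : ℂ), Complex.norm_real a, Real.norm_eq_abs]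
      refine mul_le_mul_of_nonneg_left ?_ (by positivity)
      rw [norm_mul, Complex.norm_real, Real.norm_of_nonneg hxa.le]
      exact b1'

/-- On the right half plane the Tricomi function is proportional to a recessive solution. -/
lemma exists_recessive_zero (a b : ℝ) : ∃ (X K κ : ℝ) (R R' : ℂ → ℂ), 0 < κ ∧
    SolvesLogKummer a b (halfStrip 0 X) R R' ∧ ∀ L ∈ halfStrip 0 X,
      ‖R L‖ ≤ K * Real.exp (-a * L.re) ∧ ‖R' L‖ ≤ K * Real.exp (-a * L.re) ∧
      κ * Real.exp (-a * L.re) ≤ ‖R L‖ ∧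
      tricomiSurf a b L * R' L - tricomiSurfDeriv a b L * R L = 0 := by
  obtain ⟨X, R, R', hode, hcont, hbd⟩ := hasRecessiveFamily a (θ := 0) (by norm_num)
  obtain ⟨Y, K, κ, hκ, hb⟩ := hbd b
  refine ⟨max X Y, K, κ, R b, R' b, hκ, (hode b).mono (halfStrip_anti 0 (le_max_left _ _)),
    fun L hL => ?_⟩
  obtain ⟨h1, h2, h3⟩ := hb L (halfStrip_anti 0 (le_max_right _ _) hL)
  have hLX := halfStrip_anti 0 (le_max_left _ _) hL
  refine ⟨h1, h2, h3, ?_⟩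
  obtain ⟨c1, c2⟩ := hcont L hLX
  -- The growth estimate covers only noninteger parameters. An integer `b` is reached as a limit,
  -- for which the family `R` was made continuous in `b`.
  have t1 := (tendsto_tricomiGen a b L).comp (tendsto_ofReal_nhdsNE b)
  have t2 := (tendsto_tricomiGen_deriv a b L).comp (tendsto_ofReal_nhdsNE b)
  have t3 := (t1.mul ((c2.tendsto b).mono_left nhdsWithin_le_nhds)).sub
    (t2.mul ((c1.tendsto b).mono_left nhdsWithin_le_nhds))
  refine tendsto_nhds_unique t3 (tendsto_const_nhds.congr' ?_)
  filter_upwards [eventually_not_exists_eq_intCast b] with β hβ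
  obtain ⟨Y', K', κ', -, hb'⟩ := hbd β
  have h4 := tricomiSurf_wronskian_eq_zero_of_not_int hβ (hode β)
    (fun L hL => ⟨(hb' L hL).1, (hb' L hL).2.1⟩) hLX
  have hβ1 : ∀ m : ℤ, ((β : ℂ) + 1) ≠ m := fun m h =>
    ofReal_ne_intCast hβ (m - 1) (by push_cast; rw [← h]; ring)
  rw [tricomiSurfDeriv, tricomiSurf_eq_tricomiGen _ _ (ofReal_ne_intCast hβ),
    tricomiSurf_eq_tricomiGen _ _ hβ1] at h4
  exact h4.symm

/-- The ray `Im L = -θ/2` lies in both half strips, since `π/3 < 5π/12`, and there `Re (exp L) =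
exp(Re L) / 2`. Abel's weight decays doubly exponentially and beats the sizes of the two solutions.
-/
lemma recessive_wronskian_eq_zero {a b θ X Y K K' : ℝ} (hθ : |θ| = 2 * Real.pi / 3)
    {R R' S S' : ℂ → ℂ} (hR : SolvesLogKummer a b (halfStrip 0 X) R R')
    (hS : SolvesLogKummer a b (halfStrip θ Y) S S')
    (hRb : ∀ L ∈ halfStrip 0 X, ‖R L‖ ≤ K * Real.exp (-a * L.re) ∧
      ‖R' L‖ ≤ K * Real.exp (-a * L.re))
    (hSb : ∀ L ∈ halfStrip θ Y, ‖S L‖ ≤ K' * Real.exp (-a * L.re) ∧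
      ‖S' L‖ ≤ K' * Real.exp (-a * L.re))
    {L : ℂ} (hL : L ∈ halfStrip 0 X) (hL' : L ∈ halfStrip θ Y) :
    R L * S' L - R' L * S L = 0 := by
  have hpi := Real.pi_pos
  set D := halfStrip 0 X ∩ halfStrip θ Y with hD
  set v : ℝ → ℂ := fun t => t + ((-(θ / 2) : ℝ) : ℂ) * Complex.I with hv
  have hvre : ∀ t, (v t).re = t := fun t => by simp [hv]
  have hvim : ∀ t, (v t).im = -(θ / 2) := fun t => by simp [hv]
  have habs : |θ / 2| = Real.pi / 3 := by rw [abs_div, hθ, abs_two]; ring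
  have hvD : ∀ t, max X Y < t → v t ∈ D := fun t ht => by
    refine ⟨mem_halfStrip.2 ⟨?_, ?_⟩, mem_halfStrip.2 ⟨?_, ?_⟩⟩
    · rw [hvre]; exact (le_max_left _ _).trans_lt ht
    · rw [hvim, add_zero, abs_neg, habs]; linarith
    · rw [hvre]; exact (le_max_right _ _).trans_lt ht
    · rw [hvim, show -(θ / 2) + θ = θ / 2 by ring, habs]; linarith
  have hconv : IsPreconnected D := by
    have h1 : Convex ℝ D := by
      refine Convex.inter ?_ ?_ <;>
      exact ((convex_Ioi _).linear_preimage Complex.reLm).inter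
        ((convex_Ioo _ _).linear_preimage Complex.imLm)
    exact h1.isPreconnected
  refine (hR.mono inter_subset_left).wronskian_eq_zero (hS.mono inter_subset_right)
    ((isOpen_halfStrip _ _).inter (isOpen_halfStrip _ _)) hconv (v := v) ?_ ?_ ⟨hL, hL'⟩
  · filter_upwards [eventually_gt_atTop (max X Y)] with t ht using hvD t ht
  · have hcos : Real.cos (-(θ / 2)) = 1 / 2 := by
      rw [Real.cos_neg, ← Real.cos_abs, habs, Real.cos_pi_div_three]
    set q : ℝ := -(2 * a + 1 - b) with hq
    have t1 : Tendsto (fun t : ℝ => 2 * |K| * |K'|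
        * ((Real.exp t) ^ q * Real.exp (-(1 / 2) * Real.exp t))) atTop (𝓝 0) := by
      have := ((tendsto_rpow_mul_exp_neg_mul_atTop_nhds_zero q (1 / 2) (by norm_num)).comp
        Real.tendsto_exp_atTop).const_mul (2 * |K| * |K'|)
      simpa only [mul_zero, Function.comp_def] using this
    refine squeeze_zero_norm' ?_ t1
    filter_upwards [eventually_gt_atTop (max X Y)] with t ht
    obtain ⟨m1, m2⟩ := hvD t ht
    obtain ⟨r1, r2⟩ := hRb _ m1
    obtain ⟨s1, s2⟩ := hSb _ m2
    rw [hvre] at r1 r2 s1 s2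
    set E := Real.exp (-a * t) with hE
    have hE0 : 0 < E := Real.exp_pos _
    have up : ∀ {x k : ℝ}, x ≤ k * E → x ≤ |k| * E := fun h =>
      h.trans (mul_le_mul_of_nonneg_right (le_abs_self _) hE0.le)
    have hW : ‖R (v t) * S' (v t) - R' (v t) * S (v t)‖ ≤ 2 * |K| * |K'| * (E * E) := by
      refine (norm_sub_le _ _).trans ?_
      rw [norm_mul, norm_mul]
      have p1 := mul_le_mul (up r1) (up s2) (norm_nonneg _) (by positivity)
      have p2 := mul_le_mul (up r2) (up s1) (norm_nonneg _) (by positivity)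
      linarith
    have hexp : ‖Complex.exp (-((1 - b) * v t + Complex.exp (v t)))‖
        = Real.exp (-((1 - b) * t)) * Real.exp (-(1 / 2) * Real.exp t) := by
      rw [Complex.norm_exp, ← Real.exp_add]
      congr 1
      rw [Complex.neg_re, Complex.add_re, Complex.exp_re, hvre, hvim, hcos]
      have : ((1 - b : ℂ) * v t).re = (1 - b) * t := by
        rw [show (1 - b : ℂ) = ((1 - b : ℝ) : ℂ) by push_cast; rfl, Complex.re_ofReal_mul, hvre]
      rw [this]
      ring
    rw [norm_mul, hexp]
    calc _ ≤ 2 * |K| * |K'| * (E * E)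
          * (Real.exp (-((1 - b) * t)) * Real.exp (-(1 / 2) * Real.exp t)) := by gcongr
      _ = 2 * |K| * |K'| * ((E * E * Real.exp (-((1 - b) * t)))
          * Real.exp (-(1 / 2) * Real.exp t)) := by ring
      _ = _ := by
        have : E * E * Real.exp (-((1 - b) * t)) = (Real.exp t) ^ q := by
          rw [← Real.exp_mul, hE, ← Real.exp_add, ← Real.exp_add, hq]
          ring_nf
        rw [this]

/-- At a point common to both half strips `U` and the side solution are each proportional to the
central recessive solution, which is nonzero there. So their Wronskian vanishes at that point, and
by Abel's identity on the whole side strip. -/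
lemma exists_recessive_side (a b : ℝ) {θ : ℝ} (hθ : |θ| = 2 * Real.pi / 3) :
    ∃ (X K κ : ℝ) (R R' : ℂ → ℂ), 0 < κ ∧ ∀ L ∈ halfStrip θ X,
      ‖R' L‖ ≤ K * Real.exp (-a * L.re) ∧ κ * Real.exp (-a * L.re) ≤ ‖R L‖ ∧
      tricomiSurf a b L * R' L - tricomiSurfDeriv a b L * R L = 0 := by
  have hpi := Real.pi_pos
  have hcos : Real.cos θ = -1 / 2 := by
    rw [← Real.cos_abs, hθ, show 2 * Real.pi / 3 = Real.pi - Real.pi / 3 by ring, Real.cos_pi_sub,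
      Real.cos_pi_div_three]
    norm_num
  obtain ⟨X, R, R', hode, -, hbd⟩ := hasRecessiveFamily a hcos.ge
  obtain ⟨Y, K, κ, hκ, hb⟩ := hbd b
  obtain ⟨X₀, K₀, κ₀, R₀, R₀', hκ₀, hode₀, hb₀⟩ := exists_recessive_zero a b
  set Z := max X Y with hZ
  refine ⟨Z, K, κ, R b, R' b, hκ, fun L hL => ?_⟩
  have hbZ : ∀ L ∈ halfStrip θ Z, _ := fun L hL =>
    hb L (halfStrip_anti θ (le_max_right X Y) hL)
  obtain ⟨-, h2, h3⟩ := hbZ L hL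
  refine ⟨h2, h3, ?_⟩
  have hodeZ := (hode b).mono (halfStrip_anti θ (le_max_left X Y))
  have habs : |θ / 2| = Real.pi / 3 := by rw [abs_div, hθ, abs_two]; ring
  set M : ℂ := ((max X₀ Z + 1 : ℝ) : ℂ) + ((-(θ / 2) : ℝ) : ℂ) * Complex.I with hM
  have hMre : M.re = max X₀ Z + 1 := by simp [hM]
  have hMim : M.im = -(θ / 2) := by simp [hM]
  have hM0 : M ∈ halfStrip 0 X₀ := by
    refine mem_halfStrip.2 ⟨?_, ?_⟩
    · rw [hMre]; exact (le_max_left _ _).trans_lt (lt_add_one _)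
    · rw [hMim, add_zero, abs_neg, habs]; linarith
  have hMθ : M ∈ halfStrip θ Z := by
    refine mem_halfStrip.2 ⟨?_, ?_⟩
    · rw [hMre]; exact (le_max_right _ _).trans_lt (lt_add_one _)
    · rw [hMim, show -(θ / 2) + θ = θ / 2 by ring, habs]; linarith
  have w1 := recessive_wronskian_eq_zero hθ hode₀ hodeZ
    (fun L hL => ⟨(hb₀ L hL).1, (hb₀ L hL).2.1⟩) (fun L hL => ⟨(hbZ L hL).1, (hbZ L hL).2.1⟩) hM0 hMθ
  obtain ⟨-, -, w2, w3⟩ := hb₀ M hM0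
  have hR0 : R₀ M ≠ 0 := by
    rw [← norm_pos_iff]
    exact lt_of_lt_of_le (mul_pos hκ₀ (Real.exp_pos _)) w2
  have w4 : tricomiSurf a b M * R' b M - tricomiSurfDeriv a b M * R b M = 0 := by
    refine mul_left_cancel₀ hR0 ?_
    linear_combination (tricomiSurf a b M) * w1 + (R b M) * w3
  have w5 := (solvesLogKummer_tricomiSurf a b (halfStrip θ Z)).wronskian_eq hodeZ
    (isOpen_halfStrip θ Z) (isPreconnected_halfStrip θ Z) hL hMθ
  rw [w4, zero_mul] at w5
  exact (mul_eq_zero.1 w5).resolve_right (Complex.exp_ne_zero _)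

lemma tricomiSurf_ne_zero_or {a b : ℂ} (ha : rGamma a ≠ 0) (hab : rGamma (a - b + 1) ≠ 0) (L : ℂ) :
    tricomiSurf a b L ≠ 0 ∨ tricomiSurfDeriv a b L ≠ 0 := by
  by_contra! h
  have := tricomiSurf_wronskian a b L
  rw [h.1, h.2, zero_mul, zero_mul, sub_zero] at this
  have hpi : (Real.pi : ℂ) ≠ 0 := by exact_mod_cast Real.pi_ne_zero
  refine absurd this.symm (mul_ne_zero (mul_ne_zero (mul_ne_zero (mul_ne_zero (mul_ne_zero
    (mul_ne_zero two_ne_zero hpi) Complex.I_ne_zero) ?_) ha) hab) ?_) <;>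
  exact Complex.exp_ne_zero _

/-- A vanishing Wronskian with `r ≠ 0` means `U'/U = r'/r`. A zero of `U` would be a common zero of
`U` and its derivative, which `tricomiSurf_ne_zero_or` excludes. -/
lemma norm_tricomiLogDeriv_le_of_wronskian {a b : ℝ} (ha : rGamma a ≠ 0)
    (hab : rGamma (a - b + 1) ≠ 0) {K κ : ℝ} (hκ : 0 < κ) {L r r' : ℂ}
    (h1 : ‖r'‖ ≤ K * Real.exp (-a * L.re)) (h2 : κ * Real.exp (-a * L.re) ≤ ‖r‖)
    (h3 : tricomiSurf a b L * r' - tricomiSurfDeriv a b L * r = 0) :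
    tricomiSurf a b L ≠ 0 ∧ ‖tricomiLogDeriv a b L‖ ≤ K / κ * Real.exp (-L.re) := by
  have hE := Real.exp_pos (-a * L.re)
  have hr : 0 < ‖r‖ := lt_of_lt_of_le (mul_pos hκ hE) h2
  have hr0 : r ≠ 0 := norm_pos_iff.1 hr
  have hne : tricomiSurf a b L ≠ 0 := by
    intro h
    rw [h, zero_mul, zero_sub, neg_eq_zero] at h3
    rcases tricomiSurf_ne_zero_or ha hab L with h4 | h4
    · exact h4 h
    · exact h4 ((mul_eq_zero.1 h3).resolve_right hr0)
  refine ⟨hne, ?_⟩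
  have h4 : tricomiLogDeriv a b L = r' / r * Complex.exp (-L) := by
    have hE' := Complex.exp_ne_zero L
    rw [tricomiLogDeriv, Complex.exp_neg]
    field_simp
    linear_combination -h3
  rw [h4, norm_mul, Complex.norm_exp, Complex.neg_re, norm_div]
  refine mul_le_mul_of_nonneg_right ?_ (Real.exp_pos _).le
  rw [div_le_div_iff₀ hr hκ]
  have hK : 0 ≤ K := nonneg_of_mul_nonneg_left ((norm_nonneg _).trans h1) hE
  calc ‖r'‖ * κ ≤ K * Real.exp (-a * L.re) * κ := by gcongr
    _ = K * (κ * Real.exp (-a * L.re)) := by ring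
    _ ≤ K * ‖r‖ := by gcongr

/-- The logarithmic derivative decays like `1 / z`, uniformly for `|arg z| < 13π/12`. -/
lemma exists_norm_tricomiLogDeriv_le {a b : ℝ} (ha : rGamma a ≠ 0)
    (hab : rGamma (a - b + 1) ≠ 0) : ∃ X K : ℝ, ∀ L : ℂ, X < L.re → |L.im| < 13 * Real.pi / 12 →
      tricomiSurf a b L ≠ 0 ∧ ‖tricomiLogDeriv a b L‖ ≤ K * Real.exp (-L.re) := by
  have hpi := Real.pi_pos
  obtain ⟨X₀, K₀, κ₀, R₀, R₀', hκ₀, -, hb₀⟩ := exists_recessive_zero a b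
  -- The angle `-2π/3` covers `π/4 < Im L < 13π/12`, the angle `2π/3` its mirror image, and both
  -- overlap the central strip `|Im L| < 5π/12`.
  obtain ⟨X₁, K₁, κ₁, R₁, R₁', hκ₁, hb₁⟩ := exists_recessive_side a b
    (θ := -(2 * Real.pi / 3)) (by rw [abs_neg, abs_of_pos (by positivity)])
  obtain ⟨X₂, K₂, κ₂, R₂, R₂', hκ₂, hb₂⟩ := exists_recessive_side a b
    (θ := 2 * Real.pi / 3) (by rw [abs_of_pos (by positivity)])
  refine ⟨max X₀ (max X₁ X₂), max (K₀ / κ₀) (max (K₁ / κ₁) (K₂ / κ₂)), fun L hL him => ?_⟩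
  simp only [max_lt_iff] at hL
  obtain ⟨hL0, hL1, hL2⟩ := hL
  obtain ⟨i1, i2⟩ := abs_lt.1 him
  have up : ∀ {k : ℝ}, k ≤ max (K₀ / κ₀) (max (K₁ / κ₁) (K₂ / κ₂)) →
      (tricomiSurf a b L ≠ 0 ∧ ‖tricomiLogDeriv a b L‖ ≤ k * Real.exp (-L.re)) →
      tricomiSurf a b L ≠ 0 ∧ ‖tricomiLogDeriv a b L‖
        ≤ max (K₀ / κ₀) (max (K₁ / κ₁) (K₂ / κ₂)) * Real.exp (-L.re) := fun hk h =>
    ⟨h.1, h.2.trans (mul_le_mul_of_nonneg_right hk (Real.exp_pos _).le)⟩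
  by_cases h0 : |L.im| < 5 * Real.pi / 12
  · obtain ⟨-, w1, w2, w3⟩ := hb₀ L (mem_halfStrip.2 ⟨hL0, by rwa [add_zero]⟩)
    exact up (le_max_left _ _) (norm_tricomiLogDeriv_le_of_wronskian ha hab hκ₀ w1 w2 w3)
  · rcases le_total 0 L.im with hs | hs
    · rw [abs_of_nonneg hs] at h0
      obtain ⟨w1, w2, w3⟩ := hb₁ L (mem_halfStrip.2 ⟨hL1, abs_lt.2 ⟨by linarith, by linarith⟩⟩)
      exact up ((le_max_left _ _).trans (le_max_right _ _))
        (norm_tricomiLogDeriv_le_of_wronskian ha hab hκ₁ w1 w2 w3)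
    · rw [abs_of_nonpos hs] at h0
      obtain ⟨w1, w2, w3⟩ := hb₂ L (mem_halfStrip.2 ⟨hL2, abs_lt.2 ⟨by linarith, by linarith⟩⟩)
      exact up ((le_max_right _ _).trans (le_max_right _ _))
        (norm_tricomiLogDeriv_le_of_wronskian ha hab hκ₂ w1 w2 w3)

/-! ### The asymptotic expansion from the Riccati equation -/

lemma Polynomial.exists_norm_eval_le {p : Polynomial ℂ} {m : ℕ} (h : Polynomial.X ^ m ∣ p) :
    ∃ K, 0 ≤ K ∧ ∀ q : ℂ, ‖q‖ ≤ 1 → ‖p.eval q‖ ≤ K * ‖q‖ ^ m := by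
  obtain ⟨r, rfl⟩ := h
  obtain ⟨K, hK⟩ := (isCompact_closedBall (0 : ℂ) 1).exists_bound_of_continuousOn
    r.continuous.continuousOn
  refine ⟨|K|, abs_nonneg K, fun q hq => ?_⟩
  rw [Polynomial.eval_mul, Polynomial.eval_pow, Polynomial.eval_X, norm_mul, norm_pow, mul_comm]
  gcongr
  exact (hK q (by simpa using hq)).trans (le_abs_self K)

/-- The coefficients of a formal solution in powers of `e^{-L}` of the Riccati equation
`y' = (e^L - b) y + a - e^L y²`. -/
structure IsRiccatiSeries (a b : ℂ) (c : ℕ → ℂ) : Prop where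
  zero : c 0 = 0
  one : c 1 = -a
  succ : ∀ n, c (n + 2) = (b - (n + 1)) * c (n + 1)
    + ∑ p ∈ Finset.HasAntidiagonal.antidiagonal (n + 2), c p.1 * c p.2

/-- The polynomial with the first `n + 1` coefficients of a sequence. -/
def initialPoly (c : ℕ → ℂ) (n : ℕ) : Polynomial ℂ :=
  ∑ j ∈ Finset.range (n + 1), Polynomial.C (c j) * Polynomial.X ^ j

lemma coeff_initialPoly (c : ℕ → ℂ) (n m : ℕ) :
    (initialPoly c n).coeff m = if m ≤ n then c m else 0 := by
  simp [initialPoly, Polynomial.coeff_X_pow]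

namespace IsRiccatiSeries

variable {a b : ℂ} {c : ℕ → ℂ}

lemma X_dvd_initialPoly (hc : IsRiccatiSeries a b c) (n : ℕ) :
    Polynomial.X ^ 1 ∣ initialPoly c n := by
  rw [Polynomial.X_pow_dvd_iff]
  intro d hd
  obtain rfl : d = 0 := by omega
  simp [coeff_initialPoly, hc.zero]

/-- With `q = e^{-L}` the Riccati equation reads `y = q y' + y² + b q y - a q`, and `d/dL` acts on
polynomials in `q` as `-q d/dq`. One substitution of the first `n` terms into the right side yields
one more correct coefficient. -/
lemma X_pow_dvd_residual (hc : IsRiccatiSeries a b c) (n : ℕ) :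
    Polynomial.X ^ (n + 2) ∣ -(Polynomial.X ^ 2 * (initialPoly c n).derivative)
      + initialPoly c n ^ 2 + Polynomial.C b * (Polynomial.X * initialPoly c n)
      - Polynomial.C a * Polynomial.X - initialPoly c (n + 1) := by
  rw [Polynomial.X_pow_dvd_iff]
  intro d hd
  have hsq : (initialPoly c n ^ 2).coeff d
      = ∑ p ∈ Finset.HasAntidiagonal.antidiagonal d, c p.1 * c p.2 := by
    rw [pow_two, Polynomial.coeff_mul]
    refine Finset.sum_congr rfl fun p hp => ?_
    rw [Finset.HasAntidiagonal.mem_antidiagonal] at hp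
    rw [coeff_initialPoly, coeff_initialPoly]
    by_cases h1 : p.1 ≤ n
    · by_cases h2 : p.2 ≤ n
      · rw [if_pos h1, if_pos h2]
      · obtain h3 : p.1 = 0 := by omega
        rw [h3, hc.zero]
        simp
    · obtain h3 : p.2 = 0 := by omega
      rw [h3, hc.zero]
      simp
  simp only [Polynomial.coeff_add, Polynomial.coeff_sub, Polynomial.coeff_neg,
    Polynomial.coeff_C_mul, hsq]
  rcases d with _ | _ | d
  · simp [coeff_initialPoly, hc.zero, pow_two, mul_assoc]
  · rw [pow_two, mul_assoc, Polynomial.coeff_X_mul, Polynomial.coeff_X_mul]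
    simp [coeff_initialPoly, hc.zero, hc.one, Finset.Nat.antidiagonal_succ]
  · rw [pow_two, mul_assoc, Polynomial.coeff_X_mul, Polynomial.coeff_X_mul,
      Polynomial.coeff_X_mul, Polynomial.coeff_derivative, coeff_initialPoly, coeff_initialPoly,
      if_pos (by omega), if_pos (by omega), hc.succ d, Polynomial.coeff_X, if_neg (by omega)]
    ring

/-- A solution of the Riccati equation that is `O(e^{-L})` in a half-strip has the formal solution
as its asymptotic expansion in every smaller half-strip. -/
lemma exists_norm_sub_le (hc : IsRiccatiSeries a b c) {y : ℂ → ℂ} {X₀ K₀ w₀ : ℝ}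
    (hy : ∀ L : ℂ, X₀ < L.re → |L.im| < w₀ →
      HasDerivAt y ((Complex.exp L - b) * y L + a - Complex.exp L * y L ^ 2) L)
    (hb : ∀ L : ℂ, X₀ < L.re → |L.im| < w₀ → ‖y L‖ ≤ K₀ * ‖Complex.exp (-L)‖) (n : ℕ) :
    ∀ w < w₀, ∃ X K : ℝ, ∀ L : ℂ, X < L.re → |L.im| ≤ w →
      ‖y L - (initialPoly c n).eval (Complex.exp (-L))‖ ≤ K * ‖Complex.exp (-L)‖ ^ (n + 1) := by
  induction n with
  | zero =>
    intro w hw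
    refine ⟨X₀, K₀, fun L h1 h2 => ?_⟩
    simpa [initialPoly, hc.zero] using hb L h1 (h2.trans_lt hw)
  | succ n ih =>
    intro w hw
    -- The derivative of the error is bounded by Cauchy's estimate on a disc of radius `r`, which
    -- costs some width of the strip. Hence the induction hypothesis is used at `w + r < w₀`.
    set r := min 1 ((w₀ - w) / 2) with hr
    have hr0 : 0 < r := lt_min one_pos (by linarith)
    have hr1 : r ≤ 1 := min_le_left _ _
    have hr2 : r ≤ (w₀ - w) / 2 := min_le_right _ _
    obtain ⟨X', K', hE⟩ := ih (w + r) (by linarith)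
    obtain ⟨A, hA0, hA⟩ := Polynomial.exists_norm_eval_le (hc.X_pow_dvd_residual n)
    obtain ⟨B, hB0, hB⟩ := Polynomial.exists_norm_eval_le (hc.X_dvd_initialPoly n)
    refine ⟨max (max X' X₀) 0 + 1, A + |K'| * Real.exp 1 ^ (n + 1) / r + |K'| * (|K₀| + B)
      + ‖b‖ * |K'|, fun L h1 h2 => ?_⟩
    have hX' : X' ≤ max (max X' X₀) 0 := (le_max_left _ _).trans (le_max_left _ _)
    have hX₀ : X₀ ≤ max (max X' X₀) 0 := (le_max_right _ _).trans (le_max_left _ _)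
    have h00 : 0 ≤ max (max X' X₀) 0 := le_max_right _ _
    have hEd : ∀ z ∈ Metric.closedBall L r, X' < z.re ∧ X₀ < z.re ∧ |z.im| ≤ w + r := by
      intro z hz
      rw [mem_closedBall_iff_norm] at hz
      have e1 := (Complex.abs_re_le_norm (z - L)).trans hz
      have e2 := (Complex.abs_im_le_norm (z - L)).trans hz
      rw [Complex.sub_re, abs_le] at e1
      rw [Complex.sub_im, abs_le] at e2
      rw [abs_le] at h2 ⊢
      exact ⟨by linarith [e1.1], by linarith [e1.1], by linarith [e2.1, h2.1],
        by linarith [e2.2, h2.2]⟩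
    set E : ℂ → ℂ := fun z => y z - (initialPoly c n).eval (Complex.exp (-z)) with hEdef
    set q := Complex.exp (-L) with hq
    have hq0 : q ≠ 0 := Complex.exp_ne_zero _
    have hq1 : ‖q‖ ≤ 1 := by
      rw [hq, Complex.norm_exp, Real.exp_le_one_iff, Complex.neg_re]
      linarith
    have hqL : q * Complex.exp L = 1 := by rw [hq, ← Complex.exp_add]; simp
    have hder : ∀ z ∈ Metric.closedBall L r, HasDerivAt E
        ((Complex.exp z - b) * y z + a - Complex.exp z * y z ^ 2
          - (initialPoly c n).derivative.eval (Complex.exp (-z)) * (Complex.exp (-z) * -1)) z := by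
      intro z hz
      obtain ⟨_, e2, e3⟩ := hEd z hz
      exact (hy z e2 (by linarith)).sub (((initialPoly c n).hasDerivAt _).comp z
        ((hasDerivAt_neg z).cexp))
    -- The factor `exp 1` compares `|e^{-z}|` with `|e^{-L}|` on the disc, as `r ≤ 1`.
    have hDE : ‖deriv E L‖ ≤ |K'| * (Real.exp 1 * ‖q‖) ^ (n + 1) / r := by
      refine Complex.norm_deriv_le_of_forall_mem_sphere_norm_le hr0
        (DifferentiableOn.diffContOnCl_ball (U := Metric.closedBall L r)
          (fun z hz => (hder z hz).differentiableAt.differentiableWithinAt) subset_rfl) ?_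
      intro z hz
      have hz' := Metric.sphere_subset_closedBall hz
      obtain ⟨e1, _, e3⟩ := hEd z hz'
      refine (hE z e1 e3).trans ((mul_le_mul_of_nonneg_right (le_abs_self K')
        (by positivity)).trans ?_)
      gcongr
      rw [hq, Complex.norm_exp, Complex.norm_exp, ← Real.exp_add, Real.exp_le_exp,
        Complex.neg_re, Complex.neg_re]
      have e1 := (Complex.abs_re_le_norm (z - L)).trans (mem_closedBall_iff_norm.1 hz')
      rw [Complex.sub_re, abs_le] at e1
      linarith [e1.1]
    have hL := Metric.mem_closedBall_self (x := L) hr0.le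
    obtain ⟨g1, g2, g3⟩ := hEd L hL
    have hEL : ‖E L‖ ≤ |K'| * ‖q‖ ^ (n + 1) :=
      (hE L g1 g3).trans (mul_le_mul_of_nonneg_right (le_abs_self K') (by positivity))
    have hyL : ‖y L‖ ≤ |K₀| * ‖q‖ :=
      (hb L g2 (by linarith)).trans (mul_le_mul_of_nonneg_right (le_abs_self K₀) (norm_nonneg _))
    have hPL : ‖(initialPoly c n).eval q‖ ≤ B * ‖q‖ := by simpa using hB q hq1
    have hQ := hA q hq1
    -- Subtracting the fixed-point form for the polynomial from that for `y` leaves the residual and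
    -- terms in `E`, each carrying an additional factor of size `O(q)`.
    have hid : y L - (initialPoly c (n + 1)).eval q
        = (-(Polynomial.X ^ 2 * (initialPoly c n).derivative)
      + initialPoly c n ^ 2 + Polynomial.C b * (Polynomial.X * initialPoly c n)
      - Polynomial.C a * Polynomial.X - initialPoly c (n + 1)).eval q
        + q * deriv E L + E L * (y L + (initialPoly c n).eval q) + b * (q * E L) := by
      rw [(hder L hL).deriv]
      simp only [Polynomial.eval_add, Polynomial.eval_sub, Polynomial.eval_neg, Polynomial.eval_mul,
        Polynomial.eval_pow, Polynomial.eval_X, Polynomial.eval_C, hEdef, ← hq]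
      linear_combination (-y L + y L ^ 2) * hqL
    rw [hid]
    have n1 : ‖q * deriv E L‖ ≤ |K'| * Real.exp 1 ^ (n + 1) / r * ‖q‖ ^ (n + 2) := by
      rw [norm_mul]
      calc _ ≤ ‖q‖ * (|K'| * (Real.exp 1 * ‖q‖) ^ (n + 1) / r) := by gcongr
        _ = _ := by rw [mul_pow]; ring
    have n2 : ‖E L * (y L + (initialPoly c n).eval q)‖ ≤ |K'| * (|K₀| + B) * ‖q‖ ^ (n + 2) := by
      rw [norm_mul]
      calc _ ≤ (|K'| * ‖q‖ ^ (n + 1)) * (|K₀| * ‖q‖ + B * ‖q‖) := by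
            gcongr
            exact (norm_add_le _ _).trans (add_le_add hyL hPL)
        _ = _ := by ring
    have n3 : ‖b * (q * E L)‖ ≤ ‖b‖ * |K'| * ‖q‖ ^ (n + 2) := by
      rw [norm_mul, norm_mul]
      calc _ ≤ ‖b‖ * (‖q‖ * (|K'| * ‖q‖ ^ (n + 1))) := by gcongr
        _ = _ := by ring
    refine (norm_add_le_of_le (norm_add_le_of_le (norm_add_le_of_le hQ n1) n2) n3).trans
      (le_of_eq ?_)
    ring

end IsRiccatiSeries

/-! ### The regular case -/

lemma hasDerivAt_tricomiLogDeriv (a b : ℂ) {L : ℂ} (h : tricomiSurf a b L ≠ 0) :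
    HasDerivAt (tricomiLogDeriv a b) ((Complex.exp L - b) * tricomiLogDeriv a b L + a
      - Complex.exp L * tricomiLogDeriv a b L ^ 2) L := by
  have he := Complex.exp_ne_zero L
  refine ((hasDerivAt_tricomiSurfDeriv a b L).div ((hasDerivAt_tricomiSurf a b L).mul
    (Complex.hasDerivAt_exp L)) (mul_ne_zero h he)).congr_deriv ?_
  simp only [tricomiLogDeriv, Pi.mul_apply]
  field_simp
  ring

/-- The recurrence is rescaled using `k α₁ = 1`, `α₂ = -(b + 1) α₁` and `α₃ = a α₁`. The coefficient
of index `0` is set to zero by hand because `u 0` is arbitrary; this also removes the two ends of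
the antidiagonal sum. -/
lemma isRiccatiSeries_of_isSelfConvolutive {α₁ α₂ α₃ k a b : ℝ} (hα₁ : 0 < α₁)
    (hk : k = 1 / α₁) (ha : a = α₃ / α₁) (hb : b = -1 - α₂ / α₁) {u : ℕ → ℝ}
    (hu : IsSelfConvolutive α₁ α₂ α₃ u) :
    IsRiccatiSeries (a : ℂ) b
      (fun n => if n = 0 then 0 else (((-1) ^ n * a * k ^ (n - 1) * u n : ℝ) : ℂ)) where
  zero := by simp
  one := by simp [hu.1]
  succ n := by
    have h1 : ∑ p ∈ Finset.HasAntidiagonal.antidiagonal (n + 2),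
        (fun n => if n = 0 then (0 : ℂ) else (((-1) ^ n * a * k ^ (n - 1) * u n : ℝ) : ℂ)) p.1
        * (fun n => if n = 0 then (0 : ℂ) else (((-1) ^ n * a * k ^ (n - 1) * u n : ℝ) : ℂ)) p.2
        = (((-1) ^ n * a ^ 2 * k ^ n
          * ∑ j ∈ Finset.Icc 1 (n + 1), u j * u (n + 2 - j) : ℝ) : ℂ) := by
      rw [Finset.Nat.sum_antidiagonal_eq_sum_range_succ_mk, Finset.mul_sum, Complex.ofReal_sum]
      symm
      refine Finset.sum_subset_zero_on_sdiff (fun j hj => ?_) (fun j hj => ?_) (fun j hj => ?_)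
      · rw [Finset.mem_Icc] at hj
        rw [Finset.mem_range]
        omega
      · rw [Finset.mem_sdiff, Finset.mem_range, Finset.mem_Icc] at hj
        rcases (by omega : j = 0 ∨ n + 2 - j = 0) with h | h
        · simp [h]
        · simp [h]
      · rw [Finset.mem_Icc] at hj
        obtain ⟨i, rfl⟩ : ∃ i, j = i + 1 := ⟨j - 1, by omega⟩
        obtain ⟨m, rfl⟩ : ∃ m, n = i + m := ⟨n - i, by omega⟩
        have e : i + m + 2 - (i + 1) = m + 1 := by omega
        simp only [e, Nat.add_eq_zero_iff, one_ne_zero, and_false, if_false, Nat.add_sub_cancel]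
        push_cast
        ring
    simp only [h1]
    rw [if_neg (by omega), if_neg (by omega), show n + 2 - 1 = n + 1 by omega,
      show n + 1 - 1 = n by omega, hu.2 (n + 2) (by omega), show n + 2 - 1 = n + 1 by omega]
    have e1 : k * α₁ = 1 := by rw [hk]; field_simp
    have e2 : α₂ = -(b + 1) * α₁ := by rw [hb]; field_simp; ring
    have e3 : α₃ = a * α₁ := by rw [ha]; field_simp
    rw [e2, e3]
    have e1' : (k : ℂ) * α₁ = 1 := by exact_mod_cast e1
    push_cast
    generalize (∑ j ∈ Finset.Icc 1 (n + 1), (u j : ℂ) * (u (n + 2 - j) : ℂ)) = s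
    linear_combination ((-1) ^ n * a * k ^ n * ((n + 2 - (b + 1)) * u (n + 1) + a * s)) * e1'

/-- A common zero of `U_R` and `U_I` makes `U` vanish on both sides of the cut at `x`, hence the
Wronskian vanish, which is a nonzero multiple of `1 / (Γ(a) Γ(a-b+1))`. -/
lemma tricomiRe_sq_add_tricomiIm_sq_pos {a b x : ℝ} (ha : Real.Gamma a ≠ 0)
    (hab : Real.Gamma (a - b + 1) ≠ 0) (hx : 0 < x) :
    0 < tricomiRe a b x ^ 2 + tricomiIm a b x ^ 2 := by
  refine lt_of_le_of_ne (by positivity) fun h => ?_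
  obtain ⟨h1, h2⟩ := (add_eq_zero_iff_of_nonneg (sq_nonneg _) (sq_nonneg _)).1 h.symm
  rw [sq_eq_zero_iff] at h1 h2
  have h3 := tricomiSurf_wronskian_cut a b hx
  rw [tricomiSurf_upper a b hx, tricomiSurf_lower a b hx, h1, h2] at h3
  have h4 : x ^ (1 - b) * Real.exp (-x) * (Real.Gamma a)⁻¹ * (Real.Gamma (a - b + 1))⁻¹ ≠ 0 := by
    have := (Real.rpow_pos_of_pos hx (1 - b)).ne'
    positivity
  have h5 : -(2 * Real.pi * Complex.I) * ((x ^ (1 - b) * Real.exp (-x) * (Real.Gamma a)⁻¹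
      * (Real.Gamma (a - b + 1))⁻¹ : ℝ) : ℂ) ≠ 0 :=
    mul_ne_zero (neg_ne_zero.2 Complex.two_pi_I_ne_zero) (by exact_mod_cast h4)
  exact h5 (by rw [← h3]; simp)

lemma Gamma_mul_muDensity_pos {k a b x : ℝ} (hk : 0 < k) (ha : Real.Gamma (a + 1) ≠ 0)
    (hab : Real.Gamma (a - b + 1) ≠ 0) (hx : 0 < x)
    (h : 0 < tricomiRe a b (k * x) ^ 2 + tricomiIm a b (k * x) ^ 2) :
    0 < Real.Gamma (a + 1) * Real.Gamma (a - b + 1) * muDensity k a b x := by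
  have e : Real.Gamma (a + 1) * Real.Gamma (a - b + 1) * muDensity k a b x
      = k * (k * x) ^ (-b) * Real.exp (-(k * x))
        / (tricomiRe a b (k * x) ^ 2 + tricomiIm a b (k * x) ^ 2) := by
    rw [muDensity]
    field_simp
  rw [e]
  have := Real.rpow_pos_of_pos (mul_pos hk hx) (-b)
  positivity

/-! ### Regularity of `F` transported to the strip -/

lemma log_exp_of_abs_im_lt {L : ℂ} (hL : |L.im| < Real.pi) : Complex.log (Complex.exp L) = L :=
  Complex.log_exp (abs_lt.1 hL).1 (abs_lt.1 hL).2.le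

lemma exp_div_mem_slitPlane {k : ℝ} (hk : 0 < k) {L : ℂ} (hL : |L.im| < Real.pi) :
    Complex.exp L / k ∈ Complex.slitPlane := by
  have h : Complex.exp L ∈ Complex.slitPlane := by
    rw [Complex.mem_slitPlane_iff_arg, ← Complex.log_im, log_exp_of_abs_im_lt hL]
    exact ⟨(abs_lt.1 hL).2.ne, Complex.exp_ne_zero L⟩
  rw [Complex.mem_slitPlane_iff] at h ⊢
  rw [Complex.div_ofReal_re, Complex.div_ofReal_im]
  exact h.imp (fun h => div_pos h hk) fun h => div_ne_zero h hk.ne'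

lemma tricomiLogDeriv_eq_genF {k a : ℝ} (b : ℝ) (hk : 0 < k) (ha : a ≠ 0) {L : ℂ}
    (hL : |L.im| < Real.pi) : tricomiLogDeriv a b L
      = ((a / k : ℝ) : ℂ) * (genF k a b (Complex.exp L / k) + ((k / b : ℝ) : ℂ)) := by
  have hk' : (k : ℂ) ≠ 0 := by exact_mod_cast hk.ne'
  have ha' : (a : ℂ) ≠ 0 := by exact_mod_cast ha
  rw [genF_eq a b hk (exp_div_mem_slitPlane hk hL), mul_div_cancel₀ _ hk', log_exp_of_abs_im_lt hL]
  push_cast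
  field_simp
  ring

namespace IsRegularCase

variable {k a b : ℝ}

/-- At a zero `L` of `U` the derivative of `U` is nonzero, so the zero is isolated. Nearby, that
derivative equals `exp(L) U` times an affine function of `F`, and this product tends to `0` because
`F` is continuous: a contradiction. Only punctured neighbourhoods are used, so the default value of
the quotient at the zero is harmless. -/
lemma tricomiSurf_ne_zero (hr : IsRegularCase k a b) (hk : 0 < k) (ha : a ≠ 0)
    (hΓ : rGamma a ≠ 0) (hΓ' : rGamma (a - b + 1) ≠ 0) {L : ℂ} (hL : |L.im| < Real.pi) :
    tricomiSurf a b L ≠ 0 := by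
  intro h0
  have h1 := (tricomiSurf_ne_zero_or hΓ hΓ' L).resolve_left (not_not.2 h0)
  have hk' : (k : ℂ) ≠ 0 := by exact_mod_cast hk.ne'
  have hcont : ContinuousAt (fun z => ((a / k : ℝ) : ℂ)
      * (genF k a b (Complex.exp z / k) + ((k / b : ℝ) : ℂ))
      * (tricomiSurf a b z * Complex.exp z)) L := by
    have hg : ContinuousAt (genF k a b) (Complex.exp L / k) :=
      (hr.1.differentiableAt (Complex.isOpen_slitPlane.mem_nhds
        (exp_div_mem_slitPlane hk hL))).continuousAt
    have he : ContinuousAt (fun z : ℂ => Complex.exp z / k) L := by fun_prop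
    have hs := (differentiable_tricomiSurf a b).continuous.continuousAt (x := L)
    have hc : ContinuousAt (fun z => genF k a b (Complex.exp z / k)) L :=
      ContinuousAt.comp (f := fun z : ℂ => Complex.exp z / k) (g := genF k a b) hg he
    exact (continuousAt_const.mul (hc.add continuousAt_const)).mul
      (hs.mul Complex.continuous_exp.continuousAt)
  have t1 := hcont.tendsto.mono_left (nhdsWithin_le_nhds (s := {L}ᶜ))
  rw [h0, zero_mul, mul_zero] at t1
  have t2 := ((differentiable_tricomiSurfDeriv a b).continuous.tendsto L).mono_left
    (nhdsWithin_le_nhds (s := {L}ᶜ))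
  refine h1 (tendsto_nhds_unique t2 (t1.congr' ?_))
  have hopen : IsOpen {z : ℂ | |z.im| < Real.pi} :=
    isOpen_lt (Complex.continuous_im.abs) continuous_const
  filter_upwards [(hasDerivAt_tricomiSurf a b L).eventually_ne h1 (c := 0),
    nhdsWithin_le_nhds (hopen.mem_nhds hL)] with z hz hz'
  rw [← tricomiLogDeriv_eq_genF b hk ha hz', tricomiLogDeriv,
    div_mul_cancel₀ _ (mul_ne_zero hz (Complex.exp_ne_zero z))]

/-- Near the origin of the cut plane `z U' / U` tends to `0`. -/
lemma tendsto_exp_mul_tricomiLogDeriv (hr : IsRegularCase k a b) (hk : 0 < k) (ha : a ≠ 0)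
    {ε : ℝ} (hε : 0 < ε) : ∃ X : ℝ, ∀ L : ℂ, L.re < X → |L.im| < Real.pi →
      ‖Complex.exp L * tricomiLogDeriv a b L‖ ≤ ε := by
  have hk' : (k : ℂ) ≠ 0 := by exact_mod_cast hk.ne'
  have t : Tendsto (fun z : ℂ => (a : ℂ) * (z * genF k a b z + z * ((k / b : ℝ) : ℂ)))
      (𝓝[Complex.slitPlane] 0) (𝓝 0) := by
    have h1 : Tendsto (fun z : ℂ => z * ((k / b : ℝ) : ℂ)) (𝓝[Complex.slitPlane] 0) (𝓝 0) :=
      ((continuous_mul_const _).tendsto' 0 0 (by simp)).mono_left nhdsWithin_le_nhds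
    simpa using (hr.2.add h1).const_mul (a : ℂ)
  have h := t.eventually (Metric.closedBall_mem_nhds 0 hε)
  obtain ⟨δ, hδ, h⟩ := Metric.mem_nhdsWithin_iff.1 h
  refine ⟨Real.log (k * δ), fun L h1 h2 => ?_⟩
  have hmem : Complex.exp L / k ∈ Metric.ball 0 δ ∩ Complex.slitPlane := by
    refine ⟨?_, exp_div_mem_slitPlane hk h2⟩
    rw [mem_ball_zero_iff, norm_div, Complex.norm_exp, Complex.norm_real,
      Real.norm_of_nonneg hk.le, div_lt_iff₀ hk, mul_comm]
    exact (Real.lt_log_iff_exp_lt (mul_pos hk hδ)).1 h1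
  have h3 : dist ((a : ℂ) * (Complex.exp L / k * genF k a b (Complex.exp L / k)
    + Complex.exp L / k * ((k / b : ℝ) : ℂ))) 0 ≤ ε := h hmem
  rw [dist_zero_right] at h3
  refine le_of_eq_of_le (congrArg norm ?_) h3
  rw [tricomiLogDeriv_eq_genF b hk ha h2]
  push_cast
  ring

end IsRegularCase

/-! ### Moments by contour integration -/

/-- Cauchy's theorem for long rectangles in the strip `|Im L| ≤ π`. -/
lemma tendsto_integral_jump_of_tendsto {g : ℂ → ℂ} {A : ℂ}
    (hg : ∀ L : ℂ, |L.im| ≤ Real.pi → DifferentiableAt ℂ g L)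
    (hright : Tendsto (fun T : ℝ => ∫ φ in -Real.pi..Real.pi, g (T + φ * Complex.I)) atTop (𝓝 A))
    (hleft : Tendsto (fun T : ℝ => ∫ φ in -Real.pi..Real.pi, g ((-T : ℝ) + φ * Complex.I))
      atTop (𝓝 0)) :
    Tendsto (fun T : ℝ => ∫ s in -T..T,
      (g (s + Real.pi * Complex.I) - g (s - Real.pi * Complex.I))) atTop (𝓝 (Complex.I * A)) := by
  have hcont : ∀ t : ℝ, |t| ≤ Real.pi → Continuous fun s : ℝ => g (s + t * Complex.I) := by
    intro t ht
    refine continuous_iff_continuousAt.2 fun s => ?_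
    have h1 : ContinuousAt g (s + t * Complex.I) := (hg _ (by simpa using ht)).continuousAt
    exact ContinuousAt.comp (f := fun s : ℝ => (s : ℂ) + t * Complex.I) h1 (by fun_prop)
  have hπ : |Real.pi| ≤ Real.pi := (abs_of_pos Real.pi_pos).le
  have key : ∀ T : ℝ, ∫ s in -T..T, (g (s + Real.pi * Complex.I) - g (s - Real.pi * Complex.I))
      = Complex.I * ((∫ φ in -Real.pi..Real.pi, g (T + φ * Complex.I))
        - ∫ φ in -Real.pi..Real.pi, g ((-T : ℝ) + φ * Complex.I)) := by
    intro T
    have h := Complex.integral_boundary_rect_eq_zero_of_differentiableOn g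
      ⟨-T, -Real.pi⟩ ⟨T, Real.pi⟩ (fun L hL => (hg L (by
        rw [Complex.mem_reProdIm] at hL
        have h2 := hL.2
        rw [uIcc_of_le (by linarith [Real.pi_pos])] at h2
        exact abs_le.2 h2)).differentiableWithinAt)
    have h2 := hcont (-Real.pi) (by rwa [abs_neg])
    have e : (fun s : ℝ => g (s - Real.pi * Complex.I))
        = fun s : ℝ => g (s + (-Real.pi : ℝ) * Complex.I) := by
      funext s
      congr 1
      push_cast
      ring
    rw [intervalIntegral.integral_sub ((hcont Real.pi hπ).intervalIntegrable _ _)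
      (e ▸ h2.intervalIntegrable _ _), e]
    simp only [smul_eq_mul] at h
    linear_combination -h
  simp only [key]
  simpa using (hright.sub hleft).const_mul Complex.I

lemma integral_exp_nat_mul_strip (m : ℕ) (T : ℝ) :
    ∫ φ in -Real.pi..Real.pi, Complex.exp (m * (T + φ * Complex.I))
      = if m = 0 then 2 * (Real.pi : ℂ) else 0 := by
  split_ifs with hm
  · subst hm
    simp
    ring
  · have h : ∀ φ : ℝ, Complex.exp (m * (T + φ * Complex.I))
        = Complex.exp (m * T) * Complex.exp (m * Complex.I * φ) := by
      intro φ
      rw [← Complex.exp_add]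
      ring_nf
    have hm' : (m : ℂ) * Complex.I ≠ 0 :=
      mul_ne_zero (Nat.cast_ne_zero.2 hm) Complex.I_ne_zero
    simp only [h]
    rw [intervalIntegral.integral_const_mul, integral_exp_mul_complex hm',
      show (m : ℂ) * Complex.I * ((-Real.pi : ℝ) : ℂ)
        = m * Complex.I * Real.pi - m * (2 * Real.pi * Complex.I) by push_cast; ring,
      Complex.exp_sub, Complex.exp_nat_mul_two_pi_mul_I, div_one, sub_self, zero_div, mul_zero]

/-- The coefficients of an asymptotic expansion in powers of `e^{-L}` as limits of means over
vertical segments. -/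
lemma tendsto_integral_exp_mul {y : ℂ → ℂ} {c : ℕ → ℂ} {n : ℕ} {X K : ℝ}
    (hy : ∀ L : ℂ, |L.im| ≤ Real.pi → ContinuousAt y L)
    (h : ∀ L : ℂ, X < L.re → |L.im| ≤ Real.pi →
      ‖y L - (initialPoly c n).eval (Complex.exp (-L))‖ ≤ K * ‖Complex.exp (-L)‖ ^ (n + 1)) :
    Tendsto (fun T : ℝ => ∫ φ in -Real.pi..Real.pi,
      Complex.exp (n * (T + φ * Complex.I)) * y (T + φ * Complex.I)) atTop
      (𝓝 (2 * Real.pi * c n)) := by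
  have hpi := Real.pi_pos
  have hP : ∀ L : ℂ, Complex.exp (n * L) * (initialPoly c n).eval (Complex.exp (-L))
      = ∑ j ∈ Finset.range (n + 1), c j * Complex.exp ((n - j : ℕ) * L) := by
    intro L
    rw [initialPoly, Polynomial.eval_finsetSum, Finset.mul_sum]
    refine Finset.sum_congr rfl fun j hj => ?_
    have hj' : j ≤ n := Nat.lt_succ_iff.1 (Finset.mem_range.1 hj)
    rw [Polynomial.eval_mul, Polynomial.eval_C, Polynomial.eval_pow, Polynomial.eval_X,
      ← Complex.exp_nat_mul, mul_left_comm, ← Complex.exp_add, Nat.cast_sub hj']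
    ring_nf
  have hint : ∀ T : ℝ, ∫ φ in -Real.pi..Real.pi, Complex.exp (n * (T + φ * Complex.I))
      * (initialPoly c n).eval (Complex.exp (-(T + φ * Complex.I))) = 2 * Real.pi * c n := by
    intro T
    simp only [hP]
    rw [intervalIntegral.integral_finsetSum fun j _ =>
      Continuous.intervalIntegrable (by fun_prop) _ _]
    simp only [intervalIntegral.integral_const_mul, integral_exp_nat_mul_strip]
    rw [Finset.sum_eq_single n]
    · simp [mul_comm]
    · intro j hj hjn
      rw [Finset.mem_range] at hj
      rw [if_neg (by omega), mul_zero]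
    · simp
  rw [tendsto_iff_norm_sub_tendsto_zero]
  have t0 : Tendsto (fun T : ℝ => |K| * Real.exp (-T) * |Real.pi - -Real.pi|) atTop (𝓝 0) := by
    have := (Real.tendsto_exp_neg_atTop_nhds_zero.const_mul |K|).mul_const |Real.pi - -Real.pi|
    simpa only [mul_zero, zero_mul] using this
  refine squeeze_zero' (Eventually.of_forall fun _ => norm_nonneg _) ?_ t0
  filter_upwards [eventually_gt_atTop X] with T hT
  have i1 : IntervalIntegrable (fun φ : ℝ => Complex.exp (n * (T + φ * Complex.I))
      * y (T + φ * Complex.I)) volume (-Real.pi) Real.pi := by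
    refine ContinuousOn.intervalIntegrable fun φ hφ => ContinuousAt.continuousWithinAt ?_
    rw [uIcc_of_le (by linarith)] at hφ
    have h1 : ContinuousAt y (T + φ * Complex.I) := hy _ (by simpa using abs_le.2 hφ)
    exact ContinuousAt.mul (by fun_prop)
      (ContinuousAt.comp (f := fun φ : ℝ => (T : ℂ) + φ * Complex.I) h1 (by fun_prop))
  have i2 : IntervalIntegrable (fun φ : ℝ => Complex.exp (n * (T + φ * Complex.I))
      * (initialPoly c n).eval (Complex.exp (-(T + φ * Complex.I)))) volume
      (-Real.pi) Real.pi := by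
    refine Continuous.intervalIntegrable (Continuous.mul (by fun_prop) ?_) _ _
    exact (initialPoly c n).continuous.comp
      (f := fun φ : ℝ => Complex.exp (-(T + φ * Complex.I))) (by fun_prop)
  rw [← hint T, ← intervalIntegral.integral_sub i1 i2]
  refine intervalIntegral.norm_integral_le_of_norm_le_const fun φ hφ => ?_
  rw [uIoc_of_le (by linarith)] at hφ
  have h2 := h (T + φ * Complex.I) (by simpa using hT)
    (by simpa using abs_le.2 ⟨hφ.1.le, hφ.2⟩)
  rw [← mul_sub, norm_mul]
  have h3 := h2.trans (mul_le_mul_of_nonneg_right (le_abs_self K) (by positivity))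
  refine (mul_le_mul_of_nonneg_left h3 (norm_nonneg _)).trans (le_of_eq ?_)
  rw [Complex.norm_exp, Complex.norm_exp, ← Real.exp_nat_mul, mul_left_comm, ← Real.exp_add]
  refine congrArg (|K| * ·) (congrArg Real.exp ?_)
  simp
  ring

/-- A nonnegative continuous function on `(0, ∞)`, integrated over logarithmically symmetric
intervals. -/
lemma integrableOn_and_integral_eq_of_tendsto_exp {f : ℝ → ℝ} {k σ A : ℝ} (hk : 0 < k)
    (hcont : Continuous fun s => Real.exp s / k * f (Real.exp s / k)) (hσ : |σ| = 1)
    (hpos : ∀ x, 0 < x → 0 ≤ σ * f x)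
    (h : Tendsto (fun T : ℝ => ∫ s in -T..T, Real.exp s / k * f (Real.exp s / k)) atTop (𝓝 A)) :
    IntegrableOn f (Ioi 0) ∧ A = ∫ x in Ioi (0 : ℝ), f x := by
  have hnorm : ∀ s : ℝ, ‖Real.exp s / k * f (Real.exp s / k)‖
      = σ * (Real.exp s / k * f (Real.exp s / k)) := by
    intro s
    have h0 : 0 < Real.exp s / k := div_pos (Real.exp_pos s) hk
    rw [mul_left_comm, norm_mul, Real.norm_of_nonneg h0.le, Real.norm_eq_abs,
      ← abs_of_nonneg (hpos _ h0), abs_mul, hσ, one_mul]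
  -- The constant sign turns convergence over the intervals `[-T, T]` into convergence of the
  -- integrals of the norm.
  have hI : Integrable fun s => Real.exp s / k * f (Real.exp s / k) := by
    refine integrable_of_intervalIntegral_norm_tendsto (σ * A)
      (fun T : ℝ => (hcont.integrableOn_Icc).mono_set Ioc_subset_Icc_self)
      tendsto_neg_atTop_atBot tendsto_id ?_
    simp only [hnorm, intervalIntegral.integral_const_mul]
    exact h.const_mul σ
  have hA := tendsto_nhds_unique h
    (intervalIntegral_tendsto_integral hI tendsto_neg_atTop_atBot tendsto_id)
  have himage : (fun s => Real.exp s / k) '' univ = Ioi 0 := by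
    rw [image_univ]
    ext x
    constructor
    · rintro ⟨s, rfl⟩
      exact div_pos (Real.exp_pos s) hk
    · intro hx
      refine ⟨Real.log (k * x), ?_⟩
      simp only [Real.exp_log (mul_pos hk hx), mul_div_cancel_left₀ _ hk.ne']
  have hinj : InjOn (fun s => Real.exp s / k) univ := fun s _ t _ hst =>
    Real.exp_injective ((div_left_inj' hk.ne').1 hst)
  have hd : ∀ s ∈ (univ : Set ℝ),
      HasDerivWithinAt (fun s => Real.exp s / k) (Real.exp s / k) univ s :=
    fun s _ => ((Real.hasDerivAt_exp s).div_const k).hasDerivWithinAt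
  have habs : ∀ s, |Real.exp s / k| • f (Real.exp s / k) = Real.exp s / k * f (Real.exp s / k) :=
    fun s => by rw [abs_of_pos (div_pos (Real.exp_pos s) hk), smul_eq_mul]
  rw [← himage, integrableOn_image_iff_integrableOn_abs_deriv_smul MeasurableSet.univ hd hinj,
    integral_image_eq_integral_abs_deriv_smul MeasurableSet.univ hd hinj]
  simp only [habs, Measure.restrict_univ, integrableOn_univ]
  exact ⟨hI, hA⟩

lemma tricomiSurf_add_pi_mul_sub_pi_ne_zero {a b : ℝ} (hΓ : Real.Gamma a ≠ 0)
    (hΓ' : Real.Gamma (a - b + 1) ≠ 0) (s : ℝ) :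
    tricomiSurf a b (s + Real.pi * Complex.I) * tricomiSurf a b (s - Real.pi * Complex.I) ≠ 0 := by
  have h := tricomiSurf_upper_mul_lower a b (Real.exp_pos s)
  rw [Real.log_exp] at h
  rw [h]
  exact_mod_cast (tricomiRe_sq_add_tricomiIm_sq_pos hΓ hΓ' (Real.exp_pos s)).ne'

lemma rGamma_ofReal_ne_zero {a : ℝ} (h : Real.Gamma a ≠ 0) : rGamma a ≠ 0 := by
  rw [← ofReal_Gamma_inv]
  exact_mod_cast inv_ne_zero h

lemma rGamma_sub_add_one_ne_zero {a b : ℝ} (h : Real.Gamma (a - b + 1) ≠ 0) :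
    rGamma ((a : ℂ) - b + 1) ≠ 0 := by
  have := rGamma_ofReal_ne_zero h
  push_cast at this
  exact this

/-- Regularity controls only the open strip; on its boundary lines zeros are excluded by the
Wronskian. -/
lemma IsRegularCase.tricomiSurf_ne_zero_of_le {k a b : ℝ} (hr : IsRegularCase k a b) (hk : 0 < k)
    (ha : a ≠ 0) (hΓ : Real.Gamma a ≠ 0) (hΓ' : Real.Gamma (a - b + 1) ≠ 0) {L : ℂ}
    (hL : |L.im| ≤ Real.pi) : tricomiSurf a b L ≠ 0 := by
  rcases hL.lt_or_eq with h | h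
  · exact hr.tricomiSurf_ne_zero hk ha (rGamma_ofReal_ne_zero hΓ) (rGamma_sub_add_one_ne_zero hΓ') h
  · obtain ⟨h1, h2⟩ := mul_ne_zero_iff.1 (tricomiSurf_add_pi_mul_sub_pi_ne_zero hΓ hΓ' L.re)
    rcases eq_or_eq_neg_of_abs_eq h with h | h
    · rwa [← h, Complex.re_add_im] at h1
    · rwa [sub_eq_add_neg, ← neg_mul, ← Complex.ofReal_neg, ← h, Complex.re_add_im] at h2

/-- In the regular case the coefficients of the asymptotic expansion of `U' / U` are the moments
of the density, up to elementary factors. -/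
theorem IsRegularCase.integrableOn_and_moment_eq {k a b : ℝ} (hr : IsRegularCase k a b)
    (hk : 0 < k) (ha : a ≠ 0) (hΓ : Real.Gamma a ≠ 0) (hΓ₁ : Real.Gamma (a + 1) ≠ 0)
    (hΓ' : Real.Gamma (a - b + 1) ≠ 0) {c : ℕ → ℂ} (hc : IsRiccatiSeries (a : ℂ) b c) {n : ℕ}
    (hn : 1 ≤ n) {A : ℝ} (hA : c n = (((-1) ^ n * a * k ^ (n - 1) * A : ℝ) : ℂ)) :
    IntegrableOn (fun x : ℝ => x ^ (n - 1) * muDensity k a b x) (Ioi 0) ∧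
      A = ∫ x in Ioi (0 : ℝ), x ^ (n - 1) * muDensity k a b x := by
  have hpi := Real.pi_pos
  have hne : ∀ L : ℂ, |L.im| ≤ Real.pi → tricomiSurf a b L ≠ 0 := fun L hL =>
    hr.tricomiSurf_ne_zero_of_le hk ha hΓ hΓ' hL
  have hyd : ∀ L : ℂ, |L.im| ≤ Real.pi → DifferentiableAt ℂ (tricomiLogDeriv a b) L := fun L hL =>
    (hasDerivAt_tricomiLogDeriv a b (hne L hL)).differentiableAt
  set D : ℝ := (-1) ^ n * a * k ^ (n - 1) with hD
  have hD0 : D ≠ 0 := by positivity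
  -- Since `dz = z dL`, integrating `g` in `L` is integrating `z^(n-1) U'/U` in `z`. On both lines
  -- `Im L = ±π` the factor `exp(n L)` equals `(-1)^n exp(n s)`, so it comes out of the jump.
  set g : ℂ → ℂ := fun L => Complex.exp (n * L) * tricomiLogDeriv a b L with hg
  have hgd : ∀ L : ℂ, |L.im| ≤ Real.pi → DifferentiableAt ℂ g L := fun L hL =>
    DifferentiableAt.mul (by fun_prop) (hyd L hL)
  set f : ℝ → ℝ := fun x => x ^ (n - 1) * muDensity k a b x with hf
  have hjump : ∀ s : ℝ, g (s + Real.pi * Complex.I) - g (s - Real.pi * Complex.I)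
      = 2 * Real.pi * Complex.I * ((D * (Real.exp s / k * f (Real.exp s / k)) : ℝ) : ℂ) := by
    intro s
    have hx : 0 < Real.exp s / k := div_pos (Real.exp_pos s) hk
    have hkx : k * (Real.exp s / k) = Real.exp s := mul_div_cancel₀ _ hk.ne'
    have hj := tricomiLogDeriv_jump ha hk hx (tricomiRe_sq_add_tricomiIm_sq_pos hΓ hΓ'
      (mul_pos hk hx)).ne'
    rw [hkx, Real.log_exp] at hj
    have e1 : Complex.exp (n * (s + Real.pi * Complex.I)) = (-1) ^ n * Complex.exp s ^ n := by
      rw [Complex.exp_nat_mul, Complex.exp_add, Complex.exp_pi_mul_I, ← mul_pow]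
      ring
    have e2 : Complex.exp (n * (s - Real.pi * Complex.I)) = (-1) ^ n * Complex.exp s ^ n := by
      rw [Complex.exp_nat_mul, Complex.exp_sub, Complex.exp_pi_mul_I, ← mul_pow]
      ring
    have hk' : (k : ℂ) ≠ 0 := by exact_mod_cast hk.ne'
    simp only [hg, e1, e2]
    rw [← mul_sub, hj]
    obtain ⟨m, rfl⟩ : ∃ m, n = m + 1 := ⟨n - 1, by omega⟩
    simp only [hD, hf, Nat.add_sub_cancel]
    push_cast
    rw [div_pow]
    field_simp
    ring
  obtain ⟨X₀, K₀, h₀⟩ := exists_norm_tricomiLogDeriv_le (rGamma_ofReal_ne_zero hΓ)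
    (rGamma_sub_add_one_ne_zero hΓ')
  -- As `13π/12 > π`, the expansion is uniform on the closed strip `|Im L| ≤ π`.
  obtain ⟨X, K, hX⟩ := hc.exists_norm_sub_le
    (fun L h1 h2 => hasDerivAt_tricomiLogDeriv a b (h₀ L h1 h2).1)
    (fun L h1 h2 => by
      rw [Complex.norm_exp, Complex.neg_re]
      exact (h₀ L h1 h2).2) n Real.pi (by linarith)
  have hright := tendsto_integral_exp_mul (fun L hL => (hyd L hL).continuousAt) hX
  have hleft : Tendsto (fun T : ℝ => ∫ φ in -Real.pi..Real.pi, g ((-T : ℝ) + φ * Complex.I))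
      atTop (𝓝 0) := by
    rw [Metric.tendsto_atTop]
    intro ε hε
    obtain ⟨Y, hY⟩ := hr.tendsto_exp_mul_tricomiLogDeriv hk ha
      (show 0 < ε / (4 * Real.pi) by positivity)
    refine ⟨max 0 (-Y) + 1, fun T hT => ?_⟩
    have hT0 : 0 < T := by linarith [le_max_left 0 (-Y)]
    have hTY : -T < Y := by linarith [le_max_right 0 (-Y)]
    rw [dist_zero_right]
    -- The condition `z F(z) → 0` is given only inside the cut plane, so the endpoint `φ = π` is
    -- discarded as a null set. As `n ≥ 1`, one factor `exp L` is used for that condition and the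
    -- others have norm at most `1`.
    refine (intervalIntegral.norm_integral_le_of_norm_le_const_ae
      (C := ε / (4 * Real.pi)) ?_).trans_lt ?_
    · filter_upwards [compl_mem_ae_iff.2 (measure_singleton Real.pi)] with φ hφ hφ'
      rw [uIoc_of_le (by linarith)] at hφ'
      have h1 := hY ((-T : ℝ) + φ * Complex.I) (by simpa using hTY)
        (by simpa using abs_lt.2 ⟨hφ'.1, lt_of_le_of_ne hφ'.2 hφ⟩)
      obtain ⟨m, rfl⟩ : ∃ m, n = m + 1 := ⟨n - 1, by omega⟩
      simp only [hg]
      rw [Complex.exp_nat_mul, pow_succ, mul_assoc, norm_mul, norm_pow]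
      refine (mul_le_of_le_one_left (norm_nonneg _) (pow_le_one₀ (norm_nonneg _) ?_)).trans h1
      rw [Complex.norm_exp, Real.exp_le_one_iff]
      simpa using hT0.le
    · rw [abs_of_pos (by linarith)]
      have : ε / (4 * Real.pi) * (Real.pi - -Real.pi) = ε / 2 := by field_simp; ring
      rw [this]
      linarith
  have hlim := tendsto_integral_jump_of_tendsto hgd hright hleft
  simp only [hjump, intervalIntegral.integral_const_mul, intervalIntegral.integral_ofReal] at hlim
  have hDc : (D : ℂ) ≠ 0 := by exact_mod_cast hD0
  have hpi' : (Real.pi : ℂ) ≠ 0 := by exact_mod_cast hpi.ne'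
  have hcancel : ∀ r : ℝ, ((2 * Real.pi * Complex.I * D)⁻¹
      * (2 * Real.pi * Complex.I * ((D * r : ℝ) : ℂ))).re = r := by
    intro r
    have h1 : (2 * Real.pi * Complex.I * D)⁻¹
        * (2 * Real.pi * Complex.I * ((D * r : ℝ) : ℂ)) = r := by
      rw [Complex.ofReal_mul D r]
      field_simp
    rw [h1, Complex.ofReal_re]
  have hlim' : Tendsto (fun T : ℝ => ∫ s in -T..T, Real.exp s / k * f (Real.exp s / k)) atTop
      (𝓝 A) := by
    have h1 := (Complex.continuous_re.tendsto _).comp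
      (hlim.const_mul (2 * Real.pi * Complex.I * D)⁻¹)
    have h2 : (2 * Real.pi * Complex.I * D)⁻¹ * (Complex.I * (2 * Real.pi * c n)) = (A : ℂ) := by
      rw [hA]
      push_cast
      field_simp
    rw [h2, Complex.ofReal_re] at h1
    refine h1.congr fun T => ?_
    exact hcancel _
  have hcont : Continuous fun s => Real.exp s / k * f (Real.exp s / k) := by
    have h1 : Continuous fun s : ℝ => ((2 * Real.pi * Complex.I * D)⁻¹
        * (g (s + Real.pi * Complex.I) - g (s - Real.pi * Complex.I))).re := by
      refine Complex.continuous_re.comp (continuous_const.mul (continuous_iff_continuousAt.2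
        fun s => ?_))
      have g1 : ContinuousAt g (s + Real.pi * Complex.I) :=
        (hgd _ (by simp [abs_of_pos hpi])).continuousAt
      have g2 : ContinuousAt g (s - Real.pi * Complex.I) :=
        (hgd _ (by simp [abs_of_pos hpi])).continuousAt
      exact (ContinuousAt.comp (f := fun s : ℝ => (s : ℂ) + Real.pi * Complex.I) g1
        (by fun_prop)).sub (ContinuousAt.comp (f := fun s : ℝ => (s : ℂ) - Real.pi * Complex.I) g2
        (by fun_prop))
    refine h1.congr fun s => ?_
    rw [hjump, hcancel]
  have hΓΓ : Real.Gamma (a + 1) * Real.Gamma (a - b + 1) ≠ 0 := mul_ne_zero hΓ₁ hΓ'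
  -- Here `σ` is the sign of `Γ(a+1) Γ(a-b+1)`, which is the constant sign of `μ`.
  refine integrableOn_and_integral_eq_of_tendsto_exp (k := k)
    (σ := Real.Gamma (a + 1) * Real.Gamma (a - b + 1)
      / |Real.Gamma (a + 1) * Real.Gamma (a - b + 1)|) hk hcont
    (by rw [abs_div, abs_abs, div_self (abs_ne_zero.2 hΓΓ)]) (fun x hx => ?_) hlim'
  have h1 := Gamma_mul_muDensity_pos hk hΓ₁ hΓ' hx
    (tricomiRe_sq_add_tricomiIm_sq_pos hΓ hΓ' (mul_pos hk hx))
  rw [hf, div_mul_eq_mul_div, mul_left_comm]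
  positivity

/-! ### Assembly of the three statements -/

lemma Real.Gamma_ne_zero_of_forall_ne {s : ℝ} (h : ∀ m : ℕ, 1 ≤ m → s ≠ -(m : ℝ)) :
    Real.Gamma (s + 1) ≠ 0 := by
  refine Real.Gamma_ne_zero fun m hm => h (m + 1) (by omega) ?_
  push_cast
  linarith

theorem mainTheorem2 (α₁ α₂ α₃ k a b : ℝ) (hα₁ : 0 < α₁) (hα₃ : α₃ ≠ 0)
    (hk : k = 1 / α₁) (ha : a = α₃ / α₁) (hb : b = -1 - α₂ / α₁)
    (u : ℕ → ℝ) (hu : IsSelfConvolutive α₁ α₂ α₃ u) :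
    -- boundary values of `U` on the two sides of the cut
    (∀ x : ℝ, 0 < x →
      Tendsto (fun ε : ℝ => tricomiU a b (-(x : ℂ) + ε * Complex.I)) (𝓝[>] 0)
        (𝓝 ((tricomiRe a b x : ℂ) + tricomiIm a b x * Complex.I)) ∧
      Tendsto (fun ε : ℝ => tricomiU a b (-(x : ℂ) - ε * Complex.I)) (𝓝[>] 0)
        (𝓝 ((tricomiRe a b x : ℂ) - tricomiIm a b x * Complex.I))) ∧
    -- the jump of `F` across the cut, divided by `2πi`, is `μ`
    (∀ x : ℝ, 0 < x → tricomiRe a b (k * x) ^ 2 + tricomiIm a b (k * x) ^ 2 ≠ 0 →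
      Tendsto (fun ε : ℝ => (1 / (2 * (Real.pi : ℂ) * Complex.I)) *
          (genF k a b (-(x : ℂ) + ε * Complex.I) - genF k a b (-(x : ℂ) - ε * Complex.I)))
        (𝓝[>] 0) (𝓝 (muDensity k a b x : ℂ))) ∧
    ((∀ m : ℕ, 1 ≤ m → a ≠ -(m : ℝ) ∧ a - b ≠ -(m : ℝ)) →
      -- positivity up to the constant factor
      (∀ x : ℝ, 0 < x →
        0 < tricomiRe a b (k * x) ^ 2 + tricomiIm a b (k * x) ^ 2 ∧
        0 < Real.Gamma (a + 1) * Real.Gamma (a - b + 1) * muDensity k a b x) ∧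
      -- in the regular case the sequence consists of the moments of `μ`
      (IsRegularCase k a b → ∀ n : ℕ, 1 ≤ n →
        IntegrableOn (fun x : ℝ => x ^ (n - 1) * muDensity k a b x) (Ioi 0) ∧
        u n = ∫ x in Ioi (0 : ℝ), x ^ (n - 1) * muDensity k a b x)) := by
  have hk0 : 0 < k := by rw [hk]; positivity
  have ha0 : a ≠ 0 := by rw [ha]; exact div_ne_zero hα₃ hα₁.ne'
  refine ⟨fun x hx => ⟨tendsto_tricomiU_upper a b hx, tendsto_tricomiU_lower a b hx⟩,
    fun x hx h => tendsto_genF_jump ha0 hk0 hx h, fun h => ?_⟩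
  have hΓ₁ : Real.Gamma (a + 1) ≠ 0 := Real.Gamma_ne_zero_of_forall_ne fun m hm => (h m hm).1
  have hΓ' : Real.Gamma (a - b + 1) ≠ 0 := Real.Gamma_ne_zero_of_forall_ne fun m hm => (h m hm).2
  have hΓ : Real.Gamma a ≠ 0 := fun h0 => hΓ₁ (by rw [Real.Gamma_add_one ha0, h0, mul_zero])
  refine ⟨fun x hx => ?_, fun hr n hn => ?_⟩
  · have hpos := tricomiRe_sq_add_tricomiIm_sq_pos hΓ hΓ' (mul_pos hk0 hx)
    exact ⟨hpos, Gamma_mul_muDensity_pos hk0 hΓ₁ hΓ' hx hpos⟩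
  · exact hr.integrableOn_and_moment_eq hk0 ha0 hΓ hΓ₁ hΓ'
      (isRiccatiSeries_of_isSelfConvolutive hα₁ hk ha hb hu) hn (by rw [if_neg (by omega)])
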